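/- Let $\mathbb F$ be an algebraically closed field and let $\mathfrak g$ be the simple Lie algebra of one of the types $A_n$ ($2\le n\le 7$), $B_n$ ($2\le n\le 7$), $C_n$ ($2\le n\le 7$), $D_n$ ($4\le n\le 8$), realized as $\mathfrak{sl}_{n+1}(\mathbb F)$, $\mathfrak{so}_{2n+1}(\mathbb F)$, $\mathfrak{sp}_{2n}(\mathbb F)$, $\mathfrak{so}_{2n}(\mathbb F)$ respectively. In types $B$, $C$, $D$ the coordinates are labelled, in this order, $1,\dots,n,(0,)-n,\dots,-1$ (the label $0$ occurs only in type $B$), and $\mathfrak g$ preserves the form $\sum_{i=1}^n(u_iv_{-i}+u_{-i}v_i)$ in type $D$, the same form plus $u_0v_0$ in type $B$, and $\sum_{i=1}^n(u_iv_{-i}-u_{-i}v_i)$ in type $C$. Assume that $\operatorname{char}\mathbb F$ is $0$ or greater than $\dim\mathfrak g$. Let $\mathfrak n$ be the Lie algebra of strictly upper-triangular matrices in $\mathfrak g$ and let $N=\exp(\mathfrak n)$ act on $\mathfrak n^*$ by the coadjoint action. Let $\Phi^+$ be the set of positive roots: it consists of the $\varepsilon_i-\varepsilon_j$ ($i<j$)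 and, besides, of the $\varepsilon_i+\varepsilon_j$ ($i<j$) in types $B$, $C$, $D$, the $\varepsilon_i$ in type $B$ and the $2\varepsilon_i$ in type $C$. Let $e_\alpha\in\mathfrak n$ ($\alpha\in\Phi^+$) be root vectors. For $f\in\mathfrak n^*$ put $\operatorname{Supp}(f)=\{\alpha\in\Phi^+: f(e_\alpha)\ne0\}$ and $\operatorname{NSupp}(f)=\bigcup_{f'\in N.f}\operatorname{Supp}(f')$. The form $f$ and its orbit $N.f$ are called extensive if $\alpha+\beta\in\operatorname{NSupp}(f)$ for all distinct simple roots $\alpha,\beta$ with $(\alpha,\beta)\ne0$. For $S\subset\Phi^+$ let $V(S)=\{f\in\mathfrak n^*:\operatorname{Supp}(f)=S\}$. The dimension of an orbit is its dimension as an algebraic variety. Number the positive roots $\alpha_1,\alpha_2,\dots$ by increasing height; among roots of the same height, by decreasing first index $i$ of $\varepsilon_i\pm\varepsilon_j$, $\varepsilon_i$, $2\varepsilon_i$; in type $D_n$ put $\varepsilon_i+\varepsilon_n$ before $\varepsilon_i-\varepsilon_n$. To a string $\mathcal S$ of letters S, A, I, L, completed on the right by letters I up to length $|\Phi^+|$,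 attach the set $S(\mathcal S)$ of all $\alpha_j$ such that the $j$-th letter of $\mathcal S$ is S. Consider the following $1512$ strings for the 19 root systems shown, where each asterisk stands for either of the letters S and I (so that a pattern with $k$ asterisks stands for $2^k$ strings); letters I at the end are omitted. For $A_2$, $A_3$, $B_2$, $C_2$ the list of strings is empty. - $A_4$ (6 strings): `A**AAILLLS`, `LAA*LALSS`. - $A_5$ (32 strings): `A**ALAILSILIS`, `A*A*ALLLISIS`, `A*AALLLSSS`, `A*ALALL*SSIS`, `A*LALAL*SSIIS`, `LA**ASAILILIIS`, `LAA*ASSLLIIS`, `LAL*AS*LAIISIS`, `LLA**LAAISSS`. - $A_6$ (65 strings): `A*A*ALLLI*SSIS`, `A*ALALILSISSIS`, `A*ALALILSSSSI*`, `ALALALS*SISSIS`, `ALALALS*SSSSI*`, `LA**ALSAILSIIIIIS`, `LA*A*ASLILIISIS`, `LA*AALSLISSIS`, `LA*ALASLI*SISIS`, `LA*LALSAI*SISIIIS`, `LAA*ALSSILSIIS`, `LAALALSSS*SIIS`, `LAL*A*S*LASIISIIS`, `LALA*ASISLIISIS`, `LALA*ASSSLII*IS`, `LALAALSISSSIS`,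 `LALAALSSSSSI*`, `LALALASIS*SISIS`, `LALALASSS*SI*IS`. - $A_7$ (50 strings): `LA*A*ALSLII*SISIS`, `LA*ALALS*ISISISIS`, `LA*ALALS*ISSSISI*`, `LALA*ALSIS*ISISIS`, `LALA*ALSSS*ISI*IS`, `LALALA*SISISSISIS`, `LALALA*SISSSSISI*`, `LALALA*SSSISSI*IS`, `LALALA*SSSSSSI*I*`. - $B_3$ (4 strings): `*A*AALLLS`. - $B_4$ (38 strings): `*A*LAALILSIIS`, `A**A*IALIILLIS`, `A**AAIL*LLIS`, `AA*ALLLSIS`, `AL*A*LA*ISILIS`, `LA*LAALS*SIIS`, `LAA*LALISS`, `LAL*AALSSS`. - $B_5$ (131 strings): `A**AL*IASLIIIILIIS`, `A**ALAILS*ILIIS`, `A*A*AI*LLILISS`, `A*A*AL*LLS*ISS`, `A*A*ALLLI*SIS`, `A*AAL*ISSLLIIS`, `A*AALLLSS*S`, `A*ALALL*S*SIS`, `A*LAL*I*SAIIISLIIS`, `A*LALAL*S*SIIIS`, `AA*ALLILSSIS`, `AALALLSISSIS`, `AALALLSSSSI*`, `AL*A**LAS*ISIILIIS`, `ALA*ALSLISIIS`,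 `ALA*AS*LLI*ISS`, `ALAAL*SSS*LIIS`, `ALALALS*SSIIS`, `LA**ASAILIILIIIS`, `LAA*ASSLLIIIS`, `LAL*AS*LAIIISIIS`, `LLA**LAAIISSS`. - $B_6$ (175 strings): `A*A*ALI*ILSILISIS`, `A*A*ALL*ILSS*ISIS`, `A*A*ALLLI*S*SIS`, `A*ALALI*SISILISIS`, `A*ALALI*SSSILI*IS`, `A*ALALILSISISIS`, `A*ALALILSSSISI*`, `A*ALALLISISSIISIS`, `A*ALALLISISSSISI*`, `A*ALALLISSSSII*IS`, `A*ALALLISSSSSI*I*`, `A*ALALLSSISS*ISI*`, `A*ALALLSSSSS*I*I*`, `ALA*ALLSI*SSIIS`, `ALA*ALS*ILSI*ISIS`, `ALALALS*SISIIISIS`, `ALALALS*SISISISI*`, `ALALALS*SSSIII*IS`, `ALALALS*SSSISI*I*`, `LA**ALSAILSIIIIIIIS`, `LA*A*ASLILIIISIS`, `LA*AALSLISSIIS`, `LA*ALASLI*SIISIS`, `LA*LALSAI*SIISIIIIS`, `LAA*ALSSILSIIIS`, `LAALALSSS*SIIIS`, `LAL*A*S*LASIIISIIIS`, `LALA*ASISLIIISIS`,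 `LALA*ASSSLIII*IS`, `LALAALSISSSIIS`, `LALAALSSSSSII*`, `LALALASIS*SIISIS`, `LALALASSS*SII*IS`. - $B_7$ (50 strings): `LA*A*ALSLII*SIISIS`, `LA*ALALS*ISISIISIS`, `LA*ALALS*ISSSIISI*`, `LALA*ALSIS*ISIISIS`, `LALA*ALSSS*ISII*IS`, `LALALA*SISISSIISIS`, `LALALA*SISSSSIISI*`, `LALALA*SSSISSII*IS`, `LALALA*SSSSSSII*I*`. - $C_3$ (5 strings): `*AAALLLS`, `*AALASLLS`, `ALASAILLS`. - $C_4$ (55 strings): `***AIIAIIAILILLS`, `*AA*LASSLILIS`, `*AAL*AL*ISLIS`, `*AAL*ALLISS`, `*AALALS*LIS`, `*AALLAL*SS*IS`, `A**AAILILLIS`, `AAALLLSSS`, `AL*AAIISLLIS`, `ALA*SASILILIS`, `ALLAAISS*LIS`, `LAA*LAL*SS*`. - $C_5$ (106 strings): `***A*IIASIIAIILIILILIS`, `**A*AIAL*ILISLIIS`, `**AALIASSILIILIIS`, `*A**ALAILSILIIIS`, `*AA*ALSLLSIIS`, `*AL*AL*LASIISIIS`, `*LAL*IAALI*SSIIIS`,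 `A**ALAILSIILIIS`, `A*A*ALLLIISIS`, `A*AALLLSSIS`, `A*ALALL*SISIS`, `A*LALAL*SISIIIS`, `AL*ALAI*SSILIIS`, `AL*ALALISSSIIIS`, `AL*ALALSSSSIII*`, `LA**ASAILIILIIIS`, `LAA*ASSLLIIIS`, `LAL*AS*LAIIISIIS`, `LLA**LAAIISSS`. - $C_6$ (195 strings): `**A*ALIA**SILISILIIIS`, `**A*ALIASSSILIIILIIIS`, `*A**ALLAILSSIIIIIIS`, `*A*A*ALLILISISIS`, `*A*AALLLISSSIS`, `*A*ALALLI*SSISIS`, `*A*LAL*AL*SSISIIIIS`, `*AA*ALLSILSSIIS`, `*AALALLSSISSIIS`, `*AALALLSSSSSII*`, `*AL*ALL*IASSIISIIIS`, `*ALA*ALISLISISIS`, `*ALA*ALSSLISI*IS`, `*ALAALL*SSSSIS`, `*ALALALIS*SSISIS`, `*ALALALSS*SSI*IS`, `A*A*ALLLI*SISIS`, `A*ALALILSISISIS`, `A*ALALILSSSISI*`, `ALALALS*SISISIS`, `ALALALS*SSSISI*`, `LA**ALSAILSIIIIIIIS`, `LA*A*ASLILIIISIS`, `LA*AALSLISSIIS`,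 `LA*ALASLI*SIISIS`, `LA*LALSAI*SIISIIIIS`, `LAA*ALSSILSIIIS`, `LAALALSSS*SIIIS`, `LAL*A*S*LASIIISIIIS`, `LALA*ASISLIIISIS`, `LALA*ASSSLIII*IS`, `LALAALSISSSIIS`, `LALAALSSSSSII*`, `LALALASIS*SIISIS`, `LALALASSS*SII*IS`. - $C_7$ (150 strings): `*A*A*ALLLII*SSISIS`, `*A*ALALLI*SISSISIS`, `*A*ALALLI*SSSSISI*`, `*ALA*ALLISI*SSISIS`, `*ALA*ALLSSI*SSI*IS`, `*ALALAL*SISISSISIS`, `*ALALAL*SISSSSISI*`, `*ALALAL*SSSISSI*IS`, `*ALALAL*SSSSSSI*I*`, `LA*A*ALSLII*SIISIS`, `LA*ALALS*ISISIISIS`, `LA*ALALS*ISSSIISI*`, `LALA*ALSIS*ISIISIS`, `LALA*ALSSS*ISII*IS`, `LALALA*SISISSIISIS`, `LALALA*SISSSSIISI*`, `LALALA*SSSISSII*IS`, `LALALA*SSSSSSII*I*`. - $D_4$ (24 strings): `AA*A*IILLLS`, `AA*ALLLSSS`, `AAALLLSS`, `AALA*ISILLS`, `AALA*SILILS`, `AALA*SS*LLS`,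 `AALALISS*LS`, `AALALLSSIS`, `AALALLSSS`, `AALALSI*SLS`, `AALALSLISS`, `ALAALSLIS`, `LAAASLLIIS`. - $D_5$ (92 strings): `AA*ALII*SILLIS`, `AA*ALLLISSIIIS`, `AA*ALLLISSISI*`, `AA*ALLLISSS*I*`, `AA*ALLLSSS**I*`, `AALA*LSLSISS`, `AALALIS*SIILIS`, `AALALISLSIS*IS`, `AALALSI*SILIIS`, `AALALSILSI*SIS`, `AALALSS*SI*LIS`, `AL**AALIISLIIIS`, `AL*LAALISS*IIIS`, `ALAAL*SLSIS`, `L***ALIIAILIAISS`, `L*AA*LIALISSS`, `LA**ALAIISILIIIS`, `LA*LALAISSI*IIIS`, `LAAALS*LSIIS`, `LLAA*LSA*IS*S`, `LLAA*SLA*IISS`. - $D_6$ (104 strings): `AL**ALALI*SS*IIIIS`, `AL**ALALISSSS`, `L***A*LIIASILIAIISS`, `L**A*ALIALIISSIS`, `L**AALLIASSISS`, `L**ALALIA*SISSIS`, `L*A**ASSAILIIILIIIIS`, `L*AA*ASSSLLIIIIS`, `L*AL*ASS*LAIIIISIIIS`, `L*LA**LIAAIISSSS`, `LA**ALLAI*SSI*IIIIS`,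 `LA**ALLAISSSIS`. - $D_7$ (130 strings): `L**A*ALLIA**SISSIS`, `L**A*ALLIASSSISS`, `L*A**ALSSAILSIIIIIIIIIS`, `L*A*A*ASSLILIIIISIS`, `L*A*AALSSLISSIIIS`, `L*A*ALASSLI*SIIISIS`, `L*A*LALSSAI*SIIISIIIIIS`, `L*AA*ALSSSILSIIIIS`, `L*AALALSSSS*SIIIIS`, `L*AL*A*SS*LASIIIISIIIIS`, `L*ALA*ASSISLIIIISIS`, `L*ALA*ASSSSLIIII*IS`, `L*ALAALSSISSSIIIS`, `L*ALAALSSSSSSIII*`, `L*ALALASSIS*SIIISIS`, `L*ALALASSSS*SIII*IS`. - $D_8$ (100 strings): `L*A*A*ALSSLII*SIIISIS`, `L*A*ALALSS*ISISIIISIS`, `L*A*ALALSS*ISSSIIISI*`, `L*ALA*ALSSIS*ISIIISIS`, `L*ALA*ALSSSS*ISIII*IS`, `L*ALALA*SSISISSIIISIS`, `L*ALALA*SSISSSSIIISI*`, `L*ALALA*SSSSISSIII*IS`, `L*ALALA*SSSSSSSIII*I*`. **Theorem.** For each of these Lie algebras the strings list all extensive coadjoint orbits of dimension $6$. That is, let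 $\mathcal S_1,\dots,\mathcal S_r$ be the strings of the list of $\mathfrak g$ and $S_k=S(\mathcal S_k)$. Then 1. the sets $V(S_1),\dots,V(S_r)$ are pairwise disjoint; 2. for every $f\in V(S_1)\sqcup\dots\sqcup V(S_r)$ the orbit $N.f$ is extensive and $\dim N.f=6$; 3. every extensive coadjoint orbit of dimension $6$ in $\mathfrak n^*$ meets $V(S_1)\sqcup\dots\sqcup V(S_r)$ in exactly one point. -/

import Mathlib

/-!
Coadjoint orbits of the nilradical of a Borel subalgebra of a classical simple Lie algebra,
realized by strictly upper-triangular matrices.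
-/

namespace ClassicalOrbits

open Matrix

attribute [local instance] LieRing.ofAssociativeRing

/-- The four classical series. -/
inductive ClassicalType
  | A | B | C | D
  deriving DecidableEq

/-- Size of the matrices of the natural realization of the Lie algebra of type `X` and rank `n`:
`sl (n+1)`, `so (2n+1)`, `sp (2n)`, `so (2n)`. -/
@[reducible] def size : ClassicalType → ℕ → ℕ
  | .A, n => n + 1
  | .B, n => 2 * n + 1
  | .C, n => 2 * n
  | .D, n => 2 * n

/-- Number of the coordinates `ε_i` used to write the roots. -/
@[reducible] def numEps : ClassicalType → ℕ → ℕ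
  | .A, n => n + 1
  | .B, n => n
  | .C, n => n
  | .D, n => n

/-- Gram matrix of `∑ i, (u_i v_{-i} + u_{-i} v_i)` (plus `u_0 v_0` if `m` is odd). Rows and columns
`0, 1, …, m - 1` stand for the labels `1, …, n, (0,) -n, …, -1`, so that the label `-i` is the
position `Fin.rev i`. -/
def symmGram (F : Type*) [Field F] (m : ℕ) : Matrix (Fin m) (Fin m) F :=
  Matrix.of fun i j => if j = i.rev then 1 else 0

/-- Gram matrix of `∑ i, (u_i v_{-i} - u_{-i} v_i)`, with the same labelling. -/
def skewGram (F : Type*) [Field F] (m : ℕ) : Matrix (Fin m) (Fin m) F :=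
  Matrix.of fun i j => if j = i.rev then (if i < i.rev then 1 else -1) else 0

/-- The classical simple Lie algebra of type `X` and rank `n`. -/
def simpleLie (F : Type*) [Field F] (X : ClassicalType) (n : ℕ) :
    LieSubalgebra F (Matrix (Fin (size X n)) (Fin (size X n)) F) :=
  match X with
  | .A => LieAlgebra.SpecialLinear.sl (Fin (size .A n)) F
  | .B => skewAdjointMatricesLieSubalgebra (symmGram F (size .B n))
  | .C => skewAdjointMatricesLieSubalgebra (skewGram F (size .C n))
  | .D => skewAdjointMatricesLieSubalgebra (symmGram F (size .D n))

/-- The Lie algebra of strictly upper-triangular matrices. -/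
def strictUpper (F : Type*) [Field F] (m : ℕ) : LieSubalgebra F (Matrix (Fin m) (Fin m) F) where
  carrier := {x | ∀ i j, j ≤ i → x i j = 0}
  add_mem' {x y} hx hy i j h := by simp [hx i j h, hy i j h]
  zero_mem' i j _ := rfl
  smul_mem' c x hx i j h := by simp [hx i j h]
  lie_mem' {x y} hx hy i j h := by
    have key : ∀ a b : Matrix (Fin m) (Fin m) F, (∀ i j, j ≤ i → a i j = 0) →
        (∀ i j, j ≤ i → b i j = 0) → (a * b) i j = 0 := by
      intro a b ha hb
      rw [Matrix.mul_apply]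
      refine Finset.sum_eq_zero fun k _ => ?_
      rcases le_total k i with hk | hk
      · rw [ha i k hk, zero_mul]
      · rw [hb k j (h.trans hk), mul_zero]
    rw [Ring.lie_def, Matrix.sub_apply, key x y hx hy, key y x hy hx, sub_zero]

/-- The nilradical `𝔫` of the Borel subalgebra of upper-triangular matrices: the strictly
upper-triangular matrices of the simple Lie algebra. -/
def nilradical (F : Type*) [Field F] (X : ClassicalType) (n : ℕ) :
    LieSubalgebra F (Matrix (Fin (size X n)) (Fin (size X n)) F) :=
  strictUpper F (size X n) ⊓ simpleLie F X n

/-! ### Positive roots -/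

/-- The matrix cells which carry positive roots: the cells above the diagonal in type `A`, those
among them which are above the antidiagonal (types `B`, `D`), or on or above it (type `C`). -/
def IsRootCell (X : ClassicalType) (n : ℕ) (c : Fin (size X n) × Fin (size X n)) : Prop :=
  match X with
  | .A => c.1 < c.2
  | .B => c.1 < c.2 ∧ c.2 < c.1.rev
  | .C => c.1 < c.2 ∧ c.2 ≤ c.1.rev
  | .D => c.1 < c.2 ∧ c.2 < c.1.rev

instance (X : ClassicalType) (n : ℕ) : DecidablePred (IsRootCell X n) := fun c => by
  cases X <;> (unfold IsRootCell; infer_instance)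

/-- The positive roots, encoded by their cells; the root itself is `PosRoot.vec`. -/
abbrev PosRoot (X : ClassicalType) (n : ℕ) : Type := {c // IsRootCell X n c}

/-- The weight of the basis vector with position `i` of the natural representation: the labels
`i`, `0`, `-i` have weights `ε_i`, `0`, `-ε_i`. -/
def weight (X : ClassicalType) (n : ℕ) (i : Fin (size X n)) : Fin (numEps X n) → ℤ :=
  match X with
  | .A => fun k => if k.val = i.val then 1 else 0
  | .B | .C | .D => fun k => if k.val = i.val then 1 else if k.val = i.rev.val then -1 else 0

/-- The root of the cell `(i, j)` as an integral vector, `weight i - weight j`. So the cells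
`(i, j)`, `(i, -j)`, `(i, 0)`, `(i, -i)` with labels `i < j` give `ε_i - ε_j`, `ε_i + ε_j`, `ε_i`
and `2 ε_i`. -/
def PosRoot.vec {X : ClassicalType} {n : ℕ} (α : PosRoot X n) : Fin (numEps X n) → ℤ :=
  weight X n α.1.1 - weight X n α.1.2

/-- The matrix of the root vector `e_α`. With labels: `e_{i,j}` in type `A`;
`e_{i,j} - e_{-j,-i}` for `ε_i - ε_j` in types `B`, `C`, `D`; `e_{i,-j} - e_{j,-i}` (types `B`, `D`)
or `e_{i,-j} + e_{j,-i}` (type `C`) for `ε_i + ε_j`; `e_{i,0} - e_{0,-i}` for `ε_i`; `e_{i,-i}` for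
`2 ε_i`. -/
def rootMatrix (F : Type*) [Field F] {X : ClassicalType} {n : ℕ} (α : PosRoot X n) :
    Matrix (Fin (size X n)) (Fin (size X n)) F :=
  match X, α with
  | .A, α => single α.1.1 α.1.2 1
  | .B, α => single α.1.1 α.1.2 1 - single α.1.2.rev α.1.1.rev 1
  | .C, α => if α.1.2 = α.1.1.rev then single α.1.1 α.1.2 1 else
      if α.1.2 < α.1.2.rev then single α.1.1 α.1.2 1 - single α.1.2.rev α.1.1.rev 1
      else single α.1.1 α.1.2 1 + single α.1.2.rev α.1.1.rev 1
  | .D, α => single α.1.1 α.1.2 1 - single α.1.2.rev α.1.1.rev 1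

theorem mem_skew_iff {F : Type*} [Field F] {m : ℕ} (J x : Matrix (Fin m) (Fin m) F) :
    x ∈ skewAdjointMatricesLieSubalgebra J ↔ xᵀ * J = J * (-x) := by
  rw [mem_skewAdjointMatricesLieSubalgebra, mem_skewAdjointMatricesSubmodule]
  rfl

theorem mem_symm_iff {F : Type*} [Field F] {m : ℕ} (x : Matrix (Fin m) (Fin m) F) :
    x ∈ skewAdjointMatricesLieSubalgebra (symmGram F m) ↔
      ∀ i j : Fin m, x j.rev i = - x i.rev j := by
  rw [mem_skew_iff, ← Matrix.ext_iff]
  refine forall₂_congr fun i j => ?_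
  have h : ∀ k : Fin m, (j = k.rev) = (k = j.rev) := fun k => by
    rw [eq_iff_iff]; constructor <;> (rintro rfl; simp)
  simp [Matrix.mul_apply, symmGram, h]

theorem mem_alt_iff {F : Type*} [Field F] {m : ℕ} (x : Matrix (Fin m) (Fin m) F) :
    x ∈ skewAdjointMatricesLieSubalgebra (skewGram F m) ↔
      ∀ i j : Fin m, x j.rev i * (if j.rev < j then 1 else -1) =
        - ((if i < i.rev then 1 else -1) * x i.rev j) := by
  rw [mem_skew_iff, ← Matrix.ext_iff]
  refine forall₂_congr fun i j => ?_
  have h : ∀ k : Fin m, (j = k.rev) = (k = j.rev) := fun k => by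
    rw [eq_iff_iff]; constructor <;> (rintro rfl; simp)
  simp [Matrix.mul_apply, skewGram, h]

theorem single_sub_mem_symm {F : Type*} [Field F] {m : ℕ} (p q : Fin m) :
    single p q (1 : F) - single q.rev p.rev 1 ∈
      skewAdjointMatricesLieSubalgebra (symmGram F m) := by
  rw [mem_symm_iff]
  intro i j
  have h1 : (q.rev = j.rev) = (q = j) := by simp
  have h2 : (p.rev = i) = (p = i.rev) := by
    rw [eq_iff_iff]; constructor <;> (rintro rfl; simp)
  have h3 : (q.rev = i.rev) = (q = i) := by simp
  have h4 : (p.rev = j) = (p = j.rev) := by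
    rw [eq_iff_iff]; constructor <;> (rintro rfl; simp)
  simp only [Matrix.sub_apply, Matrix.single_apply, h1, h2, h3, h4, and_comm, neg_sub]

theorem type_c_mem_alt {F : Type*} [Field F] {n : ℕ} (p q : Fin (2 * n)) (h : p < q)
    (h' : q ≤ p.rev) :
    (if q = p.rev then single p q (1 : F) else
      if q < q.rev then single p q 1 - single q.rev p.rev 1
      else single p q 1 + single q.rev p.rev 1) ∈
      skewAdjointMatricesLieSubalgebra (skewGram F (2 * n)) := by
  rw [mem_alt_iff]
  intro i j
  have hp := p.2
  have hq := q.2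
  have hi := i.2
  have hj := j.2
  simp only [Fin.lt_def, Fin.le_def, Fin.val_rev, Fin.ext_iff] at h h' ⊢
  by_cases c1 : q.val = 2 * n - (p.val + 1)
  · rw [if_pos c1]
    simp only [Matrix.single_apply, Fin.ext_iff, Fin.val_rev]
    split_ifs <;> first | omega | simp
  · rw [if_neg c1]
    by_cases c2 : q.val < 2 * n - (q.val + 1)
    · rw [if_pos c2]
      simp only [Matrix.sub_apply, Matrix.single_apply, Fin.ext_iff, Fin.val_rev]
      split_ifs <;> first | omega | simp
    · rw [if_neg c2]
      simp only [Matrix.add_apply, Matrix.single_apply, Fin.ext_iff, Fin.val_rev]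
      split_ifs <;> first | omega | simp

theorem rootMatrix_mem (F : Type*) [Field F] {X : ClassicalType} {n : ℕ} (α : PosRoot X n) :
    rootMatrix F α ∈ nilradical F X n := by
  obtain ⟨⟨p, q⟩, h⟩ := α
  refine ⟨?_, ?_⟩
  · have key : ∀ {m : ℕ} (p q : Fin m), p < q → ∀ i j : Fin m, j ≤ i →
        single p q (1 : F) i j = 0 := by
      intro m p q hpq i j hij
      rw [Matrix.single_apply, if_neg]
      rintro ⟨rfl, rfl⟩
      exact absurd hpq (not_lt.2 hij)
    intro i j hij
    cases X
    · exact key p q h i j hij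
    · simp [rootMatrix, key p q h.1 i j hij, key q.rev p.rev (Fin.rev_lt_rev.2 h.1) i j hij]
    · simp only [rootMatrix]
      split_ifs <;>
        simp [key p q h.1 i j hij, key q.rev p.rev (Fin.rev_lt_rev.2 h.1) i j hij]
    · simp [rootMatrix, key p q h.1 i j hij, key q.rev p.rev (Fin.rev_lt_rev.2 h.1) i j hij]
  · cases X
    · change Matrix.trace (single p q (1 : F)) = 0
      have hpq : p < q := h
      exact Matrix.trace_single_eq_of_ne _ _ _ hpq.ne
    · exact single_sub_mem_symm p q
    · exact type_c_mem_alt p q h.1 h.2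
    · exact single_sub_mem_symm p q

/-- The root vector `e_α` as an element of `𝔫`. -/
def rootVector (F : Type*) [Field F] {X : ClassicalType} {n : ℕ} (α : PosRoot X n) :
    nilradical F X n :=
  ⟨rootMatrix F α, rootMatrix_mem F α⟩

/-- A positive root is simple if it is not a sum of two positive roots. -/
def IsSimpleRoot {X : ClassicalType} {n : ℕ} (α : PosRoot X n) : Prop :=
  ¬ ∃ β γ : PosRoot X n, α.vec = β.vec + γ.vec

/-- Two distinct roots are adjacent if their scalar product is nonzero. -/
def Adjacent {X : ClassicalType} {n : ℕ} (α β : PosRoot X n) : Prop :=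
  α ≠ β ∧ α.vec ⬝ᵥ β.vec ≠ 0

/-! ### The coadjoint action of the unipotent group `N = exp 𝔫` -/

/-- `exp (ad x)`. In a nilpotent Lie algebra the terms with `k ≥ dim L` vanish. -/
noncomputable def expAd (F : Type*) [Field F] {L : Type*} [LieRing L] [LieAlgebra F L] (x : L) : L →ₗ[F] L :=
  ∑ k ∈ Finset.range (Module.finrank F L), ((Nat.factorial k : F)⁻¹) • (LieAlgebra.ad F L x ^ k)

/-- The group of the operators `Ad g` on a nilpotent Lie algebra `L`, for `g` in the unipotent group
`exp L`: it is generated by (and consists of) the operators `Ad (exp x) = exp (ad x)`. -/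
def adjointGroup (F : Type*) [Field F] (L : Type*) [LieRing L] [LieAlgebra F L] :
    Subgroup (L ≃ₗ[F] L) :=
  Subgroup.closure {g | ∃ x : L, (g : L →ₗ[F] L) = expAd F x}

/-- The coadjoint orbit of a linear form: the forms `y ↦ f (Ad g⁻¹ y)`. -/
def coadjointOrbit {F : Type*} [Field F] {L : Type*} [LieRing L] [LieAlgebra F L]
    (f : Module.Dual F L) : Set (Module.Dual F L) :=
  {f' | ∃ g ∈ adjointGroup F L, f' = f ∘ₗ ((g⁻¹ : L ≃ₗ[F] L) : L →ₗ[F] L)}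

/-- The dimension of a subset of the affine space `F ^ σ` in the Zariski topology: the Krull
dimension of the ring of the polynomial functions on it. -/
noncomputable def zariskiDim {F : Type*} [Field F] {σ : Type*} (S : Set (σ → F)) : WithBot ℕ∞ :=
  ringKrullDim (MvPolynomial σ F ⧸ MvPolynomial.vanishingIdeal F S)

section LinearForms

variable {F : Type*} [Field F] {X : ClassicalType} {n : ℕ}

/-- The coordinates of a linear form on `𝔫` in the basis dual to the root vectors. -/
def coords (f : Module.Dual F (nilradical F X n)) : PosRoot X n → F :=
  fun α => f (rootVector F α)

/-- The dimension of the coadjoint orbit `N.f` as a subvariety of `𝔫*`. -/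
noncomputable def orbitDim (f : Module.Dual F (nilradical F X n)) : WithBot ℕ∞ :=
  zariskiDim (coords '' coadjointOrbit f)

/-- `Supp f`. -/
def supp (f : Module.Dual F (nilradical F X n)) : Set (PosRoot X n) :=
  {α | f (rootVector F α) ≠ 0}

/-- `NSupp f`, the union of the supports of all forms in the orbit of `f`. -/
def nsupp (f : Module.Dual F (nilradical F X n)) : Set (PosRoot X n) :=
  ⋃ f' ∈ coadjointOrbit f, supp f'

/-- `α` and `β` are `f`-adjacent if they are adjacent and `α + β ∈ NSupp f`. -/
def FAdjacent (f : Module.Dual F (nilradical F X n)) (α β : PosRoot X n) : Prop :=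
  Adjacent α β ∧ ∃ γ ∈ nsupp f, γ.vec = α.vec + β.vec

/-- `f` (equivalently, its orbit) is extensive if adjacency and `f`-adjacency of simple roots are
the same. -/
def IsExtensive (f : Module.Dual F (nilradical F X n)) : Prop :=
  ∀ α β : PosRoot X n, IsSimpleRoot α → IsSimpleRoot β → (Adjacent α β ↔ FAdjacent f α β)

/-- `V(S)`: the linear forms with support exactly `S`. -/
def formsWithSupport (F : Type*) [Field F] {X : ClassicalType} {n : ℕ} (S : Set (PosRoot X n)) :
    Set (Module.Dual F (nilradical F X n)) :=
  {f | supp f = S}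

end LinearForms

/-! ### Enumeration of the positive roots -/

/-- The height of a positive root: the number of summands in its decomposition into simple roots. In
type `D` it is one less than the distance of the cell from the diagonal for the roots
`ε_i + ε_j`. -/
def PosRoot.height {X : ClassicalType} {n : ℕ} (α : PosRoot X n) : ℕ :=
  match X, α with
  | .D, α => if n ≤ α.1.2.val then α.1.2.val - α.1.1.val - 1 else α.1.2.val - α.1.1.val
  | .A, α | .B, α | .C, α => α.1.2.val - α.1.1.val

/-- The order of the enumeration: by height, then by decreasing first index `i` of the root
`ε_i - ε_j`, `ε_i + ε_j`, `ε_i`, `2 ε_i`; and `ε_i + ε_n` is before `ε_i - ε_n` in type `D`. -/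
def PosRoot.Precedes {X : ClassicalType} {n : ℕ} (β α : PosRoot X n) : Prop :=
  β.height < α.height ∨ (β.height = α.height ∧
    (α.1.1 < β.1.1 ∨ (α.1.1 = β.1.1 ∧ α.1.2 < β.1.2)))

instance {X : ClassicalType} {n : ℕ} (α : PosRoot X n) :
    DecidablePred fun β : PosRoot X n => β.Precedes α := fun β => by
  unfold PosRoot.Precedes; infer_instance

/-- The position of `α` in the enumeration, counted from `0`. -/
def PosRoot.index {X : ClassicalType} {n : ℕ} (α : PosRoot X n) : ℕ :=
  (Finset.univ.filter fun β : PosRoot X n => β.Precedes α).card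

/-! ### Strings -/

/-- The letters of the classifying strings. -/
inductive Letter
  | S | A | I | L
  deriving DecidableEq

/-- The letter encoded by a decimal digit: `1`, `2`, `3`, `4` stand for `S`, `A`, `I`, `L`. -/
def Letter.ofDigit : ℕ → Letter
  | 1 => .S
  | 2 => .A
  | 4 => .L
  | _ => .I

/-- The letters, from left to right, of the string encoded by a natural number: one decimal digit
for each letter, in the same order. For example, `2112234441` encodes `ASSAAILLLS`. -/
def letters (s : ℕ) : List Letter :=
  (Nat.digits 10 s).reverse.map Letter.ofDigit

/-- The letter of the string at position `k`, counted from `0`. Strings that are too short are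
completed on the right by letters `I`. -/
def letterAt (s k : ℕ) : Letter :=
  (letters s).getD k Letter.I

/-- The set of the positive roots on whose positions the string has the letter `S`. -/
def stringSupport (X : ClassicalType) (n : ℕ) (s : ℕ) : Set (PosRoot X n) :=
  {α | letterAt s α.index = Letter.S}

/-- The types and ranks under consideration. -/
def Admissible : ClassicalType → ℕ → Prop
  | .A, n => 2 ≤ n ∧ n ≤ 7
  | .B, n => 2 ≤ n ∧ n ≤ 7
  | .C, n => 2 ≤ n ∧ n ≤ 7
  | .D, n => 4 ≤ n ∧ n ≤ 8

/-- The lists of classifying strings. The list is empty where there is no extensive orbit of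
dimension `6`. -/
def strings : ClassicalType → ℕ → List ℕ
  | .A, 4 => [
     2112234441, 2132234441, 2312234441, 2332234441, 4221424113, 4223424113]
  | .A, 5 => [
     214242411133133, 214242431133133, 234242411133133, 234242431133133, 211242341343133,
     231242341343133, 213242341343133, 233242341343133, 442114223111333, 442134223111333,
     442314223111333, 442334223111333, 212424411131333, 212424431131333, 212124443131333,
     212324443131333, 232424411131333, 232424431131333, 232124443131333, 232324443131333,
     212244411133333, 232244411133333, 424121142331313, 424121342331313, 424321142331313,
     424321342331313, 421121234343313, 421321234343313, 423121234343313, 423321234343313,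
     422121144331333, 422321144331333]
  | .A, 6 => [
     24242411111131333, 24242413111131333, 24242411131131333, 24242413131131333,
     21242434111131333, 21242434131131333, 23242434111131333, 23242434131131333,
     21212444311131333, 21212444331131333, 23212444311131333, 23212444331131333,
     21232444311131333, 21232444331131333, 23232444311131333, 23232444331131333,
     24242411111133333, 24242413111133333, 21242434111133333, 23242434111133333,
     42424211111313133, 42424211131313133, 42421211143313133, 42423211143313133,
     42424213111313133, 42424213131313133, 42421213143313133, 42423213143313133,
     42124214311313133, 42124214331313133, 42121214343313133, 42123214343313133,
     42324214311313133, 42324214331313133, 42321214343313133, 42323214343313133,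
     42422411111313333, 42422413111313333, 42122414311313333, 42322414311313333,
     42242411111331333, 42242411131331333, 42212411341331333, 42232411341331333,
     42424211111333133, 42424211131333133, 42421211143333133, 42423211143333133,
     42422411111333333, 42412111421331331, 42412113421331331, 42432111421331331,
     42432113421331331, 42412311421331331, 42412313421331331, 42432311421331331,
     42432313421331331, 42142412311313331, 42142412331313331, 42112412341333331,
     42132412341333331, 42342412311313331, 42342412331313331, 42312412341333331, 42332412341333331]
  | .A, 7 => [
     42424211111113131, 42424211113113131, 42424231111113131, 42424231113113131,
     42421241111313131, 42421241113313131, 42423241111313131, 42423241113313131,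
     42424211311113131, 42424211313113131, 42424231311113131, 42424231313113131,
     42421241311313131, 42421241313313131, 42423241311313131, 42423241313313131,
     42124241131113131, 42124241131313131, 42124241331113131, 42124241331313131,
     42121241433113131, 42121241433313131, 42123241433113131, 42123241433313131,
     42324241131113131, 42324241131313131, 42324241331113131, 42324241331313131,
     42321241433113131, 42321241433313131, 42323241433113131, 42323241433313131,
     42424211111113133, 42424231111113133, 42424211311113133, 42424231311113133,
     42124241131113133, 42124241331113133, 42324241131113133, 42324241331113133,
     42424211111113331, 42424211113113331, 42424231111113331, 42424231113113331,
     42421241111313331, 42421241113313331, 42423241111313331, 42423241113313331,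
     42424211111113333, 42424231111113333]
  | .B, 3 => [
     121224441, 123224441, 321224441, 323224441]
  | .B, 4 => [
     42142241113313, 42142241313313, 42342241113313, 42342241313313, 12142243413313,
     12342243413313, 32142243413313, 32342243413313, 24121421313431, 24121423313431,
     24321421313431, 24321423313431, 21121324334431, 21321324334431, 23121324334431,
     23321324334431, 24123421313431, 24123423313431, 24323421313431, 24323423313431,
     21123324334431, 21323324334431, 23123324334431, 23323324334431, 21122341443133,
     21322341443133, 23122341443133, 23322341443133, 42412241113333, 42432241113333,
     22124441313333, 22324441313333, 21122343443133, 21322343443133, 23122343443133,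
     23322343443133, 42214243113333, 42234243113333]
  | .B, 5 => [
     424121142333133133, 424121342333133133, 424321142333133133, 424321342333133133,
     421121234334333133, 421321234334333133, 423121234334333133, 423321234334333133,
     212124144113113333, 212124144133113333, 212124344113113333, 212124344133113333,
     232124144113113333, 232124144133113333, 232124344113113333, 232124344133113333,
     242121144313113333, 242121144333113333, 242121344313113333, 242121344333113333,
     212123144343113333, 212123344343113333, 232123144343113333, 232123344343113333,
     212324144113113333, 212324144133113333, 212324344113113333, 212324344133113333,
     232324144113113333, 232324144133113333, 232324344113113333, 232324344133113333,
     242321144313113333, 242321144333113333, 242321344313113333, 242321344333113333,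
     212323144343113333, 212323344343113333, 232323144343113333, 232323344343113333,
     212424411113133333, 212424431113133333, 212124443113133333, 212324443113133333,
     232424411113133333, 232424431113133333, 232124443113133333, 232324443113133333,
     242424111133133333, 242424131133133333, 242124143133133333, 242324143133133333,
     442114223311133333, 442134223311133333, 442314223311133333, 442334223311133333,
     212424411313133333, 212424431313133333, 212124443313133333, 212324443313133333,
     232424411313133333, 232424431313133333, 232124443313133333, 232324443313133333,
     422121144333133333, 422321144333133333, 242241111143313333, 242241111343313333,
     212241311443313333, 232241311443313333, 242243111143313333, 242243111343313333,
     212243311443313333, 232243311443313333, 214242411113331333, 214242431113331333,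
     234242411113331333, 234242431113331333, 211242341134331333, 231242341134331333,
     213242341134331333, 233242341134331333, 212244411113333333, 232244411113333333,
     224244111131333333, 224244131131333333, 221244341131333333, 223244341131333333,
     224244111133333333, 214242411313331333, 214242431313331333, 234242411313331333,
     234242431313331333, 211242341334331333, 231242341334331333, 213242341334331333,
     233242341334331333, 212244411313333333, 232244411313333333, 241211421131334331,
     241211421331334331, 243211421131334331, 243211421331334331, 241231421131334331,
     241231421331334331, 243231421131334331, 243231421331334331, 214241311233314331,
     214241331233314331, 211241321433334331, 213241321433334331, 234241311233314331,
     234241331233314331, 231241321433334331, 233241321433334331, 241213421131334331,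
     241213421331334331, 243213421131334331, 243213421331334331, 241233421131334331,
     241233421331334331, 243233421131334331, 243233421331334331, 214243311233314331,
     214243331233314331, 211243321433334331, 213243321433334331, 234243311233314331,
     234243331233314331, 231243321433334331, 233243321433334331]
  | .B, 6 => [
     2124244111111313133, 2124244111113313133, 2124244311111313133, 2124244311113313133,
     2324244111111313133, 2324244111113313133, 2324244311111313133, 2324244311113313133,
     2424241111131313133, 2424241111133313133, 2424241311131313133, 2424241311133313133,
     2124243111134313133, 2124243311134313133, 2324243111134313133, 2324243311134313133,
     2124244113111313133, 2124244113113313133, 2124244313111313133, 2124244313113313133,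
     2324244113111313133, 2324244113113313133, 2324244313111313133, 2324244313113313133,
     2424241113131313133, 2424241113133313133, 2424241313131313133, 2424241313133313133,
     2124243113134313133, 2124243313134313133, 2324243113134313133, 2324243313134313133,
     2121244134111313133, 2121244134113313133, 2121244334111313133, 2121244334113313133,
     2321244134111313133, 2321244134113313133, 2321244334111313133, 2321244334113313133,
     2421241134131313133, 2421241134133313133, 2421241334131313133, 2421241334133313133,
     2121243134134313133, 2121243334134313133, 2321243134134313133, 2321243334134313133,
     2123244134111313133, 2123244134113313133, 2123244334111313133, 2123244334113313133,
     2323244134111313133, 2323244134113313133, 2323244334111313133, 2323244334113313133,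
     2423241134131313133, 2423241134133313133, 2423241334131313133, 2423241334133313133,
     2123243134134313133, 2123243334134313133, 2323243134134313133, 2323243334134313133,
     2124244111111313333, 2124244311111313333, 2324244111111313333, 2324244311111313333,
     2124244113111313333, 2124244313111313333, 2324244113111313333, 2324244313111313333,
     2121244431111313333, 2121244433111313333, 2321244431111313333, 2321244433111313333,
     2123244431111313333, 2123244433111313333, 2323244431111313333, 2323244433111313333,
     2124244111113313333, 2324244111113313333, 2124244113113313333, 2324244113113313333,
     2421244131113313333, 2421244133113313333, 2423244131113313333, 2423244133113313333,
     2424241111131313333, 2424241311131313333, 2424241113131313333, 2424241313131313333,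
     2124243411131313333, 2124243413131313333, 2324243411131313333, 2324243413131313333,
     2121244431131313333, 2121244433131313333, 2321244431131313333, 2321244433131313333,
     2123244431131313333, 2123244433131313333, 2323244431131313333, 2323244433131313333,
     4224241111133313333, 4224241113133313333, 4221241134133313333, 4223241134133313333,
     4242421111133131333, 4242421113133131333, 4242121114333131333, 4242321114333131333,
     4242421311133131333, 4242421313133131333, 4242121314333131333, 4242321314333131333,
     4212421431133131333, 4212421433133131333, 4212121434333131333, 4212321434333131333,
     4232421431133131333, 4232421433133131333, 4232121434333131333, 4232321434333131333,
     4242421111133331333, 4242421113133331333, 4242121114333331333, 4242321114333331333,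
     2124244111111333133, 2124244111113333133, 2124244311111333133, 2124244311113333133,
     2324244111111333133, 2324244111113333133, 2324244311111333133, 2324244311113333133,
     2424241111131333133, 2424241111133333133, 2424241311131333133, 2424241311133333133,
     2124243111134333133, 2124243311134333133, 2324243111134333133, 2324243311134333133,
     2124244111111333333, 2124244311111333333, 2324244111111333333, 2324244311111333333,
     2124244111113333333, 2324244111113333333, 2424241111131333333, 2424241311131333333,
     2124243411131333333, 2324243411131333333, 4242241111133133333, 4242241311133133333,
     4212241431133133333, 4232241431133133333, 4242241111133333333, 4241211142133313331,
     4241211342133313331, 4243211142133313331, 4243211342133313331, 4241231142133313331,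
     4241231342133313331, 4243231142133313331, 4243231342133313331, 4214241231133133331,
     4214241233133133331, 4211241234133333331, 4213241234133333331, 4234241231133133331,
     4234241233133133331, 4231241234133333331, 4233241234133333331]
  | .B, 7 => [
     424242111111133131, 424242111131133131, 424242311111133131, 424242311131133131,
     424212411113133131, 424212411133133131, 424232411113133131, 424232411133133131,
     424242113111133131, 424242113131133131, 424242313111133131, 424242313131133131,
     424212413113133131, 424212413133133131, 424232413113133131, 424232413133133131,
     421242411311133131, 421242411313133131, 421242413311133131, 421242413313133131,
     421212414331133131, 421212414333133131, 421232414331133131, 421232414333133131,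
     423242411311133131, 423242411313133131, 423242413311133131, 423242413313133131,
     423212414331133131, 423212414333133131, 423232414331133131, 423232414333133131,
     424242111111133331, 424242111131133331, 424242311111133331, 424242311131133331,
     424212411113133331, 424212411133133331, 424232411113133331, 424232411133133331,
     424242111111133133, 424242311111133133, 424242113111133133, 424242313111133133,
     421242411311133133, 421242413311133133, 423242411311133133, 423242413311133133,
     424242111111133333, 424242311111133333]
  | .C, 3 => [
     122421441, 322421441, 242123441, 122244413, 322244413]
  | .C, 4 => [
     1112332332343441, 3112332332343441, 1312332332343441, 3312332332343441, 1132332332343441,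
     3132332332343441, 1332332332343441, 3332332332343441, 1224424111131333, 1224424111331333,
     1224424311131333, 1224424311331333, 1224124131431333, 1224124331431333, 1224324131431333,
     1224324331431333, 3224424111131333, 3224424111331333, 3224424311131333, 3224424311331333,
     3224124131431333, 3224124331431333, 3224324131431333, 3224324331431333, 4221424111133333,
     4221424311133333, 4223424111133333, 4223424311133333, 1224124431133333, 1224324431133333,
     3224124431133333, 3224324431133333, 1224241143133333, 3224241143133333, 1224241343133333,
     3224241343133333, 2442231114313333, 2442231134313333, 2412233144313333, 2432233144313333,
     4221424111333333, 4223424111333333, 2224441113333333, 2112234344313333, 2132234344313333,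
     2312234344313333, 2332234344313333, 4221424311333333, 4223424311333333, 1221421143431333,
     3221421143431333, 2421121343431333, 1223421143431333, 3223421143431333, 2423121343431333]
  | .C, 5 => [
     1241241421331331333333, 1241243421331331333333, 1243241421331331333333,
     1243243421331331333333, 1211242341343331333333, 1213242341343331333333,
     1231242341343331333333, 1233242341343331333333, 3241241421331331333333,
     3241243421331331333333, 3243241421331331333333, 3243243421331331333333,
     3211242341343331333333, 3213242341343331333333, 3231242341343331333333,
     3233242341343331333333, 4241211423331331333333, 4241213423331331333333,
     4243211423331331333333, 4243213423331331333333, 4211212343343331333333,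
     4213212343343331333333, 4231212343343331333333, 4233212343343331333333,
     1424132243111333133333, 1424332243111333133333, 1424132243311333133333,
     1424332243311333133333, 3424132243111333133333, 3424332243111333133333,
     3424132243311333133333, 3424332243311333133333, 1221241441331333333333,
     1223241441331333333333, 3221241441331333333333, 3223241441331333333333,
     4421142233111333333333, 4421342233111333333333, 4423142233111333333333,
     4423342233111333333333, 2124244113131333333333, 2124244313131333333333,
     2121244433131333333333, 2123244433131333333333, 2324244113131333333333,
     2324244313131333333333, 2321244433131333333333, 2323244433131333333333,
     4221211443331333333333, 4223211443331333333333, 1122432113433433133333,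
     3122432113433433133333, 1322432113433433133333, 3322432113433433133333,
     2412424111133313333333, 2412424311133313333333, 2432424111133313333333,
     2432424311133313333333, 2412423111343313333333, 2412423311343313333333,
     2432423111343313333333, 2432423311343313333333, 2412424111133333333333,
     2432424111133333333333, 2142424113133313333333, 2142424313133313333333,
     2342424113133313333333, 2342424313133313333333, 2112423413343313333333,
     2312423413343313333333, 2132423413343313333333, 2332423413343313333333,
     2122444113133333333333, 2322444113133333333333, 1121232413431433133333,
     3121232413431433133333, 1321232413431433133333, 3321232413431433133333,
     1121232433431433133333, 3121232433431433133333, 1321232433431433133333,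
     3321232433431433133333, 1123232413431433133333, 3123232413431433133333,
     1323232413431433133333, 3323232413431433133333, 1123232433431433133333,
     3123232433431433133333, 1323232433431433133333, 3323232433431433133333,
     1112133213323343343431, 3112133213323343343431, 1312133213323343343431,
     3312133213323343343431, 1132133213323343343431, 3132133213323343343431,
     1332133213323343343431, 3332133213323343343431, 1112333213323343343431,
     3112333213323343343431, 1312333213323343343431, 3312333213323343343431,
     1132333213323343343431, 3132333213323343343431, 1332333213323343343431,
     3332333213323343343431]
  | .C, 6 => [
     122424411111331333333, 322424411111331333333, 122424411311331333333, 322424411311331333333,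
     122124413411331333333, 322124413411331333333, 122324413411331333333, 322324413411331333333,
     242424111113131333333, 242424131113131333333, 242424111313131333333, 242424131313131333333,
     212424341113131333333, 212424341313131333333, 232424341113131333333, 232424341313131333333,
     212124443113131333333, 212124443313131333333, 232124443113131333333, 232124443313131333333,
     212324443113131333333, 212324443313131333333, 232324443113131333333, 232324443313131333333,
     422424111113331333333, 422424111313331333333, 422124113413331333333, 422324113413331333333,
     124242411111313133333, 124242411311313133333, 124212411431313133333, 124232411431313133333,
     124242431111313133333, 124242431311313133333, 124212431431313133333, 124232431431313133333,
     121242443111313133333, 121242443311313133333, 121212443431313133333, 121232443431313133333,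
     123242443111313133333, 123242443311313133333, 123212443431313133333, 123232443431313133333,
     324242411111313133333, 324242411311313133333, 324212411431313133333, 324232411431313133333,
     324242431111313133333, 324242431311313133333, 324212431431313133333, 324232431431313133333,
     321242443111313133333, 321242443311313133333, 321212443431313133333, 321232443431313133333,
     323242443111313133333, 323242443311313133333, 323212443431313133333, 323232443431313133333,
     124242411111333133333, 124242411311333133333, 124212411431333133333, 124232411431333133333,
     324242411111333133333, 324242411311333133333, 324212411431333133333, 324232411431333133333,
     424242111113313133333, 424242111313313133333, 424212111433313133333, 424232111433313133333,
     424242131113313133333, 424242131313313133333, 424212131433313133333, 424232131433313133333,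
     421242143113313133333, 421242143313313133333, 421212143433313133333, 421232143433313133333,
     423242143113313133333, 423242143313313133333, 423212143433313133333, 423232143433313133333,
     424242111113333133333, 424242111313333133333, 424212111433333133333, 424232111433333133333,
     124224411111313333333, 124224431111313333333, 121224443111313333333, 123224443111313333333,
     324224411111313333333, 324224431111313333333, 321224443111313333333, 323224443111313333333,
     122424411111333333333, 322424411111333333333, 242424111113133333333, 242424131113133333333,
     212424341113133333333, 232424341113133333333, 424224111113313333333, 424224131113313333333,
     421224143113313333333, 423224143113313333333, 424224111113333333333, 121424124111313333133,
     121424124311313333133, 123424124111313333133, 123424124311313333133, 121424324111313333133,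
     121424324311313333133, 123424324111313333133, 123424324311313333133, 321424124111313333133,
     321424124311313333133, 323424124111313333133, 323424124311313333133, 321424324111313333133,
     321424324311313333133, 323424324111313333133, 323424324311313333133, 124124413211331333133,
     124124433211331333133, 121124423411333333133, 123124423411333333133, 324124413211331333133,
     324124433211331333133, 321124423411333333133, 323124423411333333133, 124324413211331333133,
     124324433211331333133, 121324423411333333133, 123324423411333333133, 324324413211331333133,
     324324433211331333133, 321324423411333333133, 323324423411333333133, 424121114213331333133,
     424121134213331333133, 424321114213331333133, 424321134213331333133, 424123114213331333133,
     424123134213331333133, 424323114213331333133, 424323134213331333133, 421424123113313333133,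
     421424123313313333133, 421124123413333333133, 421324123413333333133, 423424123113313333133,
     423424123313313333133, 423124123413333333133, 423324123413333333133, 112124321113431343331,
     312124321113431343331, 132124321113431343331, 332124321113431343331, 112124321313431343331,
     312124321313431343331, 132124321313431343331, 332124321313431343331, 112324321113431343331,
     312324321113431343331, 132324321113431343331, 332324321113431343331, 112324321313431343331,
     312324321313431343331, 132324321313431343331, 332324321313431343331, 112124323113431343331,
     312124323113431343331, 132124323113431343331, 332124323113431343331, 112124323313431343331,
     312124323313431343331, 132124323313431343331, 332124323313431343331, 112324323113431343331,
     312324323113431343331, 132324323113431343331, 332324323113431343331, 112324323313431343331,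
     312324323313431343331, 132324323313431343331, 332324323313431343331, 112124321113433343331,
     312124321113433343331, 132124321113433343331, 332124321113433343331, 112324321113433343331,
     312324321113433343331, 132324321113433343331, 332324321113433343331]
  | .C, 7 => [
     124242411111113131, 124242411311113131, 124242431111113131, 124242431311113131,
     324242411111113131, 324242411311113131, 324242431111113131, 324242431311113131,
     124242411113113131, 124242411313113131, 124242431113113131, 124242431313113131,
     324242411113113131, 324242411313113131, 324242431113113131, 324242431313113131,
     121242443111113131, 121242443311113131, 321242443111113131, 321242443311113131,
     121242443113113131, 121242443313113131, 321242443113113131, 321242443313113131,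
     123242443111113131, 123242443311113131, 323242443111113131, 323242443311113131,
     123242443113113131, 123242443313113131, 323242443113113131, 323242443313113131,
     124212441131113131, 124212441133113131, 124212443131113131, 124212443133113131,
     121212444331113131, 121212444333113131, 123212444331113131, 123212444333113131,
     324212441131113131, 324212441133113131, 324212443131113131, 324212443133113131,
     321212444331113131, 321212444333113131, 323212444331113131, 323212444333113131,
     124232441131113131, 124232441133113131, 124232443131113131, 124232443133113131,
     121232444331113131, 121232444333113131, 123232444331113131, 123232444333113131,
     324232441131113131, 324232441133113131, 324232443131113131, 324232443133113131,
     321232444331113131, 321232444333113131, 323232444331113131, 323232444333113131,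
     124242411111113331, 124242431111113331, 324242411111113331, 324242431111113331,
     124242411113113331, 124242431113113331, 324242411113113331, 324242431113113331,
     124212441131113331, 124212441133113331, 324212441131113331, 324212441133113331,
     124232441131113331, 124232441133113331, 324232441131113331, 324232441133113331,
     424242111111133131, 424242111131133131, 424242311111133131, 424242311131133131,
     424212411113133131, 424212411133133131, 424232411113133131, 424232411133133131,
     424242113111133131, 424242113131133131, 424242313111133131, 424242313131133131,
     424212413113133131, 424212413133133131, 424232413113133131, 424232413133133131,
     421242411311133131, 421242411313133131, 421242413311133131, 421242413313133131,
     421212414331133131, 421212414333133131, 421232414331133131, 421232414333133131,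
     423242411311133131, 423242411313133131, 423242413311133131, 423242413313133131,
     423212414331133131, 423212414333133131, 423232414331133131, 423232414333133131,
     424242111111133331, 424242111131133331, 424242311111133331, 424242311131133331,
     424212411113133331, 424212411133133331, 424232411113133331, 424232411133133331,
     124242411111113133, 124242411311113133, 124242431111113133, 124242431311113133,
     324242411111113133, 324242411311113133, 324242431111113133, 324242431311113133,
     121242443111113133, 121242443311113133, 321242443111113133, 321242443311113133,
     123242443111113133, 123242443311113133, 323242443111113133, 323242443311113133,
     124242411111113333, 124242431111113333, 324242411111113333, 324242431111113333,
     424242111111133133, 424242311111133133, 424242113111133133, 424242313111133133,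
     421242411311133133, 421242413311133133, 423242411311133133, 423242413311133133,
     424242111111133333, 424242311111133333]
  | .D, 4 => [
     22421111441, 22421113441, 22423111441, 22423113441, 22424131141, 22424133141, 22421134341,
     22423134341, 22424311141, 22424311341, 22421313441, 22423313441, 22121334441, 22123334441,
     22321334441, 22323334441, 22424411133, 22424411313, 22244411333, 22424143113, 24224143133,
     42221443313, 22124441113, 22324441113]
  | .D, 5 => [
     2212444111113133, 2212444111313133, 2212444311113133, 2212444311313133, 2212444111133133,
     2212444111333133, 2212444311133133, 2212444311333133, 2232444111113133, 2232444111313133,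
     2232444311113133, 2232444311313133, 2232444111133133, 2232444111333133, 2232444311133133,
     2232444311333133, 2242411113143133, 2242411113343133, 2242411313143133, 2242411313343133,
     2242413413113133, 2242413413313133, 2242413113433133, 2242413313433133, 2242431413113133,
     2242431413133133, 2242431113343133, 2242431313343133, 2212433113443133, 2212433313443133,
     2232433113443133, 2232433313443133, 2414224311133313, 2414224311333313, 2411224331433313,
     2413224331433313, 2434224311133313, 2434224311333313, 2431224331433313, 2433224331433313,
     2212444111113333, 2212444311113333, 2232444111113333, 2232444311113333, 2212444111133333,
     2212444311133333, 2232444111133333, 2232444311133333, 4214242311313331, 4214242311333331,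
     4211242331343331, 4213242331343331, 4234242311313331, 4234242311333331, 4231242331343331,
     4233242331343331, 2212444111313333, 2212444311313333, 2232444111313333, 2232444311313333,
     2212444111333333, 2232444111333333, 4111243323432311, 4311243323432311, 4131243323432311,
     4331243323432311, 4113243323432311, 4313243323432311, 4133243323432311, 4333243323432311,
     4422141213111333, 4422141233111333, 4422341213111333, 4422341233111333, 4122143243111333,
     4122343243111333, 4322143243111333, 4322343243111333, 4422141213131333, 4422341213131333,
     4422141233131333, 4422341233131333, 2422411413133333, 2422431413133333, 4422114213311333,
     4422314213311333, 4422114233311333, 4422314233311333, 4222411413313333, 4222413413313333,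
     2242141413113333, 2242341413113333]
  | .D, 6 => [
     24112424311113333133, 24112424331113333133, 24132424311113333133, 24132424331113333133,
     24312424311113333133, 24312424331113333133, 24332424311113333133, 24332424331113333133,
     24112424311133333133, 24112424331133333133, 24312424311133333133, 24312424331133333133,
     24132424311133333133, 24132424331133333133, 24332424311133333133, 24332424331133333133,
     24112424311113333333, 24132424311113333333, 24312424311113333333, 24332424311113333333,
     42112442311131333313, 42112442331131333313, 42132442311131333313, 42132442331131333313,
     42312442311131333313, 42312442331131333313, 42332442311131333313, 42332442331131333313,
     42112442311133333313, 42112442331133333313, 42312442311133333313, 42312442331133333313,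
     42132442311133333313, 42132442331133333313, 42332442311133333313, 42332442331133333313,
     42112442311131333333, 42132442311131333333, 42312442311131333333, 42332442311131333333,
     41421143223311113333, 41421343223311113333, 41423143223311113333, 41423343223311113333,
     43421143223311113333, 43421343223311113333, 43423143223311113333, 43423343223311113333,
     41124243211311313333, 43124243211311313333, 41124243231311313333, 43124243231311313333,
     41121243243311313333, 43121243243311313333, 41123243243311313333, 43123243243311313333,
     41324243211311313333, 43324243211311313333, 41324243231311313333, 43324243231311313333,
     41321243243311313333, 43321243243311313333, 41323243243311313333, 43323243243311313333,
     41122443211311333333, 43122443211311333333, 41322443211311333333, 43322443211311333333,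
     41241211142333313331, 41241211342333313331, 41243211142333313331, 41243211342333313331,
     41211211234333433331, 41213211234333433331, 41231211234333433331, 41233211234333433331,
     43241211142333313331, 43241211342333313331, 43243211142333313331, 43243211342333313331,
     43211211234333433331, 43213211234333433331, 43231211234333433331, 43233211234333433331,
     41221211144333313333, 41223211144333313333, 43221211144333313333, 43223211144333313333,
     41112143321343233113, 43112143321343233113, 41312143321343233113, 43312143321343233113,
     41132143321343233113, 43132143321343233113, 41332143321343233113, 43332143321343233113,
     41112343321343233113, 43112343321343233113, 41312343321343233113, 43312343321343233113,
     41132343321343233113, 43132343321343233113, 41332343321343233113, 43332343321343233113]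
  | .D, 7 => [
     41242421111113331313333, 41242421111313331313333, 41242121111433331313333,
     41242321111433331313333, 41242421131113331313333, 41242421131313331313333,
     41242121131433331313333, 41242321131433331313333, 41212421143113331313333,
     41212421143313331313333, 41212121143433331313333, 41212321143433331313333,
     41232421143113331313333, 41232421143313331313333, 41232121143433331313333,
     41232321143433331313333, 43242421111113331313333, 43242421111313331313333,
     43242121111433331313333, 43242321111433331313333, 43242421131113331313333,
     43242421131313331313333, 43242121131433331313333, 43242321131433331313333,
     43212421143113331313333, 43212421143313331313333, 43212121143433331313333,
     43212321143433331313333, 43232421143113331313333, 43232421143313331313333,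
     43232121143433331313333, 43232321143433331313333, 41242241111113331333333,
     41242241131113331333333, 41212241143113331333333, 41232241143113331333333,
     43242241111113331333333, 43242241131113331333333, 43212241143113331333333,
     43232241143113331333333, 41224241111113333133333, 41224241111313333133333,
     41221241113413333133333, 41223241113413333133333, 43224241111113333133333,
     43224241111313333133333, 43221241113413333133333, 43223241113413333133333,
     41242421111113333313333, 41242421111313333313333, 41242121111433333313333,
     41242321111433333313333, 43242421111113333313333, 43242421111313333313333,
     43242121111433333313333, 43242321111433333313333, 41242241111113333333333,
     43242241111113333333333, 41121244321113113133333, 43121244321113113133333,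
     41121244321313113133333, 43121244321313113133333, 41321244321113113133333,
     43321244321113113133333, 41321244321313113133333, 43321244321313113133333,
     41123244321113113133333, 43123244321113113133333, 41123244321313113133333,
     43123244321313113133333, 41323244321113113133333, 43323244321113113133333,
     41323244321313113133333, 43323244321313113133333, 41121244323113113133333,
     43121244323113113133333, 41121244323313113133333, 43121244323313113133333,
     41321244323113113133333, 43321244323113113133333, 41321244323313113133333,
     43321244323313113133333, 41123244323113113133333, 43123244323113113133333,
     41123244323313113133333, 43123244323313113133333, 41323244323113113133333,
     43323244323113113133333, 41323244323313113133333, 43323244323313113133333,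
     41121244321113113333333, 43121244321113113333333, 41321244321113113333333,
     43321244321113113333333, 41123244321113113333333, 43123244321113113333333,
     41323244321113113333333, 43323244321113113333333, 41241211114213333133331,
     41241211134213333133331, 41243211114213333133331, 41243211134213333133331,
     41241231114213333133331, 41241231134213333133331, 41243231114213333133331,
     41243231134213333133331, 41214241123113331333331, 41214241123313331333331,
     41211241123413333333331, 41213241123413333333331, 41234241123113331333331,
     41234241123313331333331, 41231241123413333333331, 41233241123413333333331,
     43241211114213333133331, 43241211134213333133331, 43243211114213333133331,
     43243211134213333133331, 43241231114213333133331, 43241231134213333133331,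
     43243231114213333133331, 43243231134213333133331, 43214241123113331333331,
     43214241123313331333331, 43211241123413333333331, 43213241123413333333331,
     43234241123113331333331, 43234241123313331333331, 43231241123413333333331,
     43233241123413333333331]
  | .D, 8 => [
     412424211111111333131, 412424211111311333131, 412424231111111333131, 412424231111311333131,
     412421241111131333131, 412421241111331333131, 412423241111131333131, 412423241111331333131,
     412424211131111333131, 412424211131311333131, 412424231131111333131, 412424231131311333131,
     412421241131131333131, 412421241131331333131, 412423241131131333131, 412423241131331333131,
     412124241113111333131, 412124241113131333131, 412124241133111333131, 412124241133131333131,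
     412121241143311333131, 412121241143331333131, 412123241143311333131, 412123241143331333131,
     412324241113111333131, 412324241113131333131, 412324241133111333131, 412324241133131333131,
     412321241143311333131, 412321241143331333131, 412323241143311333131, 412323241143331333131,
     432424211111111333131, 432424211111311333131, 432424231111111333131, 432424231111311333131,
     432421241111131333131, 432421241111331333131, 432423241111131333131, 432423241111331333131,
     432424211131111333131, 432424211131311333131, 432424231131111333131, 432424231131311333131,
     432421241131131333131, 432421241131331333131, 432423241131131333131, 432423241131331333131,
     432124241113111333131, 432124241113131333131, 432124241133111333131, 432124241133131333131,
     432121241143311333131, 432121241143331333131, 432123241143311333131, 432123241143331333131,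
     432324241113111333131, 432324241113131333131, 432324241133111333131, 432324241133131333131,
     432321241143311333131, 432321241143331333131, 432323241143311333131, 432323241143331333131,
     412424211111111333133, 412424231111111333133, 412424211131111333133, 412424231131111333133,
     412124241113111333133, 412124241133111333133, 412324241113111333133, 412324241133111333133,
     432424211111111333133, 432424231111111333133, 432424211131111333133, 432424231131111333133,
     432124241113111333133, 432124241133111333133, 432324241113111333133, 432324241133111333133,
     412424211111111333331, 412424211111311333331, 412424231111111333331, 412424231111311333331,
     412421241111131333331, 412421241111331333331, 412423241111131333331, 412423241111331333331,
     432424211111111333331, 432424211111311333331, 432424231111111333331, 432424231111311333331,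
     432421241111131333331, 432421241111331333331, 432423241111131333331, 432423241111331333331,
     412424211111111333333, 412424231111111333333, 432424211111111333333, 432424231111111333333]
  | _, _ => []

end ClassicalOrbits

open ClassicalOrbits

/-! The dimension of the orbit of `f` is the rank of the Kirillov form `x, y ↦ f ⁅x, y⁆`
(`zariskiDim_orbit`). If the root vectors are read from the last one to the first, the orbit has a
triangular polynomial parametrization: there is one free coordinate for every position at which some
form `f ⁅x, ·⁆` has its last nonzero value, and the other coordinates are polynomials in the later
free ones. So the extensive orbits of rank `6` have to be classified.

Extensiveness is a condition on the support of `f`. A root `γ` lies in `NSupp f` if and only if `f`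
does not vanish on the ideal generated by `e_γ`, and this ideal is spanned by root vectors
(`mem_nsupp_iff`, `isExtensive_iff`).

The classification is a branching reduction, whose states are described by `Reduced`: a subalgebra
spanned by the root vectors in `P`, and in it an ideal spanned by those in `P \ S`, on which the
forms vanish. Only the quotient, with basis `S`, still matters. If `g` is central in the quotient,
then `f (v g)` does not change under the exponentials of the subalgebra, and the cases `f (v g) = 0`
(`g` joins the ideal) and `f (v g) ≠ 0` (`g` joins `Z`) are treated separately (`Solved.of_split`).
If `d` fails to commute only with `b`, and `⁅d, b⁆` is a multiple of an element of `Z`, then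
exponentials of multiples of `b` make `f` vanish at `d`, and exponentials of multiples of `d` make
it vanish at `b`. So `d` joins the ideal and `b` is left out of the subalgebra. The orbits
correspond one to one, and the pair accounts for `2` in the rank (`Reduced.remove`,
`Solved.of_remove`). In type `D` three such pairs may be entangled; they are removed together, the
matrix of their brackets having determinant `±2xyz` with `x`, `y`, `z` nonzero values of `f`.

A branch ends in one of three ways. Either `S` misses a set that the support of an extensive form
must meet, or hyperbolic planes show that the rank is at least `8`, or everything left is central.
In the last case the rank is twice the number of removed pairs, and the forms with support exactly
`S` are unique representatives (`solved_leaf`). `classify` walks through this tree and compares its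
leaves with the given supports; `classify_sound` derives the classification from its success.

The characteristic exceeds the number of positive roots, so the factorials in the exponentials are
invertible. A filtration argument for unipotent matrices shows that products of exponentials are
exponentials (`expGroup_of_mul`), hence the adjoint group consists of the operators `exp (ad x)`.
The structure constants are read off from matrix cells. What remains are two finite computations for
every type and rank, `checked` and `classified`. -/

namespace ClassicalOrbits

/-! ### The classification algorithm -/

/-- A nonzero bracket `⁅v i, v j⁆ = c • v k` of members of a basis. -/
structure Rel where
  i : ℕ
  j : ℕ
  k : ℕ
  c : ℤ

namespace Rel

def meets (t : Rel) (r : ℕ) : Bool := Nat.beq t.i r || Nat.beq t.j r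

def joins (t : Rel) (r c : ℕ) : Bool :=
  (Nat.beq t.i r && Nat.beq t.j c) || (Nat.beq t.i c && Nat.beq t.j r)

end Rel

/-- Sets of positions are bit masks, handled with operations on natural numbers that the kernel
evaluates on binary numerals. -/
def bit (S i : ℕ) : Bool := Nat.beq (Nat.land (Nat.shiftRight S i) 1) 1

/-- The list functions use `List.rec` and `cond` directly, so that the kernel unfolds them cheaply
and evaluates only the branch it needs. -/
noncomputable def anyL {α : Type} (p : α → Bool) (l : List α) : Bool :=
  List.rec false (fun x _ r => cond (p x) true r) l

noncomputable def allL {α : Type} (p : α → Bool) (l : List α) : Bool :=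
  List.rec true (fun x _ r => cond (p x) r false) l

noncomputable def filterL {α : Type} (p : α → Bool) (l : List α) : List α :=
  List.rec [] (fun x _ r => cond (p x) (x :: r) r) l

noncomputable def findL {α : Type} (p : α → Bool) (l : List α) : Option α :=
  List.rec none (fun x _ r => cond (p x) (some x) r) l

noncomputable def lastL {α : Type} (p : α → Bool) (l : List α) : Option α :=
  List.rec (fun o => o) (fun x _ r o => r (cond (p x) (some x) o)) l none

/-- The mask contains `r` itself: removing it leaves vectors whose brackets with `r` are not in the
table. -/
noncomputable def neighbours (E : List Rel) (r : ℕ) : ℕ :=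
  List.rec (Nat.pow 2 r) (fun t _ m => cond (Nat.beq t.i r) (Nat.lor m (Nat.pow 2 t.j))
    (cond (Nat.beq t.j r) (Nat.lor m (Nat.pow 2 t.i)) m)) E

noncomputable def meetsOnce (E : List Rel) (r : ℕ) : Bool :=
  match filterL (fun t => t.meets r) E with
  | [_] => true
  | _ => false

/-- A heuristic choice of a pair of basis vectors with a central bracket. -/
noncomputable def choosePair (E : List Rel) (Z : ℕ) : Option (ℕ × ℕ) :=
  match findL (fun t => cond (bit Z t.k) (meetsOnce E t.j) false) E with
  | some t => some (t.j, t.i)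
  | none =>
    match findL (fun t => cond (bit Z t.k) (meetsOnce E t.i) false) E with
    | some t => some (t.i, t.j)
    | none =>
      match lastL (fun t => bit Z t.k) E with
      | some t => some (t.j, t.i)
      | none => none

/-- Greedy search for `m` pairwise orthogonal hyperbolic planes. -/
noncomputable def peel : ℕ → List Rel → ℕ → Bool
  | 0, _, _ => true
  | m + 1, E, Z =>
    match choosePair E Z with
    | none => false
    | some (r, c) =>
      cond (anyL (fun t => cond (bit Z t.k) (t.joins r c) false) E)
      (peel m (filterL (fun t => cond (bit (neighbours E r) t.i) false
        (!(bit (neighbours E r) t.j))) E) Z) false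

/-- The table stores a bracket in one order of its factors only, hence the sign. -/
noncomputable def look (E : List Rel) (r c : ℕ) : Option (ℕ × ℤ) :=
  match findL (fun t => t.joins r c) E with
  | none => none
  | some t => some (t.k, cond (Nat.beq t.i r) t.c (-t.c))

/-- Two triples of basis vectors. -/
structure Hexad where
  r₁ : ℕ
  r₂ : ℕ
  r₃ : ℕ
  c₁ : ℕ
  c₂ : ℕ
  c₃ : ℕ

namespace Hexad

def rows (q : Hexad) : List ℕ := [q.r₁, q.r₂, q.r₃]

def cols (q : Hexad) : List ℕ := [q.c₁, q.c₂, q.c₃]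

/-- The pairing of rows and columns has zero diagonal, and central values with a nonzero
determinant off the diagonal. -/
noncomputable def paired (q : Hexad) (E : List Rel) (Z : ℕ) : Bool :=
  match look E q.r₁ q.c₁, look E q.r₂ q.c₂, look E q.r₃ q.c₃, look E q.r₁ q.c₂, look E q.r₂ q.c₁,
    look E q.r₁ q.c₃, look E q.r₃ q.c₁, look E q.r₂ q.c₃, look E q.r₃ q.c₂ with
  | none, none, none, some (k₁₂, a₁₂), some (k₂₁, a₂₁), some (k₁₃, a₁₃), some (k₃₁, a₃₁),
    some (k₂₃, a₂₃), some (k₃₂, a₃₂) =>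
    Nat.beq k₁₂ k₂₁ && Nat.beq k₁₃ k₃₁ && Nat.beq k₂₃ k₃₂ && bit Z k₁₂ && bit Z k₁₃ && bit Z k₂₃ &&
    Nat.beq (a₁₂ * a₂₃ * a₃₁ + a₁₃ * a₂₁ * a₃₂).natAbs 2
  | _, _, _, _, _, _, _, _, _ => false

/-- A pair that is absent from the table has its bracket in the ideal annihilated by the form. -/
noncomputable def isotropic (q : Hexad) (E : List Rel) : Bool :=
  allL (fun t => !(t.joins q.r₁ q.r₂) && !(t.joins q.r₁ q.r₃) && !(t.joins q.r₂ q.r₃)) E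

def distinct (q : Hexad) : Bool :=
  decide (q.rows ++ q.cols).Nodup

end Hexad

noncomputable def memb (l : List ℕ) (x : ℕ) : Bool := anyL (fun y => Nat.beq y x) l

/-- The vectors of `D` only meet those of `B`, with central brackets; those of `B` are not
brackets; the listed supports avoid both. -/
noncomputable def removable (D B : List ℕ) (E : List Rel) (Z : ℕ) (comp : List ℕ) : Bool :=
  allL (fun t => !(memb B t.k) && (!(memb D t.i) || (memb B t.j && bit Z t.k)) &&
    (!(memb D t.j) || (memb B t.i && bit Z t.k))) E &&
  allL (fun T => allL (fun x => !(bit T x)) D && allL (fun x => !(bit T x)) B) comp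

/-- A heuristic search. `classify` tests again whatever soundness needs. -/
noncomputable def chooseReduction (E : List Rel) (Z : ℕ) (comp : List ℕ) : Option (ℕ × ℕ) :=
  match findL (fun t => bit Z t.k && meetsOnce E t.j && removable [t.j] [t.i] E Z comp) E with
  | some t => some (t.j, t.i)
  | none =>
    match findL (fun t => bit Z t.k && meetsOnce E t.i && removable [t.i] [t.j] E Z comp) E with
    | some t => some (t.i, t.j)
    | none => none

noncomputable def used (E : List Rel) : ℕ :=
  List.rec 0 (fun t _ m => Nat.lor m (Nat.lor (Nat.pow 2 t.i) (Nat.pow 2 t.j))) E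

noncomputable def clear (S : ℕ) (l : List ℕ) : ℕ := List.rec S (fun x _ s => Nat.xor s (Nat.pow 2 x)) l

noncomputable def avoiding (E : List Rel) (l : List ℕ) : List Rel :=
  filterL (fun t => !(memb l t.i) && !(memb l t.j) && !(memb l t.k)) E

/-- A certificate of rank at least `8`: every removed pair contributes `2`, so `4 - a` further
planes suffice. An isotropic triple paired perfectly with another triple contributes `6`, which
suffices for `a = 1`. -/
noncomputable def killed (cores : List Hexad) (Z : ℕ) (E : List Rel) (a : ℕ) : Bool :=
  Nat.ble 4 a || peel (4 - a) E Z ||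
    (Nat.beq a 1 && anyL (fun q => q.distinct && q.isotropic E && q.paired E Z) cores)

def isNil {α : Type} (l : List α) : Bool :=
  match l with
  | [] => true
  | _ => false

/-- The classification algorithm. `S` is the set of the remaining roots, `Z ⊆ S` the set of those on
which the form is known not to vanish, `E` the table of the brackets between elements of `S`, `a`
the number of removed pairs, `comp` the list of the supports still to be met. -/
noncomputable def classify (ups : List ℕ) (cores : List Hexad) : ℕ → ℕ → ℕ → List Rel → ℕ → List ℕ → Bool
  | 0, _, _, _, _, _ => false
  | fuel + 1, S, Z, E, a, comp =>
    -- Some set of `ups` has no remaining root, so no form of this branch is extensive.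
    cond (anyL (fun u => Nat.beq (Nat.land u S) 0) ups) (isNil comp)
    (cond (isNil comp && killed cores Z E a) true
    -- Bitwise, `((S xor Z) or U) xor U` is `(S \ Z) \ U`, where `U` is the set of positions used in
    -- `E`. Its `log2` is the last central position that is not yet decided. For the empty set
    -- `log2` returns `0`, hence the explicit tests.
    (cond (bit S (Nat.log2 (Nat.xor (Nat.lor (Nat.xor S Z) (used E)) (used E))) &&
        !(bit Z (Nat.log2 (Nat.xor (Nat.lor (Nat.xor S Z) (used E)) (used E)))) &&
        !(anyL (fun t => t.meets (Nat.log2 (Nat.xor (Nat.lor (Nat.xor S Z) (used E)) (used E)))) E))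
      ((fun g => classify ups cores fuel (Nat.xor S (Nat.pow 2 g)) Z
          (filterL (fun t => !(Nat.beq t.k g)) E) a (filterL (fun T => !(bit T g)) comp) &&
        classify ups cores fuel S (Nat.lor Z (Nat.pow 2 g)) E a (filterL (fun T => bit T g) comp))
        (Nat.log2 (Nat.xor (Nat.lor (Nat.xor S Z) (used E)) (used E))))
      -- Everything that remains is central, and the rank is `2 * a`.
      (cond (Nat.beq S Z)
        (cond (Nat.beq a 3)
          (match comp with
          | [T] => Nat.beq T Z
          | _ => false)
          (isNil comp))
        (match chooseReduction E Z comp with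
        | some (d, b) =>
          removable [d] [b] E Z comp && anyL (fun t => bit Z t.k && t.joins d b) E &&
          classify ups cores fuel (clear S [d, b]) Z (avoiding E [d, b]) (a + 1) comp
        | none =>
          match cores with
          | [] => false
          | q :: _ =>
            q.distinct && q.paired E Z && removable q.rows q.cols E Z comp &&
            classify ups cores fuel (clear S (q.rows ++ q.cols)) Z (avoiding E (q.rows ++ q.cols))
              (a + 3) comp))))

/-! ### Tables of the classical types -/

def isCell (X : ClassicalType) (n p q : ℕ) : Bool :=
  match X with
  | .A => Nat.blt p q && Nat.blt q (n + 1)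
  | .B => Nat.blt p q && Nat.blt (p + q + 1) (2 * n + 1)
  | .C => Nat.blt p q && Nat.ble (p + q + 1) (2 * n)
  | .D => Nat.blt p q && Nat.blt (p + q + 1) (2 * n)

def cellHeight (X : ClassicalType) (n p q : ℕ) : ℕ :=
  match X with
  | .D => if Nat.ble n q then q - p - 1 else q - p
  | _ => q - p

/-- The cells of the positive roots, in the order of the enumeration. -/
def cells (X : ClassicalType) (n : ℕ) : List (ℕ × ℕ) :=
  (List.range (size X n)).flatMap fun h =>
    (List.range (size X n)).reverse.flatMap fun p =>
      -- In type `D` the roots of height `h` have column `p + h + 1` from the middle on and `p + h`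
      -- before it. Both occur only for `ε_i + ε_n` and `ε_i - ε_n`, which come in this order. In
      -- the other types the height test rejects the first column.
      ([p + h + 1, p + h].filter fun q => isCell X n p q && Nat.beq (cellHeight X n p q) h).map
        fun q => (p, q)

/-- The coefficient of the second cell of a root vector. -/
def mirrorSign (X : ClassicalType) (n p q : ℕ) : ℤ :=
  match X with
  | .A => 0
  | .B => -1
  | .C => if Nat.beq (p + q + 1) (2 * n) then 0 else if Nat.blt q n then -1 else 1
  | .D => -1

def cellEq (x y : ℕ × ℕ) : Bool := Nat.beq x.1 y.1 && Nat.beq x.2 y.2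

/-- The matrix cells of the bracket of two root vectors. -/
def bracketCells (X : ClassicalType) (n : ℕ) (x y : ℕ × ℕ) : List ((ℕ × ℕ) × ℤ) :=
  let m := size X n - 1
  let s := mirrorSign X n x.1 x.2
  let t := mirrorSign X n y.1 y.2
  let a := x.1
  let b := x.2
  let a' := m - x.1
  let b' := m - x.2
  let c := y.1
  let d := y.2
  let c' := m - y.1
  let d' := m - y.2
  (if Nat.beq b c then [((a, d), 1)] else []) ++
  ((if Nat.beq b d' then [((a, c'), t)] else []) ++
  ((if Nat.beq a' c then [((b', d), s)] else []) ++
  ((if Nat.beq a' d' then [((b', c'), s * t)] else []) ++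
  ((if Nat.beq d a then [((c, b), -1)] else []) ++
  ((if Nat.beq d b' then [((c, a'), -s)] else []) ++
  ((if Nat.beq c' a then [((d', b), -t)] else []) ++
  (if Nat.beq c' b' then [((d', a'), -(s * t))] else [])))))))

/-- An element of `𝔫` is determined by its entries in the root cells, so the mirrored cells may be
dropped. -/
def rootTerms (X : ClassicalType) (n : ℕ) (x y : ℕ × ℕ) : List ((ℕ × ℕ) × ℤ) :=
  (bracketCells X n x y).filter fun z => isCell X n z.1.1 z.1.2 && !(Nat.beq z.2.natAbs 0)

/-- Several terms of a bracket may fall into one cell; in type `C` the bracket of the root vectors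
of `ε_i - ε_j` and `ε_i + ε_j` gets its factor `2` in this way. -/
def total : List ((ℕ × ℕ) × ℤ) → ℤ
  | [] => 0
  | z :: l => z.2 + total l

def position (x : ℕ × ℕ) : List (ℕ × ℕ) → ℕ
  | [] => 0
  | y :: l => if cellEq y x then 0 else position x l + 1

def numbered (X : ClassicalType) (n : ℕ) : List ((ℕ × ℕ) × ℕ) := (cells X n).zipIdx

def relations (X : ClassicalType) (n : ℕ) : List Rel :=
  (numbered X n).reverse.flatMap fun y =>
    ((numbered X n).filter fun x => Nat.blt x.2 y.2).reverse.flatMap fun x =>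
      match rootTerms X n x.1 y.1 with
      | [] => []
      | z :: l => if total (z :: l) = 0 then [] else
          [⟨x.2, y.2, position z.1 (cells X n), total (z :: l)⟩]

/-- The set of the roots above a root. -/
def upper (E : List Rel) (k : ℕ) : ℕ :=
  -- The fold begins at the end of the table, where the second factors are smallest. A bracket comes
  -- after both its factors, so a single pass closes the set; `closedUnder` checks this.
  E.foldr (fun t m => if bit m t.i || bit m t.j then Nat.lor m (Nat.pow 2 t.k) else m) (Nat.pow 2 k)

/-- The simple roots occupy the first `n` positions and `t.i < t.j`, so the filter selects the
brackets of two simple root vectors. -/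
def uppers (X : ClassicalType) (n : ℕ) : List ℕ :=
  let E := relations X n
  (E.filter fun t => Nat.blt t.j n).map fun t => upper E t.k

/-- Each hexad belongs to a subsystem of type `D_4`. The columns are its outer simple roots, the
rows their sums with the central one. A row and a column that come from different outer roots add up
to a root, which is the same if the two outer roots are exchanged; those that come from the same
outer root do not. -/
def hexads : ClassicalType → ℕ → List Hexad
  | .D, 4 => [⟨6, 5, 4, 3, 1, 0⟩]
  | .D, 5 => [⟨12, 6, 5, 8, 1, 0⟩]
  | .D, 6 => [⟨8, 7, 6, 3, 1, 0⟩, ⟨14, 7, 6, 9, 1, 0⟩]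
  | _, _ => []

/-- The set of the positions of the digit `1`, counted from the left, as a bit mask. -/
def digitMask : ℕ → ℕ → ℕ → ℕ
  | 0, _, acc => acc
  | fuel + 1, s, acc =>
    if Nat.beq s 0 then acc
    -- The digits are consumed from the right while the accumulator doubles, so the leftmost digit
    -- ends up in bit `0`.
    else digitMask fuel (s / 10) (2 * acc + if Nat.beq (s % 10) 1 then 1 else 0)

def supports (X : ClassicalType) (n : ℕ) : List ℕ := (strings X n).map fun s => digitMask 60 s 0

/-- Every step decides or removes at least one position, and there are at most `56` of them (in
`D_8`), so the fuel `60` is enough. -/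
noncomputable def classified (X : ClassicalType) (n : ℕ) : Bool :=
  classify (uppers X n) (hexads X n) 60 (2 ^ (cells X n).length - 1) 0 (relations X n) 0
    (supports X n)

end ClassicalOrbits

namespace ClassicalOrbits

open Module

/-! ### Exponentials, coadjoint orbits and the Kirillov form -/

section Abstract

variable {F : Type*} [Field F] {L : Type*} [LieRing L] [LieAlgebra F L]

theorem expAd_apply (x y : L) : expAd F x y =
    ∑ k ∈ Finset.range (finrank F L), ((Nat.factorial k : F)⁻¹) • ((LieAlgebra.ad F L x ^ k) y) := by
  simp [expAd, LinearMap.sum_apply]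

/-- The operators `exp (ad x)` make up the adjoint group. -/
structure ExpGroup (F L : Type*) [Field F] [LieRing L] [LieAlgebra F L] : Prop where
  two_le : 2 ≤ finrank F L
  eq_expAd : ∀ g ∈ adjointGroup F L, ∃ x : L, (g : L →ₗ[F] L) = expAd F x
  expAd_mem : ∀ x : L, ∃ g ∈ adjointGroup F L, (g : L →ₗ[F] L) = expAd F x

theorem ad_pow_mem {x : L} {Q : Submodule F L} (hQ : ∀ q ∈ Q, ⁅x, q⁆ ∈ Q) {y : L} (hy : y ∈ Q)
    (k : ℕ) : (LieAlgebra.ad F L x ^ k) y ∈ Q := by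
  induction k with
  | zero => simpa
  | succ k ih =>
    rw [pow_succ', Module.End.mul_apply]
    exact hQ _ ih

theorem expAd_mem_of_stable {x : L} {Q : Submodule F L} (hQ : ∀ q ∈ Q, ⁅x, q⁆ ∈ Q) {y : L}
    (hy : y ∈ Q) : expAd F x y ∈ Q := by
  rw [expAd_apply]
  exact Q.sum_mem fun k _ => Q.smul_mem _ (ad_pow_mem hQ hy k)

theorem expAd_split (hL : 2 ≤ finrank F L) (x y : L) : expAd F x y = y + ⁅x, y⁆ +
    ∑ k ∈ Finset.range (finrank F L - 2), ((Nat.factorial (k + 2) : F)⁻¹) •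
      ((LieAlgebra.ad F L x ^ (k + 2)) y) := by
  obtain ⟨d, hd⟩ := Nat.exists_eq_add_of_le' hL
  rw [expAd_apply, hd, Finset.sum_range_succ', Finset.sum_range_succ']
  simp
  abel

/-- The terms of order at least two lie in `⁅x, Q⁆`, where `f` vanishes. Hence the exponential acts
on the value at `y` to first order. -/
theorem apply_expAd (hL : 2 ≤ finrank F L) {f : Dual F L} {x y : L} (Q : Submodule F L)
    (hQ : ∀ q ∈ Q, ⁅x, q⁆ ∈ Q) (hy : ⁅x, y⁆ ∈ Q) (hf : ∀ q ∈ Q, f ⁅x, q⁆ = 0) :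
    f (expAd F x y) = f y + f ⁅x, y⁆ := by
  rw [expAd_split hL, map_add, map_add, map_sum]
  simp only [add_eq_left]
  refine Finset.sum_eq_zero fun k _ => ?_
  have h : (LieAlgebra.ad F L x ^ (k + 2)) y = ⁅x, (LieAlgebra.ad F L x ^ k) ⁅x, y⁆⁆ := by
    rw [pow_succ', Module.End.mul_apply, pow_succ, Module.End.mul_apply]; rfl
  rw [map_smul, h, hf _ (ad_pow_mem hQ hy k), smul_zero]

theorem ExpGroup.mem_orbit_iff (h : ExpGroup F L) {f f' : Dual F L} :
    f' ∈ coadjointOrbit f ↔ ∃ x : L, f' = f ∘ₗ expAd F x := by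
  constructor
  · rintro ⟨g, hg, rfl⟩
    obtain ⟨x, hx⟩ := h.eq_expAd _ (inv_mem hg)
    exact ⟨x, by rw [← hx]⟩
  · rintro ⟨x, rfl⟩
    obtain ⟨g, hg, hx⟩ := h.expAd_mem x
    exact ⟨g⁻¹, inv_mem hg, by rw [inv_inv, hx]⟩

theorem mem_orbit_iff' {f f' : Dual F L} :
    f' ∈ coadjointOrbit f ↔ ∃ g ∈ adjointGroup F L, f' = f ∘ₗ (g : L →ₗ[F] L) := by
  constructor
  · rintro ⟨g, hg, rfl⟩
    exact ⟨g⁻¹, inv_mem hg, rfl⟩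
  · rintro ⟨g, hg, rfl⟩
    exact ⟨g⁻¹, inv_mem hg, by rw [inv_inv]⟩

theorem orbit_refl (f : Dual F L) : f ∈ coadjointOrbit f :=
  ⟨1, one_mem _, by ext; simp⟩

theorem orbit_symm {f f' : Dual F L} (h : f' ∈ coadjointOrbit f) : f ∈ coadjointOrbit f' := by
  obtain ⟨g, hg, rfl⟩ := h
  exact ⟨g⁻¹, inv_mem hg, by ext; simp⟩

theorem orbit_trans {f f' f'' : Dual F L} (h : f' ∈ coadjointOrbit f)
    (h' : f'' ∈ coadjointOrbit f') : f'' ∈ coadjointOrbit f := by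
  obtain ⟨g, hg, rfl⟩ := h
  obtain ⟨k, hk, rfl⟩ := h'
  refine ⟨k * g, mul_mem hk hg, ?_⟩
  ext
  simp [mul_inv_rev]

theorem orbit_eq {f f' : Dual F L} (h : f' ∈ coadjointOrbit f) :
    coadjointOrbit f' = coadjointOrbit f :=
  Set.ext fun _ => ⟨orbit_trans h, orbit_trans (orbit_symm h)⟩

theorem ExpGroup.comp_expAd_mem (h : ExpGroup F L) (f : Dual F L) (x : L) :
    f ∘ₗ expAd F x ∈ coadjointOrbit f := h.mem_orbit_iff.2 ⟨x, rfl⟩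

/-- The alternating form `x, y ↦ f ⁅x, y⁆`. -/
def kirillov (f : Dual F L) : L →ₗ[F] Dual F L :=
  (LinearMap.llcomp F L L F f) ∘ₗ (LieAlgebra.ad F L : L →ₗ[F] Module.End F L)

@[simp]
theorem kirillov_apply (f : Dual F L) (x y : L) : kirillov f x y = f ⁅x, y⁆ := rfl

noncomputable def kirillovRank (f : Dual F L) : ℕ := finrank F (LinearMap.range (kirillov f))

/-! ### Ordered bases on which `ad x` is strictly triangular -/

section Flag

variable {σ : Type*} (b : Basis σ F L) (ord : σ → ℕ)

/-- Brackets with `b j` only involve basis vectors which come after `b j`. -/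
def IsFlag : Prop :=
  Function.Injective ord ∧ ∀ i j k, b.repr ⁅b i, b j⁆ k ≠ 0 → ord j < ord k

def tail (m : ℕ) : Submodule F L := Submodule.span F (b '' {i | m ≤ ord i})

variable {b ord}

theorem basis_mem_tail {m : ℕ} {i : σ} (h : m ≤ ord i) : b i ∈ tail b ord m :=
  Submodule.subset_span ⟨i, h, rfl⟩

theorem tail_antitone : Antitone (tail b ord) := fun _ _ h =>
  Submodule.span_mono (Set.image_mono fun _ hi => h.trans hi)

theorem tail_zero : tail b ord 0 = ⊤ := by
  rw [eq_top_iff, ← b.span_eq]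
  exact Submodule.span_mono (by rintro _ ⟨i, rfl⟩; exact ⟨i, Nat.zero_le _, rfl⟩)

theorem lie_basis_mem_tail [Fintype σ] (h : IsFlag b ord) (x : L) (j : σ) :
    ⁅x, b j⁆ ∈ tail b ord (ord j + 1) := by
  rw [← b.sum_repr x, sum_lie]
  refine Submodule.sum_mem _ fun i _ => ?_
  rw [smul_lie]
  refine Submodule.smul_mem _ _ ?_
  rw [← b.sum_repr ⁅b i, b j⁆]
  refine Submodule.sum_mem _ fun k _ => ?_
  by_cases hk : b.repr ⁅b i, b j⁆ k = 0
  · rw [hk, zero_smul]; exact zero_mem _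
  · exact Submodule.smul_mem _ _ (basis_mem_tail (h.2 i j k hk))

theorem lie_mem_tail [Fintype σ] (h : IsFlag b ord) (x : L) {m : ℕ} {y : L} (hy : y ∈ tail b ord m) :
    ⁅x, y⁆ ∈ tail b ord (m + 1) := by
  induction hy using Submodule.span_induction with
  | mem y hy =>
    obtain ⟨j, hj, rfl⟩ := hy
    exact tail_antitone (Nat.succ_le_succ hj) (lie_basis_mem_tail h x j)
  | zero => simp
  | add y z _ _ hy hz => rw [lie_add]; exact add_mem hy hz
  | smul c y _ hy => rw [lie_smul]; exact Submodule.smul_mem _ _ hy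

theorem lie_mem_tail' [Fintype σ] (h : IsFlag b ord) (x : L) {m : ℕ} {y : L} (hy : y ∈ tail b ord m) :
    ⁅x, y⁆ ∈ tail b ord m := tail_antitone m.le_succ (lie_mem_tail h x hy)

theorem ad_pow_mem_tail [Fintype σ] (h : IsFlag b ord) (x y : L) (k : ℕ) :
    (LieAlgebra.ad F L x ^ k) y ∈ tail b ord k := by
  induction k with
  | zero => rw [tail_zero]; trivial
  | succ k ih =>
    rw [pow_succ', Module.End.mul_apply]
    exact lie_mem_tail h x ih

theorem exists_tail_eq_bot [Fintype σ] : ∃ M, tail b ord M = ⊥ ∧ ∀ i, ord i < M := by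
  have hM : ∀ i, ord i < Finset.univ.sup ord + 1 := fun i =>
    Nat.lt_succ_of_le (Finset.le_sup (f := ord) (Finset.mem_univ i))
  refine ⟨_, ?_, hM⟩
  rw [tail, Submodule.span_eq_bot]
  rintro _ ⟨i, hi, rfl⟩
  exact absurd (hM i) (not_lt.2 hi)

theorem exists_ad_pow_eq_zero [Fintype σ] (h : IsFlag b ord) : ∃ M : ℕ, ∀ x y : L,
    (LieAlgebra.ad F L x ^ M) y = 0 := by
  obtain ⟨M, hM, -⟩ := exists_tail_eq_bot (b := b) (ord := ord)
  exact ⟨M, fun x y => by simpa [hM] using ad_pow_mem_tail h x y M⟩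

theorem expAd_sub_mem_tail [Fintype σ] (hL : 2 ≤ finrank F L) (h : IsFlag b ord) (x : L) {m : ℕ} {y : L}
    (hy : y ∈ tail b ord m) : expAd F x y - y ∈ tail b ord (m + 1) := by
  rw [expAd_split hL, add_assoc, add_sub_cancel_left]
  refine add_mem (lie_mem_tail h x hy) (Submodule.sum_mem _ fun k _ => Submodule.smul_mem _ _ ?_)
  rw [pow_succ', Module.End.mul_apply]
  exact lie_mem_tail h x (ad_pow_mem (fun q => lie_mem_tail' h x) hy _)

theorem expAd_mem_tail [Fintype σ] (h : IsFlag b ord) (x : L) {m : ℕ} {y : L}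
    (hy : y ∈ tail b ord m) : expAd F x y ∈ tail b ord m :=
  expAd_mem_of_stable (fun _ => lie_mem_tail' h x) hy

/-- If the unipotent operator `exp (ad x)` preserves `f` on a stable subspace, then so does
`ad x`. -/
theorem lie_eq_zero_of_expAd [Fintype σ] (hL : 2 ≤ finrank F L) (h : IsFlag b ord) {f : Dual F L} {x : L}
    (Q : Submodule F L) (hQ : ∀ q ∈ Q, ⁅x, q⁆ ∈ Q) (hf : ∀ q ∈ Q, f (expAd F x q) = f q) :
    ∀ q ∈ Q, f ⁅x, q⁆ = 0 := by
  -- Induction on the power of `ad x` that kills `q`. The terms of order at least two in the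
  -- exponential are brackets of `x` with elements killed by a smaller power, so only the linear
  -- term is left.
  have key : ∀ k : ℕ, ∀ q ∈ Q, (LieAlgebra.ad F L x ^ k) q = 0 → f ⁅x, q⁆ = 0 := by
    intro k
    induction k with
    | zero =>
      intro q _ h0
      have : q = 0 := by simpa using h0
      simp [this]
    | succ k ih =>
      intro q hq h0
      have e := hf q hq
      rw [expAd_split hL, map_add, map_add, map_sum, Finset.sum_eq_zero, add_zero] at e
      · simpa using e
      · intro l _
        have e2 : (LieAlgebra.ad F L x ^ (l + 2)) q = ⁅x, (LieAlgebra.ad F L x ^ (l + 1)) q⁆ := by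
          rw [pow_succ', Module.End.mul_apply]; rfl
        rw [map_smul, e2, ih _ (ad_pow_mem hQ hq _), smul_zero]
        rw [← Module.End.mul_apply, ← pow_add, show k + (l + 1) = l + (k + 1) by ring, pow_add,
          Module.End.mul_apply, h0, map_zero]
  obtain ⟨M, hM⟩ := exists_ad_pow_eq_zero h
  exact fun q hq => key M q hq (hM x q)

end Flag

end Abstract

end ClassicalOrbits

namespace ClassicalOrbits

open Module

/-! ### The dimension of an orbit is the rank of the Kirillov form -/

section Dimension

variable {F : Type*} [Field F]

/-- Functions given by polynomials in the coordinates from `A`. -/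
def IsPolyIn {τ : Type*} (A : Set τ) (φ : (τ → F) → F) : Prop :=
  ∃ p ∈ MvPolynomial.supported F A, ∀ t, φ t = MvPolynomial.eval t p

namespace IsPolyIn

variable {τ : Type*} {A B : Set τ} {φ ψ : (τ → F) → F}

theorem mono (h : IsPolyIn A φ) (hAB : A ⊆ B) : IsPolyIn B φ := by
  obtain ⟨p, hp, e⟩ := h
  exact ⟨p, MvPolynomial.supported_mono hAB hp, e⟩

theorem const (c : F) : IsPolyIn A fun _ => c :=
  ⟨MvPolynomial.C c, Subalgebra.algebraMap_mem _ c, fun t => by simp⟩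

theorem coord {i : τ} (hi : i ∈ A) : IsPolyIn A fun t : τ → F => t i :=
  ⟨MvPolynomial.X i, MvPolynomial.X_mem_supported.2 hi, fun t => by simp⟩

theorem add (h : IsPolyIn A φ) (h' : IsPolyIn A ψ) : IsPolyIn A fun t => φ t + ψ t := by
  obtain ⟨p, hp, e⟩ := h
  obtain ⟨q, hq, e'⟩ := h'
  exact ⟨p + q, add_mem hp hq, fun t => by simp [e, e']⟩

theorem mul (h : IsPolyIn A φ) (h' : IsPolyIn A ψ) : IsPolyIn A fun t => φ t * ψ t := by
  obtain ⟨p, hp, e⟩ := h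
  obtain ⟨q, hq, e'⟩ := h'
  exact ⟨p * q, mul_mem hp hq, fun t => by simp [e, e']⟩

theorem pow (h : IsPolyIn A φ) (k : ℕ) : IsPolyIn A fun t => φ t ^ k := by
  obtain ⟨p, hp, e⟩ := h
  exact ⟨p ^ k, pow_mem hp k, fun t => by simp [e]⟩

theorem sum {ι : Type*} (s : Finset ι) {φ : ι → (τ → F) → F} (h : ∀ i ∈ s, IsPolyIn A (φ i)) :
    IsPolyIn A fun t => ∑ i ∈ s, φ i t := by
  classical
  induction s using Finset.induction_on with
  | empty => simpa using const (A := A) (0 : F)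
  | insert i s hi ih =>
    simp only [Finset.sum_insert hi]
    exact (h i (Finset.mem_insert_self _ _)).add
      (ih fun j hj => h j (Finset.mem_insert_of_mem hj))

theorem congr (h : IsPolyIn A φ) {t t' : τ → F} (e : ∀ i ∈ A, t i = t' i) : φ t = φ t' := by
  obtain ⟨p, hp, hφ⟩ := h
  rw [hφ, hφ]
  exact MvPolynomial.eval₂Hom_congr' rfl
    (fun i hi _ => e i (MvPolynomial.mem_supported.1 hp hi)) rfl

end IsPolyIn

/-- Over an infinite field the polynomials that vanish on the image form the kernel of the
substitution of `q`. By surjectivity the coordinate ring is the polynomial ring in the variables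
`τ`. -/
theorem zariskiDim_range {σ τ : Type*} [Finite τ] [Infinite F] (q : σ → MvPolynomial τ F)
    (hq : Function.Surjective (MvPolynomial.aeval q : MvPolynomial σ F →ₐ[F] MvPolynomial τ F)) :
    zariskiDim (Set.range fun t : τ → F => fun i => MvPolynomial.eval t (q i)) =
      (Nat.card τ : WithBot ℕ∞) := by
  have hker : MvPolynomial.vanishingIdeal F
      (Set.range fun t : τ → F => fun i => MvPolynomial.eval t (q i)) =
      RingHom.ker (MvPolynomial.aeval q : MvPolynomial σ F →ₐ[F] MvPolynomial τ F) := by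
    ext p
    have e : ∀ t : τ → F, MvPolynomial.aeval (fun i => MvPolynomial.eval t (q i)) p =
        MvPolynomial.eval t (MvPolynomial.aeval q p) := fun t => by
      induction p using MvPolynomial.induction_on with
      | C a => simp
      | add p q hp hq => simp only [map_add, hp, hq]
      | mul_X p i hp => simp only [map_mul, hp, MvPolynomial.aeval_X]
    rw [MvPolynomial.mem_vanishingIdeal_iff, RingHom.mem_ker, Set.forall_mem_range]
    simp only [e]
    constructor
    · intro h
      exact MvPolynomial.funext fun t => by simpa using h t
    · intro h t
      rw [h, map_zero]
  rw [zariskiDim, hker, ringKrullDim_eq_of_ringEquiv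
    (Ideal.quotientKerAlgEquivOfSurjective hq).toRingEquiv,
    MvPolynomial.ringKrullDim_of_isNoetherianRing, ringKrullDim_eq_zero_of_field, zero_add]

variable {L : Type*} [LieRing L] [LieAlgebra F L] {σ : Type*} (b : Basis σ F L) (ord : σ → ℕ)

/-- The leading positions of the forms `y ↦ f ⁅x, y⁆`. -/
def jumps (f : Dual F L) : Set σ :=
  {i | ∃ x : L, (∀ j, ord i < ord j → f ⁅x, b j⁆ = 0) ∧ f ⁅x, b i⁆ = 1}

variable {b ord}

theorem apply_eq_zero_of_mem_tail {g : Dual F L} {m : ℕ} (h : ∀ j, m ≤ ord j → g (b j) = 0)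
    {y : L} (hy : y ∈ tail b ord m) : g y = 0 := by
  induction hy using Submodule.span_induction with
  | mem y hy =>
    obtain ⟨j, hj, rfl⟩ := hy
    exact h j hj
  | zero => simp
  | add y z _ _ hy hz => rw [map_add, hy, hz, add_zero]
  | smul c y _ hy => rw [map_smul, hy, smul_zero]

theorem apply_eq_of_mem_tail {g g' : Dual F L} {m : ℕ} (h : ∀ j, m ≤ ord j → g (b j) = g' (b j))
    {y : L} (hy : y ∈ tail b ord m) : g y = g' y := by
  have := apply_eq_zero_of_mem_tail (g := g - g') (b := b) (ord := ord)
    (fun j hj => by simp [h j hj]) hy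
  simpa [sub_eq_zero] using this

theorem apply_lie_eq_zero {f : Dual F L} {x : L} {m : ℕ} (h : ∀ j, m ≤ ord j → f ⁅x, b j⁆ = 0)
    {y : L} (hy : y ∈ tail b ord m) : f ⁅x, y⁆ = 0 :=
  apply_eq_zero_of_mem_tail (g := kirillov f x) h hy

theorem mem_jumps {f : Dual F L} {i : σ} {x : L} (h : ∀ j, ord i < ord j → f ⁅x, b j⁆ = 0)
    (hi : f ⁅x, b i⁆ ≠ 0) : i ∈ jumps b ord f :=
  ⟨(f ⁅x, b i⁆)⁻¹ • x, fun j hj => by simp [h j hj], by simp [hi]⟩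

/-- Evaluation at the jumps is an isomorphism from the range of the Kirillov form onto the functions
on the jumps. It is injective, because the last nonzero value of a form `f ⁅x, ·⁆` is at a jump; it
is surjective by back substitution from the last jump. -/
theorem card_jumps [Fintype σ] (hord : Function.Injective ord) (f : Dual F L) :
    Nat.card (jumps b ord f) = kirillovRank f := by
  classical
  let ρ : LinearMap.range (kirillov f) →ₗ[F] (jumps b ord f → F) :=
    LinearMap.pi fun i => (Dual.eval F L (b i)) ∘ₗ Submodule.subtype _
  have hρ : ∀ w i, ρ w i = w.1 (b i) := fun w i => rfl
  have inj : Function.Injective ρ := by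
    have h0 : ∀ x : L, (∀ i : jumps b ord f, f ⁅x, b i⁆ = 0) → kirillov f x = 0 := ?_
    · rintro ⟨_, x, rfl⟩ ⟨_, y, rfl⟩ h
      refine Subtype.ext (sub_eq_zero.1 ?_)
      rw [← map_sub]
      refine h0 _ fun i => ?_
      have := congrFun h i
      simp only [hρ, kirillov_apply] at this
      rw [sub_lie, map_sub, this, sub_self]
    intro x h0
    by_contra hne
    have hex : ∃ i, f ⁅x, b i⁆ ≠ 0 := by
      by_contra! hall
      exact hne (b.ext fun i => by simpa using hall i)
    obtain ⟨i, hi, hmax⟩ := (Finset.univ.filter fun i => f ⁅x, b i⁆ ≠ 0).exists_max_image ord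
      (by obtain ⟨i, hi⟩ := hex; exact ⟨i, by simpa using hi⟩)
    have hi' : f ⁅x, b i⁆ ≠ 0 := by simpa using hi
    have hJ : i ∈ jumps b ord f := mem_jumps (fun j hj => by
      by_contra hc
      exact absurd (hmax j (by simpa using hc)) (not_le.2 hj)) hi'
    exact hi' (h0 ⟨i, hJ⟩)
  obtain ⟨M, -, hM⟩ := exists_tail_eq_bot (b := b) (ord := ord)
  have surj : Function.Surjective ρ := by
    intro t
    -- The prescribed values are attained at the jumps of order at least `M - k`. The witness of the
    -- next jump gives zero at all later positions, so adding a multiple of it spoils nothing.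
    have key : ∀ k : ℕ, ∃ x : L, ∀ i : jumps b ord f, M ≤ ord i + k → f ⁅x, b i⁆ = t i := by
      intro k
      induction k with
      | zero => exact ⟨0, fun i hi => absurd (hM i) (not_lt.2 hi)⟩
      | succ k ih =>
        obtain ⟨x, hx⟩ := ih
        by_cases hk : ∃ i : jumps b ord f, M = ord i + (k + 1)
        · obtain ⟨⟨i, hi⟩, hik⟩ := hk
          obtain ⟨z, hz, hzi⟩ := id hi
          refine ⟨x + (t ⟨i, hi⟩ - f ⁅x, b i⁆) • z, fun j hj => ?_⟩
          rcases hj.lt_or_eq with hj' | hj'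
          · have : ord i < ord j := by simp at hik; omega
            simp [hz j this, hx j (by omega)]
          · have : (⟨i, hi⟩ : jumps b ord f) = j :=
              Subtype.ext (hord (show ord i = ord j.1 by simp only at hik; omega))
            subst this
            simp [hzi]
        · refine ⟨x, fun j hj => hx j ?_⟩
          rcases hj.lt_or_eq with hj' | hj'
          · omega
          · exact absurd ⟨j, hj'⟩ hk
    obtain ⟨x, hx⟩ := key M
    exact ⟨⟨kirillov f x, x, rfl⟩, funext fun i => hx i (by omega)⟩
  rw [kirillovRank, (LinearEquiv.ofBijective ρ ⟨inj, surj⟩).finrank_eq, Module.finrank_pi,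
    Nat.card_eq_fintype_card]

theorem repr_expAd_smul [Fintype σ] {τ : Type*} (x : L) (j : τ) (i l : σ) {A : Set τ}
    (hj : j ∈ A) : IsPolyIn A fun t : τ → F => b.repr (expAd F (t j • x) (b i)) l := by
  have e : (fun t : τ → F => b.repr (expAd F (t j • x) (b i)) l) = fun t =>
      ∑ k ∈ Finset.range (finrank F L), (t j) ^ k *
        (((Nat.factorial k : F)⁻¹) * b.repr ((LieAlgebra.ad F L x ^ k) (b i)) l) := by
    funext t
    rw [expAd_apply, map_sum, Finsupp.finsetSum_apply]
    refine Finset.sum_congr rfl fun k _ => ?_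
    rw [map_smul (LieAlgebra.ad F L), smul_pow, LinearMap.smul_apply]
    simp only [map_smul, Finsupp.smul_apply, smul_eq_mul]
    ring
  rw [e]
  exact IsPolyIn.sum _ fun k _ => ((IsPolyIn.coord hj).pow k).mul (IsPolyIn.const _)

theorem repr_comp_apply [Fintype σ] (g h : L →ₗ[F] L) (i l : σ) :
    b.repr (g (h (b i))) l = ∑ j, b.repr (h (b i)) j * b.repr (g (b j)) l := by
  conv_lhs => rw [← b.sum_repr (h (b i))]
  rw [map_sum, map_sum, Finsupp.finsetSum_apply]
  simp only [map_smul, Finsupp.smul_apply, smul_eq_mul]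

theorem group_mem_tail [Fintype σ] (hG : ExpGroup F L) (h : IsFlag b ord) {g : L ≃ₗ[F] L}
    (hg : g ∈ adjointGroup F L) {m : ℕ} {y : L} (hy : y ∈ tail b ord m) : g y ∈ tail b ord m := by
  obtain ⟨x, hx⟩ := hG.eq_expAd g hg
  rw [show g y = expAd F x y from LinearMap.congr_fun hx y]
  exact expAd_mem_tail h x hy

theorem group_sub_mem_tail [Fintype σ] (hG : ExpGroup F L) (h : IsFlag b ord) {g : L ≃ₗ[F] L}
    (hg : g ∈ adjointGroup F L) {m : ℕ} {y : L} (hy : y ∈ tail b ord m) :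
    g y - y ∈ tail b ord (m + 1) := by
  obtain ⟨x, hx⟩ := hG.eq_expAd g hg
  rw [show g y = expAd F x y from LinearMap.congr_fun hx y]
  exact expAd_sub_mem_tail hG.two_le h x hy

/-- One step of the parametrization at a position that is not a jump. -/
theorem apply_eq_of_not_mem_jumps [Fintype σ] (hG : ExpGroup F L) (h : IsFlag b ord) {f : Dual F L}
    {g k : L ≃ₗ[F] L} (hg : g ∈ adjointGroup F L) (hk : k ∈ adjointGroup F L) {i : σ}
    (hi : i ∉ jumps b ord f) (hgk : ∀ j, ord i + 1 ≤ ord j → f (k (b j)) = f (g (b j))) :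
    f (k (b i)) = f (g (b i)) := by
  have agree : ∀ y ∈ tail b ord (ord i + 1), f (k y) = f (g y) := fun y hy =>
    apply_eq_of_mem_tail (g := f ∘ₗ (k : L →ₗ[F] L)) (g' := f ∘ₗ (g : L →ₗ[F] L)) hgk hy
  -- The forms `f` and `f ∘ exp (ad z)` agree on the tail after `i`, so `f ⁅z, ·⁆` vanishes there.
  -- It vanishes at `b i` too, since otherwise `i` would be a jump. Hence `exp (ad z)` preserves `f`
  -- at `k (b i)`.
  obtain ⟨z, hz⟩ := hG.eq_expAd (g * k⁻¹) (mul_mem hg (inv_mem hk))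
  have hz' : ∀ y, expAd F z (k y) = g y := fun y => by
    rw [← LinearMap.congr_fun hz]; simp
  have hzy : ∀ y, expAd F z y = g (k⁻¹ y) := fun y => by
    rw [← LinearMap.congr_fun hz]; simp
  have h1 := lie_eq_zero_of_expAd hG.two_le h (f := f) (x := z) (tail b ord (ord i + 1))
    (fun q => lie_mem_tail' h z) (fun q hq => by
      have := agree (k⁻¹ q) (group_mem_tail hG h (inv_mem hk) hq)
      rw [hzy, ← this]; simp)
  have h2 : f ⁅z, b i⁆ = 0 := by
    by_contra hne
    exact hi (mem_jumps (fun j hj => h1 _ (basis_mem_tail hj)) hne)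
  have hr := group_sub_mem_tail hG h hk (basis_mem_tail (b := b) le_rfl : b i ∈ tail b ord (ord i))
  have h3 : f (expAd F z (b i)) = f (b i) := by
    rw [apply_expAd hG.two_le _ (fun q => lie_mem_tail' h z) (lie_basis_mem_tail h z i) h1, h2,
      add_zero]
  have h4 : f (expAd F z (k (b i) - b i)) = f (k (b i) - b i) := by
    rw [apply_expAd hG.two_le _ (fun q => lie_mem_tail' h z) (lie_mem_tail' h z hr) h1, h1 _ hr,
      add_zero]
  rw [map_sub, map_sub, map_sub, hz', h3] at h4
  exact (sub_left_inj.1 h4).symm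

/-- The section `s` is built position by position from the end of the basis. A jump brings a new
factor `exp (t • x)` and a free parameter `t`; elsewhere the value is forced by the later ones. The
polynomials that arise at a position involve only the parameters of later jumps, which makes the
parametrization triangular. -/
theorem exists_parametrization [Fintype σ] (hG : ExpGroup F L) (h : IsFlag b ord) (f : Dual F L)
    (M : ℕ) (hM : ∀ i, ord i < M) (k : ℕ) :
    ∃ s : (jumps b ord f → F) → L ≃ₗ[F] L, (∀ t, s t ∈ adjointGroup F L) ∧
      (∀ i l, IsPolyIn {j | M ≤ ord j.1 + k} fun t => b.repr (s t (b i)) l) ∧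
      (∀ i : jumps b ord f, M ≤ ord i.1 + k →
        IsPolyIn {j | ord i.1 < ord j.1} fun t => f (s t (b i)) - t i) ∧
      (∀ i, i ∉ jumps b ord f → M ≤ ord i + k →
        IsPolyIn {j | ord i < ord j.1} fun t => f (s t (b i))) ∧
      ∀ g ∈ adjointGroup F L, ∃ t, ∀ i, M ≤ ord i + k → f (s t (b i)) = f (g (b i)) := by
  classical
  induction k with
  | zero =>
    refine ⟨fun _ => 1, fun _ => one_mem _, fun i l => IsPolyIn.const _,
      fun i hi => absurd (hM i) (not_lt.2 hi), fun i _ hi => absurd (hM i) (not_lt.2 hi),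
      fun g _ => ⟨0, fun i hi => absurd (hM i) (not_lt.2 hi)⟩⟩
  | succ k ih =>
    obtain ⟨s, hs, hp, hJ, hN, hsurj⟩ := ih
    have hf : ∀ i, IsPolyIn {j | M ≤ ord j.1 + k} fun t => f (s t (b i)) := fun i => by
      have e : (fun t => f (s t (b i))) = fun t => ∑ l, b.repr (s t (b i)) l * f (b l) := by
        funext t
        conv_lhs => rw [← b.sum_repr (s t (b i)), map_sum]
        simp only [map_smul, smul_eq_mul]
      rw [e]
      exact IsPolyIn.sum _ fun l _ => (hp i l).mul (IsPolyIn.const _)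
    by_cases hk : ∃ i, M = ord i + (k + 1)
    · obtain ⟨i₀, hi₀⟩ := hk
      have split : ∀ i, M ≤ ord i + (k + 1) → i = i₀ ∨ (M ≤ ord i + k ∧ ord i₀ + 1 ≤ ord i) := by
        intro i hi
        rcases hi.lt_or_eq with hi' | hi'
        · exact Or.inr ⟨by omega, by omega⟩
        · exact Or.inl (h.1 (by omega))
      have hset : {j : jumps b ord f | M ≤ ord j.1 + k} = {j | ord i₀ < ord j.1} := by
        ext j
        simp only [Set.mem_ofPred_eq]
        omega
      by_cases hmem : i₀ ∈ jumps b ord f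
      · obtain ⟨x, hx, hx1⟩ := id hmem
        -- Acting with `exp (c • x)` on the left, `x` being the witness of the jump, adds `c` to the
        -- value at `i₀` and fixes `f` on the tail after `i₀`.
        choose u hu hux using fun c : F => hG.expAd_mem (c • x)
        have hux' : ∀ c y, u c y = expAd F (c • x) y := fun c y => LinearMap.congr_fun (hux c) y
        have h0 : ∀ c : F, ∀ q ∈ tail b ord (ord i₀ + 1), f ⁅c • x, q⁆ = 0 := fun c q hq => by
          have := apply_lie_eq_zero (f := f) (x := x) (m := ord i₀ + 1) (fun j hj => hx j hj) hq
          simp [this]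
        have hfix : ∀ c : F, ∀ q ∈ tail b ord (ord i₀ + 1), f (u c q) = f q := fun c q hq => by
          rw [hux', apply_expAd hG.two_le _ (fun q => lie_mem_tail' h _) (lie_mem_tail' h _ hq)
            (h0 c), h0 c q hq, add_zero]
        have hi₀u : ∀ c : F, f (u c (b i₀)) = f (b i₀) + c := fun c => by
          rw [hux', apply_expAd hG.two_le _ (fun q => lie_mem_tail' h _) (lie_basis_mem_tail h _ _)
            (h0 c)]
          simp [hx1]
        have hsi₀ : ∀ t, f ((u (t ⟨i₀, hmem⟩) * s t) (b i₀)) =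
            f (s t (b i₀)) + t ⟨i₀, hmem⟩ := fun t => by
          have hr := group_sub_mem_tail hG h (hs t)
            (basis_mem_tail (b := b) le_rfl : b i₀ ∈ tail b ord (ord i₀))
          have := hfix (t ⟨i₀, hmem⟩) _ hr
          rw [map_sub, map_sub, map_sub, hi₀u] at this
          rw [LinearEquiv.mul_apply]
          linear_combination this
        have hsi : ∀ t, ∀ i, ord i₀ + 1 ≤ ord i →
            f ((u (t ⟨i₀, hmem⟩) * s t) (b i)) = f (s t (b i)) := fun t i hi =>
          hfix _ _ (group_mem_tail hG h (hs t) (basis_mem_tail hi))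
        refine ⟨fun t => u (t ⟨i₀, hmem⟩) * s t, fun t => mul_mem (hu _) (hs t), ?_, ?_, ?_, ?_⟩
        · intro i l
          have e : (fun t => b.repr ((u (t ⟨i₀, hmem⟩) * s t) (b i)) l) = fun t =>
              ∑ j, b.repr (s t (b i)) j * b.repr (expAd F (t ⟨i₀, hmem⟩ • x) (b j)) l := by
            funext t
            simp only [← hux']
            exact repr_comp_apply (u (t ⟨i₀, hmem⟩) : L →ₗ[F] L) (s t : L →ₗ[F] L) i l
          rw [e]
          exact IsPolyIn.sum _ fun j _ => ((hp i j).mono fun j hj => by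
            simp only [Set.mem_ofPred_eq] at hj ⊢; omega).mul
            (repr_expAd_smul x _ j l (by simp only [Set.mem_ofPred_eq]; omega))
        · intro i hi
          rcases split i hi with hi' | ⟨hi', hi''⟩
          · obtain rfl : (⟨i₀, hmem⟩ : jumps b ord f) = i := Subtype.ext hi'.symm
            simp only [hsi₀, add_sub_cancel_right]
            exact hset ▸ hf i₀
          · simp only [hsi _ i hi'']
            exact hJ i hi'
        · intro i hiJ hi
          rcases split i hi with rfl | ⟨hi', hi''⟩
          · exact absurd hmem hiJ
          · simp only [hsi _ i hi'']
            exact hN i hiJ hi'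
        · intro g hg
          obtain ⟨t, ht⟩ := hsurj g hg
          -- The new parameter absorbs the discrepancy at `i₀`; the section constructed before does
          -- not depend on it.
          let t' := Function.update t ⟨i₀, hmem⟩ (f (g (b i₀)) - f (s t (b i₀)))
          have htt' : ∀ i, f (s t' (b i)) = f (s t (b i)) := fun i => (hf i).congr fun j hj => by
            refine Function.update_of_ne ?_ _ _
            rintro rfl
            simp only [Set.mem_ofPred_eq] at hj
            omega
          refine ⟨t', fun i hi => ?_⟩
          rcases split i hi with rfl | ⟨hi', hi''⟩
          · rw [hsi₀, htt']
            simp [t']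
          · rw [hsi _ i hi'', htt', ht i hi']
      · refine ⟨s, hs, fun i l => (hp i l).mono fun j hj => ?_, fun i hi => ?_, fun i hiJ hi => ?_,
          fun g hg => ?_⟩
        · simp only [Set.mem_ofPred_eq] at hj ⊢
          omega
        · rcases split i hi with hi' | ⟨hi', hi''⟩
          · exact absurd (hi' ▸ i.2) hmem
          · exact hJ i hi'
        · rcases split i hi with rfl | ⟨hi', hi''⟩
          · exact hset ▸ hf i
          · exact hN i hiJ hi'
        · obtain ⟨t, ht⟩ := hsurj g hg
          refine ⟨t, fun i hi => ?_⟩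
          rcases split i hi with rfl | ⟨hi', hi''⟩
          · exact apply_eq_of_not_mem_jumps hG h hg (hs t) hmem fun j hj => ht j (by omega)
          · exact ht i hi'
    · have hne : ∀ i, M ≤ ord i + (k + 1) → M ≤ ord i + k := fun i hi => by
        rcases hi.lt_or_eq with hi' | hi'
        · omega
        · exact absurd ⟨i, hi'⟩ hk
      exact ⟨s, hs, fun i l => (hp i l).mono fun j hj => by
          simp only [Set.mem_ofPred_eq] at hj ⊢; omega,
        fun i hi => hJ i (hne i hi), fun i hiJ hi => hN i hiJ (hne i hi),
        fun g hg => (hsurj g hg).imp fun t ht i hi => ht i (hne i hi)⟩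

/-- The dimension of a coadjoint orbit is the rank of the Kirillov form. -/
theorem zariskiDim_orbit [Fintype σ] [Infinite F] (hG : ExpGroup F L) (h : IsFlag b ord)
    (f : Dual F L) :
    zariskiDim ((fun f' : Dual F L => fun i => f' (b i)) '' coadjointOrbit f) =
      (kirillovRank f : WithBot ℕ∞) := by
  classical
  obtain ⟨M, -, hM⟩ := exists_tail_eq_bot (b := b) (ord := ord)
  obtain ⟨s, hs, hp, hJ, hN, hsurj⟩ := exists_parametrization hG h f M hM M
  have hq : ∀ i, ∃ q : MvPolynomial (jumps b ord f) F,
      (∀ t, f (s t (b i)) = MvPolynomial.eval t q) ∧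
      ∀ hi : i ∈ jumps b ord f, q - MvPolynomial.X ⟨i, hi⟩ ∈
        MvPolynomial.supported F {j : jumps b ord f | ord i < ord j.1} := by
    intro i
    by_cases hi : i ∈ jumps b ord f
    · obtain ⟨q, hq, e⟩ := hJ ⟨i, hi⟩ (by omega)
      exact ⟨q + MvPolynomial.X ⟨i, hi⟩, fun t => by simp [← e], fun _ => by simpa using hq⟩
    · obtain ⟨q, hq, e⟩ := hN i hi (by omega)
      exact ⟨q, e, fun hi' => absurd hi' hi⟩
  choose q hq hq' using hq
  have himg : (fun f' : Dual F L => fun i => f' (b i)) '' coadjointOrbit f =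
      Set.range fun t => fun i => MvPolynomial.eval t (q i) := by
    ext w
    constructor
    · rintro ⟨f', hf', rfl⟩
      obtain ⟨g, hg, rfl⟩ := mem_orbit_iff'.1 hf'
      obtain ⟨t, ht⟩ := hsurj g hg
      exact ⟨t, funext fun i => by simp only [← hq]; exact ht i (by omega)⟩
    · rintro ⟨t, rfl⟩
      exact ⟨f ∘ₗ (s t : L →ₗ[F] L), mem_orbit_iff'.2 ⟨s t, hs t, rfl⟩,
        funext fun i => by simp only [← hq]; rfl⟩
  rw [himg, zariskiDim_range q, card_jumps h.1]
  -- At a jump `j` the coordinate is `X j` plus a polynomial in later variables. By descending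
  -- induction all variables belong to the subalgebra generated by the coordinates.
  have key : ∀ k : ℕ, ∀ j : jumps b ord f, M ≤ ord j.1 + k →
      MvPolynomial.X j ∈ (MvPolynomial.aeval q : _ →ₐ[F] MvPolynomial (jumps b ord f) F).range := by
    intro k
    induction k with
    | zero => exact fun j hj => absurd (hM j) (not_lt.2 hj)
    | succ k ih =>
      intro j hj
      have h1 : MvPolynomial.supported F {l : jumps b ord f | ord j.1 < ord l.1} ≤
          (MvPolynomial.aeval q : _ →ₐ[F] MvPolynomial (jumps b ord f) F).range := by
        rw [MvPolynomial.supported_eq_adjoin_X, Algebra.adjoin_le_iff]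
        rintro _ ⟨l, hl, rfl⟩
        simp only [Set.mem_ofPred_eq] at hl
        exact ih l (by omega)
      have h2 : q j ∈ (MvPolynomial.aeval q : _ →ₐ[F] MvPolynomial (jumps b ord f) F).range :=
        ⟨MvPolynomial.X j.1, by simp⟩
      simpa using sub_mem h2 (h1 (hq' j.1 j.2))
  rw [← AlgHom.range_eq_top, eq_top_iff, ← MvPolynomial.adjoin_range_X, Algebra.adjoin_le_iff]
  rintro _ ⟨j, rfl⟩
  exact key M j (by omega)

end Dimension

end ClassicalOrbits

namespace ClassicalOrbits

open Module

/-! ### Lower and upper bounds for the rank -/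

section Planes

variable {F : Type*} [Field F] {L : Type*} [LieRing L] [LieAlgebra F L]

theorem lie_mem_of_span {v : ℕ → L} {A B : Set ℕ} {Q : Submodule F L}
    (h : ∀ i ∈ A, ∀ j ∈ B, ⁅v i, v j⁆ ∈ Q) {x y : L} (hx : x ∈ Submodule.span F (v '' A))
    (hy : y ∈ Submodule.span F (v '' B)) : ⁅x, y⁆ ∈ Q := by
  induction hx using Submodule.span_induction with
  | mem x hx =>
    obtain ⟨i, hi, rfl⟩ := hx
    induction hy using Submodule.span_induction with
    | mem y hy =>
      obtain ⟨j, hj, rfl⟩ := hy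
      exact h i hi j hj
    | zero => simp
    | add y z _ _ hy hz => rw [lie_add]; exact add_mem hy hz
    | smul c y _ hy => rw [lie_smul]; exact Submodule.smul_mem _ _ hy
  | zero => simp
  | add y z _ _ hy hz => rw [add_lie]; exact add_mem hy hz
  | smul c y _ hy => rw [smul_lie]; exact Submodule.smul_mem _ _ hy

/-- There is an `m`-dimensional subspace of `Q` on which the form `x, y ↦ f ⁅x, y⁆` is
nondegenerate. -/
def Nondeg (f : Dual F L) (Q : Submodule F L) (m : ℕ) : Prop :=
  ∃ W ≤ Q, finrank F W = m ∧ ∀ w ∈ W, (∀ w' ∈ W, f ⁅w, w'⁆ = 0) → w = 0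

theorem nondeg_zero (f : Dual F L) (Q : Submodule F L) : Nondeg f Q 0 :=
  ⟨⊥, bot_le, finrank_bot F L, fun w hw _ => by simpa using hw⟩

variable [FiniteDimensional F L]

theorem Nondeg.le_rank {f : Dual F L} {Q : Submodule F L} {m : ℕ} (h : Nondeg f Q m) :
    m ≤ kirillovRank f := by
  obtain ⟨W, -, rfl, hW⟩ := h
  have h1 : Function.Injective ((kirillov f).rangeRestrict ∘ₗ W.subtype) := by
    refine fun x y hxy => ?_
    have e : kirillov f x.1 = kirillov f y.1 := congrArg Subtype.val hxy
    refine Subtype.ext (sub_eq_zero.1 (hW _ (sub_mem x.2 y.2) fun w' _ => ?_))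
    have := LinearMap.congr_fun e w'
    simp only [kirillov_apply] at this
    rw [sub_lie, map_sub, this, sub_self]
  exact LinearMap.finrank_le_finrank_of_injective h1

/-- The Kirillov form maps an isotropic `W` into its annihilator, of dimension at most `a`. So at
least `finrank W - a` dimensions of `W` lie in the radical, whose codimension is then at most `2 *
a`. -/
theorem kirillovRank_le {f : Dual F L} {W : Submodule F L}
    (hW : ∀ x ∈ W, ∀ y ∈ W, f ⁅x, y⁆ = 0) {a : ℕ} (ha : finrank F L ≤ finrank F W + a) :
    kirillovRank f ≤ 2 * a := by
  have h1 : finrank F (LinearMap.range (kirillov f)) + finrank F (LinearMap.ker (kirillov f)) =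
      finrank F L := (kirillov f).finrank_range_add_finrank_ker
  let κ := (kirillov f) ∘ₗ W.subtype
  have h2 : finrank F (LinearMap.range κ) + finrank F (LinearMap.ker κ) = finrank F W :=
    κ.finrank_range_add_finrank_ker
  have h3 : finrank F (LinearMap.range κ) ≤ finrank F W.dualAnnihilator := by
    refine Submodule.finrank_mono ?_
    rintro _ ⟨x, rfl⟩
    rw [Submodule.mem_dualAnnihilator]
    exact fun w hw => hW _ x.2 _ hw
  have h4 : finrank F W + finrank F W.dualAnnihilator = finrank F L :=
    Subspace.finrank_add_finrank_dualAnnihilator_eq W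
  have h5 : finrank F (LinearMap.ker κ) ≤ finrank F (LinearMap.ker (kirillov f)) := by
    have : (LinearMap.ker κ).map W.subtype ≤ LinearMap.ker (kirillov f) := by
      rintro _ ⟨x, hx, rfl⟩
      exact hx
    exact (LinearEquiv.finrank_eq (Submodule.equivMapOfInjective W.subtype
      W.injective_subtype (LinearMap.ker κ))).trans_le (Submodule.finrank_mono this)
  have h6 : finrank F (LinearMap.range (kirillov f)) = kirillovRank f := rfl
  omega

/-- The `b i` may pair arbitrarily with each other and with `Q`. For an element of the radical,
pairing with the `d i` kills its coefficients at the `b i`, then pairing with `W` kills its part in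
`W`, and pairing with the `b i` kills the rest. -/
theorem Nondeg.block {f : Dual F L} {Q Q' : Submodule F L} {m s : ℕ} (h : Nondeg f Q m)
    (hQ : Q ≤ Q') (d b : Fin s → L) (hd : ∀ i, d i ∈ Q') (hb : ∀ i, b i ∈ Q')
    (hdQ : ∀ i, ∀ q ∈ Q, f ⁅d i, q⁆ = 0) (hdd : ∀ i j, f ⁅d i, d j⁆ = 0)
    (hdet : (Matrix.of fun i j => f ⁅d i, b j⁆).det ≠ 0) : Nondeg f Q' (m + 2 * s) := by
  obtain ⟨W, hW, rfl, hWn⟩ := h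
  let φ : (W × (Fin s → F)) × (Fin s → F) →ₗ[F] L :=
    (W.subtype.coprod (Fintype.linearCombination F d)).coprod (Fintype.linearCombination F b)
  have hφ : ∀ x, φ x = x.1.1 + ∑ i, x.1.2 i • d i + ∑ i, x.2 i • b i := fun x => by
    simp [φ, Fintype.linearCombination_apply]
  have key : ∀ x, (∀ y, f ⁅φ x, φ y⁆ = 0) → x = 0 := by
    rintro ⟨⟨w, α⟩, β⟩ hx
    have h1 : ∀ i, f ⁅φ ⟨⟨w, α⟩, β⟩, d i⁆ = 0 := fun i => by
      have := hx ⟨⟨0, Pi.single i 1⟩, 0⟩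
      rw [hφ ⟨⟨0, Pi.single i 1⟩, 0⟩] at this
      simpa [Pi.single_apply, ite_smul] using this
    have h2 : ∀ i, f ⁅φ ⟨⟨w, α⟩, β⟩, b i⁆ = 0 := fun i => by
      have := hx ⟨⟨0, 0⟩, Pi.single i 1⟩
      rw [hφ ⟨⟨0, 0⟩, Pi.single i 1⟩] at this
      simpa [Pi.single_apply, ite_smul] using this
    have h3 : ∀ w' : W, f ⁅φ ⟨⟨w, α⟩, β⟩, w'.1⁆ = 0 := fun w' => by
      have := hx ⟨⟨w', 0⟩, 0⟩
      rw [hφ ⟨⟨w', 0⟩, 0⟩] at this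
      simpa using this
    simp only [hφ, add_lie, sum_lie, smul_lie, map_add, map_sum, map_smul, smul_eq_mul] at h1 h2 h3
    have hβ : β = 0 := by
      refine Matrix.eq_zero_of_mulVec_eq_zero hdet (funext fun i => ?_)
      have := h1 i
      simp only [hdd, mul_zero, Finset.sum_const_zero, add_zero] at this
      rw [← lie_skew, map_neg, hdQ i _ (hW w.2), neg_zero, zero_add] at this
      simp only [Matrix.mulVec, dotProduct, Matrix.of_apply, Pi.zero_apply]
      rw [← neg_eq_zero, ← this, ← Finset.sum_neg_distrib]
      refine Finset.sum_congr rfl fun j _ => ?_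
      rw [← lie_skew, map_neg]
      ring
    subst hβ
    have hw : w = 0 := by
      refine Subtype.ext (hWn _ w.2 fun w' hw' => ?_)
      have := h3 ⟨w', hw'⟩
      simpa [hdQ _ _ (hW hw')] using this
    subst hw
    have hα : α = 0 := by
      refine Matrix.eq_zero_of_vecMul_eq_zero hdet (funext fun i => ?_)
      have := h2 i
      simpa [Matrix.vecMul, dotProduct] using this
    subst hα
    rfl
  have hinj : Function.Injective φ := by
    intro x y hxy
    refine sub_eq_zero.1 (key _ fun z => ?_)
    rw [map_sub, hxy, sub_self, zero_lie, map_zero]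
  refine ⟨LinearMap.range φ, ?_, ?_, ?_⟩
  · rintro _ ⟨x, rfl⟩
    rw [hφ]
    exact add_mem (add_mem (hQ (hW x.1.1.2)) (Submodule.sum_mem _ fun i _ =>
      Submodule.smul_mem _ _ (hd i))) (Submodule.sum_mem _ fun i _ =>
      Submodule.smul_mem _ _ (hb i))
  · rw [LinearMap.finrank_range_of_inj hinj]
    simp
    ring
  · rintro _ ⟨x, rfl⟩ hx
    rw [key x fun y => hx _ ⟨y, rfl⟩, map_zero]

end Planes

/-! ### States of the reduction and the passage between them -/

section Reduction

variable {F : Type*} [Field F] {L : Type*} [LieRing L] [LieAlgebra F L]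

/-- The form vanishes on the indices in `P` outside `S`, and nowhere on `Z`. -/
def Fits (v : ℕ → L) (P S Z : Set ℕ) (f : Dual F L) : Prop :=
  (∀ i ∈ P, i ∉ S → f (v i) = 0) ∧ ∀ i ∈ Z, f (v i) ≠ 0

variable (F) in
/-- The state of the reduction of a family of coadjoint orbits. The subspace spanned by `P` is a
subalgebra in which the span of `P \ S` is an ideal annihilated by the forms; modulo this ideal the
brackets are given by `E`, and `Z` is central. -/
structure Reduced (v : ℕ → L) (R : ℕ) (P S Z : Set ℕ) (E : List Rel) (a : ℕ) : Prop where
  subZ : Z ⊆ S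
  subS : S ⊆ P
  subP : P ⊆ Set.Iio R
  rel : ∀ t ∈ E, ⁅v t.i, v t.j⁆ = (t.c : F) • v t.k ∧ (t.c : F) ≠ 0
  mem : ∀ t ∈ E, t.i ∈ S \ Z ∧ t.j ∈ S \ Z ∧ t.k ∈ S ∧ t.i ≠ t.j
  unrel : ∀ i ∈ P, ∀ j ∈ P, (∀ t ∈ E, t.joins i j = false) →
    ⁅v i, v j⁆ ∈ Submodule.span F (v '' (P \ S))
  lift : ∀ f : Dual F L, Fits v P S Z f → ∃ f' ∈ coadjointOrbit f, (∀ i ∈ P, f' (v i) = f (v i)) ∧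
    ∀ i < R, i ∉ P → f' (v i) = 0
  planes : ∀ f : Dual F L, Fits v P S Z f → ∀ m, Nondeg f (Submodule.span F (v '' P)) m →
    Nondeg f ⊤ (m + 2 * a)
  codim : finrank F L ≤ finrank F (Submodule.span F (v '' P)) + a

theorem Rel.joins_iff {t : Rel} {r c : ℕ} :
    t.joins r c = true ↔ (t.i = r ∧ t.j = c) ∨ (t.i = c ∧ t.j = r) := by
  simp [Rel.joins]

theorem Rel.meets_eq_false {t : Rel} {g : ℕ} : t.meets g = false ↔ t.i ≠ g ∧ t.j ≠ g := by
  rw [Bool.eq_false_iff]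
  simp [Rel.meets]

theorem Rel.joins_comm {t : Rel} {r c : ℕ} : t.joins r c = t.joins c r := by
  rw [Bool.eq_iff_iff, Rel.joins_iff, Rel.joins_iff, or_comm]

theorem Fits.apply_eq_zero {v : ℕ → L} {P S Z : Set ℕ} {f : Dual F L} (h : Fits v P S Z f) {y : L}
    (hy : y ∈ Submodule.span F (v '' (P \ S))) : f y = 0 := by
  induction hy using Submodule.span_induction with
  | mem y hy =>
    obtain ⟨j, hj, rfl⟩ := hy
    exact h.1 j hj.1 hj.2
  | zero => simp
  | add y z _ _ hy hz => rw [map_add, hy, hz, add_zero]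
  | smul c y _ hy => rw [map_smul, hy, smul_zero]

namespace Reduced

variable {v : ℕ → L} {R : ℕ} {P S Z : Set ℕ} {E : List Rel} {a : ℕ}

/-- The relations join only elements of `S \ Z`, so brackets with `P \ S` or with `Z` fall into the
ideal. -/
theorem lie_mem (h : Reduced F v R P S Z E a) {x y : L} (hx : x ∈ Submodule.span F (v '' P))
    (hy : y ∈ Submodule.span F (v '' ((P \ S) ∪ Z))) :
    ⁅x, y⁆ ∈ Submodule.span F (v '' (P \ S)) := by
  refine lie_mem_of_span (fun i hi j hj => h.unrel i hi j ?_ fun t ht => ?_) hx hy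
  · rcases hj with hj | hj
    · exact hj.1
    · exact h.subS (h.subZ hj)
  · rw [Bool.eq_false_iff, ne_eq, Rel.joins_iff]
    have := h.mem t ht
    rintro (⟨rfl, rfl⟩ | ⟨rfl, rfl⟩)
    · rcases hj with hj | hj
      · exact hj.2 this.2.1.1
      · exact this.2.1.2 hj
    · rcases hj with hj | hj
      · exact hj.2 this.1.1
      · exact this.1.2 hj

/-- The bracket is central modulo the ideal, so the terms of higher order lie in the ideal and `f`
kills them. -/
theorem apply_exp (hG : ExpGroup F L) (h : Reduced F v R P S Z E a) {f : Dual F L}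
    (hf : Fits v P S Z f) {x y : L} (hx : x ∈ Submodule.span F (v '' P))
    (hxy : ⁅x, y⁆ ∈ Submodule.span F (v '' ((P \ S) ∪ Z))) :
    f (expAd F x y) = f y + f ⁅x, y⁆ :=
  apply_expAd hG.two_le _ (fun _ hq => Submodule.span_mono (Set.image_mono Set.subset_union_left)
    (h.lie_mem hx hq)) hxy fun _ hq => hf.apply_eq_zero (h.lie_mem hx hq)

theorem apply_exp' (hG : ExpGroup F L) (h : Reduced F v R P S Z E a) {f : Dual F L}
    (hf : Fits v P S Z f) {x y : L} (hx : x ∈ Submodule.span F (v '' P))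
    (hxy : ⁅x, y⁆ ∈ Submodule.span F (v '' (P \ S))) :
    f (expAd F x y) = f y := by
  rw [h.apply_exp hG hf hx (Submodule.span_mono (Set.image_mono Set.subset_union_left) hxy),
    hf.apply_eq_zero hxy, add_zero]

theorem unjoined {t : Rel} {g : ℕ} (hg : t.meets g = false) (j : ℕ) : t.joins g j = false := by
  rw [Rel.meets_eq_false] at hg
  rw [Bool.eq_false_iff, ne_eq, Rel.joins_iff]
  tauto

/-- The form vanishes at a central element. -/
theorem vanish (h : Reduced F v R P S Z E a) {g : ℕ} (hg : g ∈ S) (hgZ : g ∉ Z)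
    (hgE : ∀ t ∈ E, t.meets g = false) {E' : List Rel}
    (hE' : ∀ t, t ∈ E' ↔ t ∈ E ∧ t.k ≠ g) : Reduced F v R P (S \ {g}) Z E' a := by
  have hmono : Submodule.span F (v '' (P \ S)) ≤ Submodule.span F (v '' (P \ (S \ {g}))) :=
    Submodule.span_mono (Set.image_mono (Set.sdiff_subset_sdiff_right Set.sdiff_subset))
  have hFits : ∀ f : Dual F L, Fits v P (S \ {g}) Z f → Fits v P S Z f := fun f hf =>
    ⟨fun i hi hiS => hf.1 i hi fun hc => hiS hc.1, hf.2⟩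
  have hne : ∀ t ∈ E, t.i ≠ g ∧ t.j ≠ g := fun t ht =>
    Rel.meets_eq_false.1 (hgE t ht)
  refine ⟨fun i hi => ⟨h.subZ hi, fun e => hgZ (e ▸ hi)⟩, Set.sdiff_subset.trans h.subS, h.subP,
    fun t ht => h.rel t ((hE' t).1 ht).1, fun t ht => ?_, fun i hi j hj hij => ?_,
    fun f hf => h.lift f (hFits f hf), fun f hf => h.planes f (hFits f hf), h.codim⟩
  · obtain ⟨htE, htk⟩ := (hE' t).1 ht
    obtain ⟨h1, h2, h3, h4⟩ := h.mem t htE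
    exact ⟨⟨⟨h1.1, (hne t htE).1⟩, h1.2⟩, ⟨⟨h2.1, (hne t htE).2⟩, h2.2⟩, ⟨h3, htk⟩, h4⟩
  · by_cases hall : ∀ t ∈ E, t.joins i j = false
    · exact hmono (h.unrel i hi j hj hall)
    · push Not at hall
      obtain ⟨t, htE, htj⟩ := hall
      -- A relation that has been dropped has its bracket proportional to `v g`, which now belongs
      -- to the ideal.
      have htk : t.k = g := by
        by_contra hk
        exact htj (hij t ((hE' t).2 ⟨htE, hk⟩))
      have hmem : v t.k ∈ Submodule.span F (v '' (P \ (S \ {g}))) :=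
        Submodule.subset_span ⟨t.k, ⟨h.subS (htk ▸ hg), fun hc => hc.2 htk⟩, rfl⟩
      rw [ne_eq, Bool.not_eq_false, Rel.joins_iff] at htj
      rcases htj with ⟨rfl, rfl⟩ | ⟨rfl, rfl⟩
      · rw [(h.rel t htE).1]
        exact Submodule.smul_mem _ _ hmem
      · rw [← lie_skew, (h.rel t htE).1]
        exact neg_mem (Submodule.smul_mem _ _ hmem)

/-- The form does not vanish at a central element. -/
theorem nonvanish (h : Reduced F v R P S Z E a) {g : ℕ} (hg : g ∈ S)
    (hgE : ∀ t ∈ E, t.meets g = false) : Reduced F v R P S (insert g Z) E a := by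
  have hFits : ∀ f : Dual F L, Fits v P S (insert g Z) f → Fits v P S Z f := fun f hf =>
    ⟨hf.1, fun i hi => hf.2 i (Or.inr hi)⟩
  have hne : ∀ t ∈ E, t.i ≠ g ∧ t.j ≠ g := fun t ht =>
    Rel.meets_eq_false.1 (hgE t ht)
  refine ⟨Set.insert_subset hg h.subZ, h.subS, h.subP, h.rel, fun t ht => ?_, h.unrel,
    fun f hf => h.lift f (hFits f hf), fun f hf => h.planes f (hFits f hf), h.codim⟩
  obtain ⟨h1, h2, h3, h4⟩ := h.mem t ht
  exact ⟨⟨h1.1, fun hc => hc.elim (hne t ht).1 h1.2⟩, ⟨h2.1, fun hc => hc.elim (hne t ht).2 h2.2⟩,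
    h3, h4⟩

/-- `D` only meets `B`, with central brackets that pair `D` and `B` perfectly, and the elements of
`B` are not brackets. -/
structure Block (F : Type*) [Field F] {L : Type*} [LieRing L] [LieAlgebra F L] (v : ℕ → L)
    (P S Z : Set ℕ) (E : List Rel) {s : ℕ} (D B : Fin s → ℕ) :
    Prop where
  memD : ∀ i, D i ∈ S \ Z
  memB : ∀ i, B i ∈ S \ Z
  disj : ∀ i j, D i ≠ B j
  notB : ∀ t ∈ E, t.k ∉ Set.range B
  meetI : ∀ t ∈ E, t.i ∈ Set.range D → t.j ∈ Set.range B ∧ t.k ∈ Z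
  meetJ : ∀ t ∈ E, t.j ∈ Set.range D → t.i ∈ Set.range B ∧ t.k ∈ Z
  det : ∀ f : Dual F L, Fits v P S Z f → (Matrix.of fun i j => f ⁅v (D i), v (B j)⁆).det ≠ 0

variable {s : ℕ} {D B : Fin s → ℕ}

theorem Block.lie_mem (h : Reduced F v R P S Z E a) (hb : Block F v P S Z E D B) (i : Fin s) {j : ℕ}
    (hj : j ∈ P) (hjB : j ∉ Set.range B) : ⁅v (D i), v j⁆ ∈ Submodule.span F (v '' (P \ S)) := by
  refine h.unrel _ (h.subS (hb.memD i).1) _ hj fun t ht => ?_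
  rw [Bool.eq_false_iff, ne_eq, Rel.joins_iff]
  rintro (⟨h1, rfl⟩ | ⟨rfl, h1⟩)
  · exact hjB (hb.meetI t ht ⟨i, h1.symm⟩).1
  · exact hjB (hb.meetJ t ht ⟨i, h1.symm⟩).1

/-- Brackets with `D` are central modulo the ideal. This is why exponentials act to first order at
`D`, and exponentials of elements of the span of `D` do so on all of `P`. -/
theorem Block.lie_mem' (h : Reduced F v R P S Z E a) (hb : Block F v P S Z E D B) (i : Fin s)
    {j : ℕ} (hj : j ∈ P) : ⁅v (D i), v j⁆ ∈ Submodule.span F (v '' ((P \ S) ∪ Z)) := by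
  by_cases hall : ∀ t ∈ E, t.joins (D i) j = false
  · exact Submodule.span_mono (Set.image_mono Set.subset_union_left)
      (h.unrel _ (h.subS (hb.memD i).1) j hj hall)
  · push Not at hall
    obtain ⟨t, ht, htj⟩ := hall
    have hz : ∀ {k}, k ∈ Z → v k ∈ Submodule.span F (v '' ((P \ S) ∪ Z)) := fun hk =>
      Submodule.subset_span ⟨_, Or.inr hk, rfl⟩
    rw [ne_eq, Bool.not_eq_false, Rel.joins_iff] at htj
    rcases htj with ⟨h1, rfl⟩ | ⟨rfl, h1⟩
    · rw [← h1, (h.rel t ht).1]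
      exact Submodule.smul_mem _ _ (hz (hb.meetI t ht ⟨i, h1.symm⟩).2)
    · rw [← h1, ← lie_skew, (h.rel t ht).1]
      exact neg_mem (Submodule.smul_mem _ _ (hz (hb.meetJ t ht ⟨i, h1.symm⟩).2))

theorem Block.lie_left_mem (h : Reduced F v R P S Z E a) (hb : Block F v P S Z E D B) {x y : L}
    (hx : x ∈ Submodule.span F (v '' Set.range D))
    (hy : y ∈ Submodule.span F (v '' (P \ Set.range B))) :
    ⁅x, y⁆ ∈ Submodule.span F (v '' (P \ S)) := by
  refine lie_mem_of_span ?_ hx hy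
  rintro _ ⟨i, rfl⟩ j hj
  exact Block.lie_mem h hb i hj.1 hj.2

theorem Block.lie_left_mem' (h : Reduced F v R P S Z E a) (hb : Block F v P S Z E D B) {x y : L}
    (hx : x ∈ Submodule.span F (v '' Set.range D)) (hy : y ∈ Submodule.span F (v '' P)) :
    ⁅x, y⁆ ∈ Submodule.span F (v '' ((P \ S) ∪ Z)) := by
  refine lie_mem_of_span ?_ hx hy
  rintro _ ⟨i, rfl⟩ j hj
  exact Block.lie_mem' h hb i hj

theorem Block.fits {hb : Block F v P S Z E D B} {f : Dual F L}
    (hf : Fits v (P \ Set.range B) (S \ (Set.range B ∪ Set.range D)) Z f) : Fits v P S Z f :=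
  ⟨fun i hi hiS => hf.1 i ⟨hi, by rintro ⟨j, rfl⟩; exact hiS (hb.memB j).1⟩ fun hc => hiS hc.1,
    hf.2⟩

theorem Block.range_subset (h : Reduced F v R P S Z E a) (hb : Block F v P S Z E D B) :
    Set.range D ⊆ P ∧ Set.range B ⊆ P :=
  ⟨by rintro _ ⟨i, rfl⟩; exact h.subS (hb.memD i).1,
    by rintro _ ⟨i, rfl⟩; exact h.subS (hb.memB i).1⟩

theorem sum_mem_span (D : Fin s → ℕ) (c : Fin s → F) :
    ∑ i, c i • v (D i) ∈ Submodule.span F (v '' Set.range D) :=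
  Submodule.sum_mem _ fun i _ => Submodule.smul_mem _ _
    (Submodule.subset_span ⟨_, ⟨i, rfl⟩, rfl⟩)

/-- The form can be made to vanish on `D`. -/
theorem Block.exists_fits (hG : ExpGroup F L) (h : Reduced F v R P S Z E a)
    (hb : Block F v P S Z E D B) {f : Dual F L} (hf : Fits v P S Z f) :
    ∃ f' ∈ coadjointOrbit f, Fits v (P \ Set.range B) (S \ (Set.range B ∪ Set.range D)) Z f' := by
  let G := Matrix.of fun i j => f ⁅v (D i), v (B j)⁆
  have hdet : IsUnit G.det := (hb.det f hf).isUnit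
  -- The exponential of `∑ c j • v (B j)` adds `-(G c) i` to the value at `D i`, so `G c` has to
  -- equal these values.
  let c := G⁻¹.mulVec fun i => f (v (D i))
  have hc : G.mulVec c = fun i => f (v (D i)) := by
    rw [Matrix.mulVec_mulVec, Matrix.mul_nonsing_inv _ hdet, Matrix.one_mulVec]
  let x := ∑ j, c j • v (B j)
  have hxB : x ∈ Submodule.span F (v '' Set.range B) := sum_mem_span B c
  have hx : x ∈ Submodule.span F (v '' P) :=
    Submodule.span_mono (Set.image_mono (Block.range_subset h hb).2) hxB
  refine ⟨f ∘ₗ expAd F x, hG.comp_expAd_mem f x, fun i hi hiS => ?_, fun i hi => ?_⟩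
  · by_cases hiS' : i ∈ S
    · have hiD : i ∈ Set.range D := by
        by_contra hc
        exact hiS ⟨hiS', fun h' => h'.elim hi.2 hc⟩
      obtain ⟨k, rfl⟩ := hiD
      have h1 : ⁅x, v (D k)⁆ ∈ Submodule.span F (v '' ((P \ S) ∪ Z)) := by
        rw [← lie_skew]
        exact neg_mem (Block.lie_left_mem' h hb
          (Submodule.subset_span ⟨_, ⟨k, rfl⟩, rfl⟩) hx)
      rw [LinearMap.comp_apply, h.apply_exp hG hf hx h1, ← congrFun hc k, ← lie_skew, lie_sum]
      simp [Matrix.mulVec, dotProduct, G, mul_comm]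
    · have h1 : v i ∈ Submodule.span F (v '' (P \ S)) :=
        Submodule.subset_span ⟨i, ⟨hi.1, hiS'⟩, rfl⟩
      have h2 : v i ∈ Submodule.span F (v '' ((P \ S) ∪ Z)) :=
        Submodule.span_mono (Set.image_mono Set.subset_union_left) h1
      rw [LinearMap.comp_apply, h.apply_exp' hG hf hx (h.lie_mem hx h2), hf.apply_eq_zero h1]
  · have h2 : v i ∈ Submodule.span F (v '' ((P \ S) ∪ Z)) :=
      Submodule.subset_span ⟨i, Or.inr hi, rfl⟩
    rw [LinearMap.comp_apply, h.apply_exp' hG hf hx (h.lie_mem hx h2)]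
    exact hf.2 i hi

/-- The removal of a block. -/
theorem remove [FiniteDimensional F L] (hG : ExpGroup F L) (h : Reduced F v R P S Z E a) (hb : Block F v P S Z E D B)
    {E' : List Rel} (hE' : ∀ t, t ∈ E' ↔ t ∈ E ∧ t.i ∉ Set.range B ∪ Set.range D ∧
      t.j ∉ Set.range B ∪ Set.range D ∧ t.k ∉ Set.range B ∪ Set.range D) :
    Reduced F v R (P \ Set.range B) (S \ (Set.range B ∪ Set.range D)) Z E' (a + s) := by
  have hmono : Submodule.span F (v '' (P \ S)) ≤
      Submodule.span F (v '' ((P \ Set.range B) \ (S \ (Set.range B ∪ Set.range D)))) :=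
    Submodule.span_mono (Set.image_mono fun i hi => ⟨⟨hi.1, by
      rintro ⟨j, rfl⟩
      exact hi.2 (hb.memB j).1⟩, fun hc => hi.2 hc.1⟩)
  obtain ⟨hDP, hBP⟩ := Block.range_subset h hb
  have hP' : Submodule.span F (v '' (P \ Set.range B)) ≤ Submodule.span F (v '' P) :=
    Submodule.span_mono (Set.image_mono Set.sdiff_subset)
  refine ⟨fun i hi => ⟨h.subZ hi, ?_⟩, fun i hi => ⟨h.subS hi.1, fun hc => hi.2 (Or.inl hc)⟩,
    Set.sdiff_subset.trans h.subP, fun t ht => h.rel t ((hE' t).1 ht).1, fun t ht => ?_,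
    fun i hi j hj hij => ?_, fun f hf => ?_, fun f hf m hm => ?_, ?_⟩
  · rintro (⟨j, rfl⟩ | ⟨j, rfl⟩)
    · exact (hb.memB j).2 hi
    · exact (hb.memD j).2 hi
  · obtain ⟨htE, hi, hj, hk⟩ := (hE' t).1 ht
    obtain ⟨h1, h2, h3, h4⟩ := h.mem t htE
    exact ⟨⟨⟨h1.1, hi⟩, h1.2⟩, ⟨⟨h2.1, hj⟩, h2.2⟩, ⟨h3, hk⟩, h4⟩
  · by_cases hall : ∀ t ∈ E, t.joins i j = false
    · exact hmono (h.unrel i hi.1 j hj.1 hall)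
    · push Not at hall
      obtain ⟨t, htE, htj⟩ := hall
      have hmem : v t.k ∈ Submodule.span F
          (v '' ((P \ Set.range B) \ (S \ (Set.range B ∪ Set.range D)))) := by
        -- A relation between elements outside `B` can have been dropped only because its bracket is
        -- in `D`: an element of `D` meets only `B`, and no bracket lies in `B`. The elements of `D`
        -- have just joined the ideal.
        refine Submodule.subset_span ⟨t.k, ⟨⟨h.subS (h.mem t htE).2.2.1, hb.notB t htE⟩,
          fun hc => htj (hij t ((hE' t).2 ⟨htE, ?_, ?_, hc.2⟩))⟩, rfl⟩
        all_goals
          rw [ne_eq, Bool.not_eq_false, Rel.joins_iff] at htj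
          rcases htj with ⟨rfl, rfl⟩ | ⟨rfl, rfl⟩
        · exact fun hc => hc.elim hi.2 fun hc => hj.2 (hb.meetI t htE hc).1
        · exact fun hc => hc.elim hj.2 fun hc => hi.2 (hb.meetI t htE hc).1
        · exact fun hc => hc.elim hj.2 fun hc => hi.2 (hb.meetJ t htE hc).1
        · exact fun hc => hc.elim hi.2 fun hc => hj.2 (hb.meetJ t htE hc).1
      rw [ne_eq, Bool.not_eq_false, Rel.joins_iff] at htj
      rcases htj with ⟨rfl, rfl⟩ | ⟨rfl, rfl⟩
      · rw [(h.rel t htE).1]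
        exact Submodule.smul_mem _ _ hmem
      · rw [← lie_skew, (h.rel t htE).1]
        exact neg_mem (Submodule.smul_mem _ _ hmem)
  · have hf0 : Fits v P S Z f := Block.fits (hb := hb) hf
    let G := Matrix.of fun i j => f ⁅v (D i), v (B j)⁆
    have hdet : IsUnit G.det := (hb.det f hf0).isUnit
    let c := G⁻¹.vecMul (fun i => - f (v (B i)))
    -- Now `D` acts: on `P`, the exponential of `∑ c j • v (D j)` changes `f` only at `B`, where it
    -- adds `c G`. This `c` makes the values at `B` zero, as the lift requires.
    let c := Matrix.vecMul (fun i => - f (v (B i))) G⁻¹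
    have hc : Matrix.vecMul c G = fun i => - f (v (B i)) := by
      rw [Matrix.vecMul_vecMul, Matrix.nonsing_inv_mul _ hdet, Matrix.vecMul_one]
    let x := ∑ j, c j • v (D j)
    have hxD : x ∈ Submodule.span F (v '' Set.range D) := sum_mem_span D c
    have hx : x ∈ Submodule.span F (v '' P) := Submodule.span_mono (Set.image_mono hDP) hxD
    have hfix : ∀ i ∈ P, i ∉ Set.range B → (f ∘ₗ expAd F x) (v i) = f (v i) := fun i hi hiB =>
      h.apply_exp' hG hf0 hx (Block.lie_left_mem h hb hxD
        (Submodule.subset_span ⟨i, ⟨hi, hiB⟩, rfl⟩))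
    have hkill : ∀ k, (f ∘ₗ expAd F x) (v (B k)) = 0 := fun k => by
      rw [LinearMap.comp_apply, h.apply_exp hG hf0 hx (Block.lie_left_mem' h hb hxD
        (Submodule.subset_span ⟨_, hBP ⟨k, rfl⟩, rfl⟩)), sum_lie]
      have := congrFun hc k
      simp only [Matrix.vecMul, dotProduct, G, Matrix.of_apply] at this
      simp [this]
    obtain ⟨f', hf', h1, h2⟩ := h.lift (f ∘ₗ expAd F x) ⟨fun i hi hiS => by
        rw [hfix i hi (by rintro ⟨j, rfl⟩; exact hiS (hb.memB j).1), hf0.1 i hi hiS],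
      fun i hi => by
        rw [hfix i (h.subS (h.subZ hi)) (by rintro ⟨j, rfl⟩; exact (hb.memB j).2 hi)]
        exact hf0.2 i hi⟩
    refine ⟨f', orbit_trans (hG.comp_expAd_mem f x) hf', fun i hi => ?_, fun i hi hiP => ?_⟩
    · rw [h1 i hi.1, hfix i hi.1 hi.2]
    · by_cases hiP' : i ∈ P
      · have : i ∈ Set.range B := by
          by_contra hc
          exact hiP ⟨hiP', hc⟩
        obtain ⟨k, rfl⟩ := this
        rw [h1 _ hiP', hkill]
      · exact h2 i hi hiP'
  · have hf0 : Fits v P S Z f := Block.fits (hb := hb) hf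
    have h1 : Nondeg f (Submodule.span F (v '' P)) (m + 2 * s) := by
      refine hm.block hP' (fun i => v (D i)) (fun i => v (B i))
        (fun i => Submodule.subset_span ⟨_, hDP ⟨i, rfl⟩, rfl⟩)
        (fun i => Submodule.subset_span ⟨_, hBP ⟨i, rfl⟩, rfl⟩) (fun i q hq => ?_) (fun i j => ?_)
        (hb.det f hf0)
      · exact hf0.apply_eq_zero (Block.lie_left_mem h hb
          (Submodule.subset_span ⟨_, ⟨i, rfl⟩, rfl⟩) hq)
      · exact hf0.apply_eq_zero (Block.lie_mem h hb i (hDP ⟨j, rfl⟩)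
          (by rintro ⟨k, hk⟩; exact hb.disj _ _ hk.symm))
    have := h.planes f hf0 _ h1
    rwa [show m + 2 * s + 2 * a = m + 2 * (a + s) by ring] at this
  · have h1 : Submodule.span F (v '' P) ≤
        Submodule.span F (v '' (P \ Set.range B)) ⊔ Submodule.span F (Set.range (v ∘ B)) := by
      rw [Submodule.span_le]
      rintro _ ⟨i, hi, rfl⟩
      by_cases hc : i ∈ Set.range B
      · obtain ⟨k, rfl⟩ := hc
        exact Submodule.mem_sup_right (Submodule.subset_span ⟨k, rfl⟩)
      · exact Submodule.mem_sup_left (Submodule.subset_span ⟨i, ⟨hi, hc⟩, rfl⟩)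
    have h2 := (Submodule.finrank_mono h1).trans (Submodule.finrank_add_le_finrank_add_finrank _ _)
    have h3 : finrank F (Submodule.span F (Set.range (v ∘ B))) ≤ s := by
      exact (finrank_range_le_card (R := F) (v ∘ B)).trans (by simp)
    have := h.codim
    omega

/-- An element of the group that connects forms which vanish on `D` does not involve `B`. -/
theorem Block.mem_span (hG : ExpGroup F L) (h : Reduced F v R P S Z E a)
    (hb : Block F v P S Z E D B) {f : Dual F L} (hf : Fits v P S Z f) {x : L}
    (hx : x ∈ Submodule.span F (v '' P)) (hf0 : ∀ i, f (v (D i)) = 0)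
    (hf1 : ∀ i, f (expAd F x (v (D i))) = 0) : x ∈ Submodule.span F (v '' (P \ Set.range B)) := by
  have h1 : Submodule.span F (v '' P) ≤
      Submodule.span F (v '' (P \ Set.range B)) ⊔ Submodule.span F (Set.range (v ∘ B)) := by
    rw [Submodule.span_le]
    rintro _ ⟨i, hi, rfl⟩
    by_cases hc : i ∈ Set.range B
    · obtain ⟨k, rfl⟩ := hc
      exact Submodule.mem_sup_right (Submodule.subset_span ⟨k, rfl⟩)
    · exact Submodule.mem_sup_left (Submodule.subset_span ⟨i, ⟨hi, hc⟩, rfl⟩)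
  obtain ⟨y, hy, z, hz, rfl⟩ := Submodule.mem_sup.1 (h1 hx)
  obtain ⟨c, rfl⟩ := (Submodule.mem_span_range_iff_exists_fun F).1 hz
  -- With `c` the coordinates along `B`, the exponential adds `-(G c) i` to the value at `D i`. The
  -- values before and after are zero, and `G` is nonsingular.
  have hc : c = 0 := by
    refine Matrix.eq_zero_of_mulVec_eq_zero (hb.det f hf) (funext fun i => ?_)
    have hD : v (D i) ∈ Submodule.span F (v '' Set.range D) :=
      Submodule.subset_span ⟨_, ⟨i, rfl⟩, rfl⟩
    have h2 := hf1 i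
    rw [h.apply_exp hG hf hx (by
      rw [← lie_skew]; exact neg_mem (Block.lie_left_mem' h hb hD hx)), hf0, zero_add,
      ← lie_skew, lie_add, map_neg, map_add,
      hf.apply_eq_zero (Block.lie_left_mem h hb hD hy), zero_add, neg_eq_zero, lie_sum,
      map_sum] at h2
    simpa [Matrix.mulVec, dotProduct, mul_comm] using h2
  subst hc
  simpa using hy

end Reduced

end Reduction

end ClassicalOrbits

namespace ClassicalOrbits

open Module

/-! ### Specifications of the list functions and of the bit masks -/

section Lists

variable {α : Type} {p : α → Bool} {l : List α}

theorem anyL_eq_true : anyL p l = true ↔ ∃ x ∈ l, p x = true := by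
  induction l with
  | nil => simp [anyL]
  | cons x l ih =>
    have : anyL p (x :: l) = cond (p x) true (anyL p l) := rfl
    rw [this]
    cases h : p x <;> simp [h, ih]

theorem allL_eq_true : allL p l = true ↔ ∀ x ∈ l, p x = true := by
  induction l with
  | nil => simp [allL]
  | cons x l ih =>
    have : allL p (x :: l) = cond (p x) (allL p l) false := rfl
    rw [this]
    cases h : p x <;> simp [h, ih]

theorem mem_filterL {x : α} : x ∈ filterL p l ↔ x ∈ l ∧ p x = true := by
  induction l with
  | nil => simp [filterL]
  | cons y l ih =>
    have : filterL p (y :: l) = cond (p y) (y :: filterL p l) (filterL p l) := rfl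
    rw [this]
    cases h : p y <;> simp only [cond_true, cond_false, List.mem_cons, ih] <;> grind

theorem findL_eq_some {x : α} (h : findL p l = some x) : x ∈ l ∧ p x = true := by
  induction l with
  | nil => simp [findL] at h
  | cons y l ih =>
    have e : findL p (y :: l) = cond (p y) (some y) (findL p l) := rfl
    rw [e] at h
    cases hy : p y with
    | true =>
      rw [hy] at h
      obtain rfl := Option.some.inj h
      exact ⟨List.mem_cons_self, hy⟩
    | false =>
      rw [hy] at h
      exact ⟨List.mem_cons_of_mem _ (ih h).1, (ih h).2⟩

theorem findL_eq_none (h : findL p l = none) : ∀ x ∈ l, p x = false := by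
  induction l with
  | nil => simp
  | cons y l ih =>
    have e : findL p (y :: l) = cond (p y) (some y) (findL p l) := rfl
    rw [e] at h
    cases hy : p y with
    | true => rw [hy] at h; cases h
    | false =>
      rw [hy] at h
      simpa [hy] using ih h

theorem memb_eq_true {l : List ℕ} {x : ℕ} : memb l x = true ↔ x ∈ l := by
  rw [memb, anyL_eq_true]
  simp

theorem memb_eq_false {l : List ℕ} {x : ℕ} : memb l x = false ↔ x ∉ l := by
  rw [← memb_eq_true, Bool.not_eq_true]

theorem isNil_eq_true : isNil l = true ↔ l = [] := by
  cases l <;> simp [isNil]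

end Lists

section Masks

theorem bit_eq (S i : ℕ) : bit S i = S.testBit i := by
  have h : Nat.land (Nat.shiftRight S i) 1 = S >>> i % 2 := Nat.and_one_is_mod _
  rw [bit, h, Nat.testBit_eq_decide_div_mod_eq, Nat.shiftRight_eq_div_pow, Bool.eq_iff_iff]
  simp

def mask (S : ℕ) : Set ℕ := {i | bit S i = true}

theorem mem_mask {S i : ℕ} : i ∈ mask S ↔ bit S i = true := Iff.rfl

theorem mask_zero : mask 0 = ∅ := by
  ext i
  simp [mem_mask, bit_eq]

theorem mask_lor_pow (S g : ℕ) : mask (Nat.lor S (Nat.pow 2 g)) = insert g (mask S) := by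
  ext i
  have : Nat.lor S (Nat.pow 2 g) = S ||| 2 ^ g := rfl
  rw [this, Set.mem_insert_iff, mem_mask, mem_mask, bit_eq, bit_eq, Nat.testBit_or,
    Nat.testBit_two_pow]
  simp only [Bool.or_eq_true, decide_eq_true_eq]
  tauto

theorem mask_xor_pow {S g : ℕ} (hg : g ∈ mask S) :
    mask (Nat.xor S (Nat.pow 2 g)) = mask S \ {g} := by
  ext i
  have : Nat.xor S (Nat.pow 2 g) = S ^^^ 2 ^ g := rfl
  rw [mem_mask, bit_eq] at hg
  rw [this, Set.mem_sdiff, mem_mask, mem_mask, bit_eq, bit_eq, Nat.testBit_xor,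
    Nat.testBit_two_pow, Set.mem_singleton_iff]
  by_cases h : i = g
  · subst h
    simp [hg]
  · simp [h, Ne.symm h]

theorem mask_clear {S : ℕ} {l : List ℕ} (hl : l.Nodup) (h : ∀ x ∈ l, x ∈ mask S) :
    mask (clear S l) = mask S \ {x | x ∈ l} := by
  induction l with
  | nil => ext; simp [clear]
  | cons x l ih =>
    have e : clear S (x :: l) = Nat.xor (clear S l) (Nat.pow 2 x) := rfl
    rw [List.nodup_cons] at hl
    have ih' := ih hl.2 fun y hy => h y (List.mem_cons_of_mem _ hy)
    rw [e, mask_xor_pow (by rw [ih']; exact ⟨h x List.mem_cons_self, hl.1⟩), ih']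
    ext i
    simp only [Set.mem_sdiff, Set.mem_ofPred_eq, Set.mem_singleton_iff, List.mem_cons]
    tauto

theorem mask_and_eq_zero {u S : ℕ} (h : Nat.beq (Nat.land u S) 0 = true) {i : ℕ} (hi : i ∈ mask u) :
    i ∉ mask S := by
  have h0 : u &&& S = 0 := Nat.eq_of_beq_eq_true h
  intro hc
  rw [mem_mask, bit_eq] at hi hc
  have := Nat.testBit_and u S i
  rw [h0, hi, hc] at this
  simp at this

theorem exists_mem_mask {u S : ℕ} (h : Nat.beq (Nat.land u S) 0 = false) :
    ∃ i ∈ mask u, i ∈ mask S := by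
  have h0 : u &&& S ≠ 0 := fun hc => by
    rw [show Nat.land u S = 0 from hc] at h
    exact absurd h (by decide)
  obtain ⟨i, hi⟩ := Nat.exists_testBit_of_ne_zero h0
  rw [Nat.testBit_and, Bool.and_eq_true] at hi
  exact ⟨i, by rw [mem_mask, bit_eq]; exact hi.1, by rw [mem_mask, bit_eq]; exact hi.2⟩

theorem neighbours_spec {E : List Rel} {r i : ℕ} (h : bit (neighbours E r) i = false) :
    i ≠ r ∧ ∀ t ∈ E, t.joins r i = false := by
  have h' : i ∉ mask (neighbours E r) := by rw [mem_mask, h]; simp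
  clear h
  induction E with
  | nil =>
    refine ⟨?_, by simp⟩
    rintro rfl
    refine h' ?_
    have : neighbours [] i = 2 ^ i := rfl
    rw [mem_mask, bit_eq, this, Nat.testBit_two_pow_self]
  | cons t E ih =>
    have e : neighbours (t :: E) r = cond (Nat.beq t.i r)
      (Nat.lor (neighbours E r) (Nat.pow 2 t.j)) (cond (Nat.beq t.j r)
      (Nat.lor (neighbours E r) (Nat.pow 2 t.i)) (neighbours E r)) := rfl
    rw [e] at h'
    have key : i ∉ mask (neighbours E r) ∧ t.joins r i = false := by
      rw [Bool.eq_false_iff, ne_eq, Rel.joins_iff]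
      cases h1 : Nat.beq t.i r with
      | true =>
        rw [h1, cond_true, mask_lor_pow, Set.mem_insert_iff] at h'
        have h1 := Nat.eq_of_beq_eq_true h1
        refine ⟨fun hc => h' (Or.inr hc), ?_⟩
        rintro (⟨_, hc⟩ | ⟨hc, hc'⟩)
        · exact h' (Or.inl hc.symm)
        · exact h' (Or.inl (hc.symm.trans (h1.trans hc'.symm)))
      | false =>
        rw [h1, cond_false] at h'
        have h1 : t.i ≠ r := fun hc => by simp [hc] at h1
        cases h2 : Nat.beq t.j r with
        | true =>
          rw [h2, cond_true, mask_lor_pow, Set.mem_insert_iff] at h'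
          exact ⟨fun hc => h' (Or.inr hc), fun hc => hc.elim (fun hc => h1 hc.1)
            fun hc => h' (Or.inl hc.1.symm)⟩
        | false =>
          rw [h2, cond_false] at h'
          have h2 : t.j ≠ r := fun hc => by simp [hc] at h2
          exact ⟨h', fun hc => hc.elim (fun hc => h1 hc.1) fun hc => h2 hc.2⟩
    obtain ⟨h1, h2⟩ := ih key.1
    refine ⟨h1, fun t' ht' => ?_⟩
    rcases List.mem_cons.1 ht' with rfl | ht'
    · exact key.2
    · exact h2 t' ht'

end Masks

/-! ### Soundness of the algorithm -/

section Soundness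

variable {F : Type*} [Field F] {L : Type*} [LieRing L] [LieAlgebra F L]

def HasSupport (v : ℕ → L) (R : ℕ) (f : Dual F L) (T : ℕ) : Prop :=
  ∀ i < R, (f (v i) ≠ 0 ↔ i ∈ mask T)

/-- The forms with supports in `comp` represent the orbits of rank `6` with the property `Ext`. -/
structure Solved (v : ℕ → L) (R : ℕ) (Ext : Dual F L → Prop) (P S Z : Set ℕ) (comp : List ℕ) :
    Prop where
  unique : ∀ f f' : Dual F L, Fits v P S Z f → Fits v P S Z f' → ∀ T ∈ comp, HasSupport v R f T →
    ∀ T' ∈ comp, HasSupport v R f' T' → ∀ x ∈ Submodule.span F (v '' P), f' = f ∘ₗ expAd F x →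
    f = f'
  exist : ∀ f : Dual F L, Fits v P S Z f → Ext f → kirillovRank f = 6 →
    ∃ f' ∈ coadjointOrbit f, ∃ T ∈ comp, HasSupport v R f' T
  sound : ∀ f : Dual F L, Fits v P S Z f → ∀ T ∈ comp, HasSupport v R f T →
    kirillovRank f = 6 ∧ Ext f

/-- The hypotheses under which the algorithm is sound. -/
structure Setting (v : ℕ → L) (R : ℕ) (Ext : Dual F L → Prop) (ups : List ℕ) : Prop where
  group : ExpGroup F L
  two : (2 : F) ≠ 0
  span : Submodule.span F (v '' Set.Iio R) = ⊤
  rank : ∀ f f' : Dual F L, f' ∈ coadjointOrbit f → kirillovRank f' = kirillovRank f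
  ext_orbit : ∀ f f' : Dual F L, f' ∈ coadjointOrbit f → Ext f → Ext f'
  ext_iff : ∀ f : Dual F L, Ext f ↔ ∀ u ∈ ups, ∃ i < R, i ∈ mask u ∧ f (v i) ≠ 0

theorem Setting.finite {v : ℕ → L} {R : ℕ} {Ext : Dual F L → Prop} {ups : List ℕ}
    (h : Setting v R Ext ups) : FiniteDimensional F L :=
  FiniteDimensional.of_finrank_pos (by have := h.group.two_le; omega)

variable {v : ℕ → L} {R : ℕ} {P S Z : Set ℕ} {E : List Rel} {a : ℕ} {Ext : Dual F L → Prop}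
  {ups : List ℕ} {comp : List ℕ}

theorem solved_nil (h : ∀ f : Dual F L, Fits v P S Z f → Ext f → kirillovRank f ≠ 6) :
    Solved v R Ext P S Z [] :=
  ⟨fun _ _ _ _ _ hT => by simp at hT, fun f hf he hr => absurd hr (h f hf he),
    fun _ _ _ hT => by simp at hT⟩

theorem Reduced.apply_joined (h : Reduced F v R P S Z E a) {f : Dual F L} (hf : Fits v P S Z f)
    {t : Rel} (ht : t ∈ E) (hk : t.k ∈ Z) {r c : ℕ} (hj : t.joins r c = true) :
    f ⁅v r, v c⁆ ≠ 0 := by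
  obtain ⟨h1, h2⟩ := h.rel t ht
  have h3 : f ⁅v t.i, v t.j⁆ ≠ 0 := by
    rw [h1, map_smul, smul_eq_mul]
    exact mul_ne_zero h2 (hf.2 _ hk)
  rw [Rel.joins_iff] at hj
  rcases hj with ⟨rfl, rfl⟩ | ⟨rfl, rfl⟩
  · exact h3
  · rw [← lie_skew, map_neg]
    exact neg_ne_zero.2 h3

theorem Reduced.apply_unjoined (h : Reduced F v R P S Z E a) {f : Dual F L} (hf : Fits v P S Z f)
    {r c : ℕ} (hr : r ∈ P) (hc : c ∈ P) (hj : ∀ t ∈ E, t.joins r c = false) :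
    f ⁅v r, v c⁆ = 0 :=
  hf.apply_eq_zero (h.unrel r hr c hc hj)

/-- The chosen `r` is orthogonal to everything outside its neighbours, so a nondegenerate subspace
found there extends by `r` and `c`. The vector `c` need not be orthogonal to it. -/
theorem peel_sound [FiniteDimensional F L] (h : Reduced F v R P S (mask n) E a) {f : Dual F L}
    (hf : Fits v P S (mask n) f) (m : ℕ) : ∀ (A : Set ℕ) (E' : List Rel), A ⊆ P →
    (∀ t, t ∈ E' ↔ t ∈ E ∧ t.i ∈ A ∧ t.j ∈ A) → peel m E' n = true →
    Nondeg f (Submodule.span F (v '' A)) (2 * m) := by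
  induction m with
  | zero => exact fun A _ _ _ _ => nondeg_zero f _
  | succ m ih =>
    intro A E' hA hE' hp
    rw [peel] at hp
    split at hp
    · simp at hp
    · rename_i r c _
      cases hany : anyL (fun t => cond (bit n t.k) (t.joins r c) false) E' with
      | false =>
        rw [hany, cond_false] at hp
        exact absurd hp (by simp)
      | true =>
        rw [hany, cond_true] at hp
        obtain ⟨t, ht, htk⟩ := anyL_eq_true.1 hany
        cases hk : bit n t.k with
        | false => simp [hk] at htk
        | true =>
          rw [hk, cond_true] at htk
          obtain ⟨htE, hi, hj⟩ := (hE' t).1 ht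
          have hrc : r ∈ A ∧ c ∈ A := by
            rcases Rel.joins_iff.1 htk with ⟨rfl, rfl⟩ | ⟨rfl, rfl⟩
            · exact ⟨hi, hj⟩
            · exact ⟨hj, hi⟩
          have h1 := ih (A \ mask (neighbours E' r)) _ (Set.sdiff_subset.trans hA) (fun t => by
            rw [mem_filterL, hE', Set.mem_sdiff, Set.mem_sdiff, mem_mask, mem_mask]
            cases bit (neighbours E' r) t.i <;> cases bit (neighbours E' r) t.j <;> simp) hp
          have h2 := h1.block (Q' := Submodule.span F (v '' A)) (s := 1)
            (Submodule.span_mono (Set.image_mono Set.sdiff_subset)) (fun _ => v r) (fun _ => v c)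
            (fun _ => Submodule.subset_span ⟨r, hrc.1, rfl⟩)
            (fun _ => Submodule.subset_span ⟨c, hrc.2, rfl⟩) (fun _ q hq => by
              refine hf.apply_eq_zero (lie_mem_of_span (A := {r}) (fun i hi j hj => ?_)
                (Submodule.subset_span ⟨r, rfl, rfl⟩) hq)
              obtain rfl : i = r := hi
              refine h.unrel _ (hA hrc.1) _ (hA hj.1) fun t ht => ?_
              rw [Bool.eq_false_iff]
              intro hc
              have htE' : t ∈ E' := (hE' t).2 ⟨ht, by
                rcases Rel.joins_iff.1 hc with ⟨h1, h2⟩ | ⟨h1, h2⟩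
                · exact ⟨h1 ▸ hrc.1, h2 ▸ hj.1⟩
                · exact ⟨h1 ▸ hj.1, h2 ▸ hrc.1⟩⟩
              have := (neighbours_spec (E := E') (r := i) (i := j)
                (by have := hj.2; rwa [mem_mask, Bool.not_eq_true] at this)).2 t htE'
              simp [hc] at this) (fun _ _ => by simp)
            (by simpa using h.apply_joined hf htE hk htk)
          rwa [show 2 * (m + 1) = 2 * m + 2 * 1 by ring]

theorem look_some (h : Reduced F v R P S Z E a) {r c k : ℕ} {x : ℤ}
    (hl : look E r c = some (k, x)) : (∃ t ∈ E, t.joins r c = true) ∧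
    ⁅v r, v c⁆ = (x : F) • v k := by
  rw [look] at hl
  split at hl
  · simp at hl
  · rename_i t ht
    obtain ⟨htE, htj⟩ := findL_eq_some ht
    obtain ⟨rfl, hx⟩ := Prod.mk.inj (Option.some.inj hl)
    refine ⟨⟨t, htE, htj⟩, ?_⟩
    have hne := (h.mem t htE).2.2.2
    have hr := (h.rel t htE).1
    rcases Rel.joins_iff.1 htj with ⟨rfl, rfl⟩ | ⟨rfl, rfl⟩
    · have : Nat.beq t.i t.i = true := by simp
      rw [this, cond_true] at hx
      rw [← hx, hr]
    · have : Nat.beq t.i t.j = false := by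
        rw [Bool.eq_false_iff]
        exact fun hc => hne (Nat.eq_of_beq_eq_true hc)
      rw [this, cond_false] at hx
      rw [← lie_skew, hr, ← hx]
      simp

theorem look_none (h : Reduced F v R P S Z E a) {r c : ℕ} (hl : look E r c = none) (hr : r ∈ P)
    (hc : c ∈ P) {f : Dual F L} (hf : Fits v P S Z f) : f ⁅v r, v c⁆ = 0 := by
  rw [look] at hl
  split at hl
  · rename_i hn
    exact h.apply_unjoined hf hr hc (findL_eq_none hn)
  · simp at hl

theorem Reduced.mem_of_joins (h : Reduced F v R P S Z E a) {r c : ℕ}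
    (hj : ∃ t ∈ E, t.joins r c = true) : r ∈ S \ Z ∧ c ∈ S \ Z := by
  obtain ⟨t, ht, htj⟩ := hj
  obtain ⟨h1, h2, -, -⟩ := h.mem t ht
  rcases Rel.joins_iff.1 htj with ⟨rfl, rfl⟩ | ⟨rfl, rfl⟩
  · exact ⟨h1, h2⟩
  · exact ⟨h2, h1⟩

theorem natAbs_cast_ne_zero (h2 : (2 : F) ≠ 0) {x : ℤ} (hx : x.natAbs = 2) : (x : F) ≠ 0 := by
  rcases Int.natAbs_eq x with h | h <;> rw [h, hx] <;> simpa using h2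

/-- With zero diagonal two terms of the determinant survive. As the brackets at `(i, j)` and `(j,
i)` are multiples of the same vector, both contain the same product of three nonzero values of `f`,
with total coefficient `±2`. -/
theorem paired_sound (h2 : (2 : F) ≠ 0) (h : Reduced F v R P S (mask n) E a) {q : Hexad}
    (hq : q.paired E n = true) : (∀ i, ![q.r₁, q.r₂, q.r₃] i ∈ S \ mask n) ∧
    (∀ i, ![q.c₁, q.c₂, q.c₃] i ∈ S \ mask n) ∧
    ∀ f : Dual F L, Fits v P S (mask n) f →
      (Matrix.of fun i j => f ⁅v (![q.r₁, q.r₂, q.r₃] i), v (![q.c₁, q.c₂, q.c₃] j)⁆).det ≠ 0 := by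
  unfold Hexad.paired at hq
  split at hq
  · rename_i k₁₂ a₁₂ k₂₁ a₂₁ k₁₃ a₁₃ k₃₁ a₃₁ k₂₃ a₂₃ k₃₂ a₃₂ e₁₁ e₂₂ e₃₃ e₁₂ e₂₁ e₁₃ e₃₁ e₂₃ e₃₂
    simp only [Bool.and_eq_true] at hq
    obtain ⟨⟨⟨⟨⟨⟨hk₁, hk₂⟩, hk₃⟩, hz₁⟩, hz₂⟩, hz₃⟩, hdet⟩ := hq
    obtain rfl := Nat.eq_of_beq_eq_true hk₁
    obtain rfl := Nat.eq_of_beq_eq_true hk₂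
    obtain rfl := Nat.eq_of_beq_eq_true hk₃
    have hdet := natAbs_cast_ne_zero h2 (Nat.eq_of_beq_eq_true hdet)
    obtain ⟨m₁₂, l₁₂⟩ := look_some h e₁₂
    obtain ⟨m₂₁, l₂₁⟩ := look_some h e₂₁
    obtain ⟨m₁₃, l₁₃⟩ := look_some h e₁₃
    obtain ⟨m₃₁, l₃₁⟩ := look_some h e₃₁
    obtain ⟨m₂₃, l₂₃⟩ := look_some h e₂₃
    obtain ⟨m₃₂, l₃₂⟩ := look_some h e₃₂
    have M₁₂ := h.mem_of_joins m₁₂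
    have M₂₁ := h.mem_of_joins m₂₁
    have M₃₁ := h.mem_of_joins m₃₁
    have M₁₃ := h.mem_of_joins m₁₃
    refine ⟨fun i => ?_, fun i => ?_, fun f hf => ?_⟩
    · fin_cases i
      exacts [M₁₂.1, M₂₁.1, M₃₁.1]
    · fin_cases i
      exacts [M₂₁.2, M₁₂.2, M₁₃.2]
    · have sP : ∀ {i}, i ∈ S \ mask n → i ∈ P := fun hi => h.subS hi.1
      have o₁ := look_none h e₁₁ (sP M₁₂.1) (sP M₂₁.2) hf
      have o₂ := look_none h e₂₂ (sP M₂₁.1) (sP M₁₂.2) hf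
      have o₃ := look_none h e₃₃ (sP M₃₁.1) (sP M₁₃.2) hf
      rw [Matrix.det_fin_three]
      simp only [Matrix.of_apply, Matrix.cons_val_zero, Matrix.cons_val_one, Matrix.cons_val, o₁,
        o₂, o₃, l₁₂, l₂₁, l₁₃, l₃₁, l₂₃, l₃₂, map_smul, smul_eq_mul]
      have : f (v k₁₂) * f (v k₁₃) * f (v k₂₃) *
          ((a₁₂ * a₂₃ * a₃₁ + a₁₃ * a₂₁ * a₃₂ : ℤ) : F) ≠ 0 :=
        mul_ne_zero (mul_ne_zero (mul_ne_zero (hf.2 _ hz₁) (hf.2 _ hz₂)) (hf.2 _ hz₃)) hdet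
      intro hc
      apply this
      rw [← hc]
      push_cast
      ring
  · simp at hq

theorem Reduced.lower [FiniteDimensional F L] (h : Reduced F v R P S Z E a) {f : Dual F L}
    (hf : Fits v P S Z f) {m : ℕ} (hm : Nondeg f (Submodule.span F (v '' P)) m) :
    m + 2 * a ≤ kirillovRank f :=
  (h.planes f hf m hm).le_rank

theorem isotropic_sound (h : Reduced F v R P S Z E a) {q : Hexad} (hq : q.isotropic E = true)
    (hP : ∀ i, ![q.r₁, q.r₂, q.r₃] i ∈ P) {f : Dual F L} (hf : Fits v P S Z f) (i j : Fin 3) :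
    f ⁅v (![q.r₁, q.r₂, q.r₃] i), v (![q.r₁, q.r₂, q.r₃] j)⁆ = 0 := by
  have key : ∀ t ∈ E, t.joins q.r₁ q.r₂ = false ∧ t.joins q.r₁ q.r₃ = false ∧
      t.joins q.r₂ q.r₃ = false := fun t ht => by
    have := allL_eq_true.1 hq t ht
    simpa [Bool.and_eq_true, and_assoc] using this
  have h₁ : q.r₁ ∈ P := hP 0
  have h₂ : q.r₂ ∈ P := hP 1
  have h₃ : q.r₃ ∈ P := hP 2
  have k₁₂ := h.apply_unjoined hf h₁ h₂ fun t ht => (key t ht).1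
  have k₁₃ := h.apply_unjoined hf h₁ h₃ fun t ht => (key t ht).2.1
  have k₂₃ := h.apply_unjoined hf h₂ h₃ fun t ht => (key t ht).2.2
  have k₂₁ := h.apply_unjoined hf h₂ h₁ fun t ht => Rel.joins_comm.trans (key t ht).1
  have k₃₁ := h.apply_unjoined hf h₃ h₁ fun t ht => Rel.joins_comm.trans (key t ht).2.1
  have k₃₂ := h.apply_unjoined hf h₃ h₂ fun t ht => Rel.joins_comm.trans (key t ht).2.2
  fin_cases i <;> fin_cases j <;> simp [k₁₂, k₁₃, k₂₃, k₂₁, k₃₁, k₃₂]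

theorem killed_sound [FiniteDimensional F L] (h2 : (2 : F) ≠ 0)
    (h : Reduced F v R P S (mask n) E a) {cores : List Hexad} (hk : killed cores n E a = true)
    {f : Dual F L} (hf : Fits v P S (mask n) f) : 8 ≤ kirillovRank f := by
  rw [killed, Bool.or_eq_true, Bool.or_eq_true] at hk
  rcases hk with (hk | hk) | hk
  · have h4 : 4 ≤ a := Nat.le_of_ble_eq_true hk
    have := h.lower hf (nondeg_zero _ _)
    omega
  · have := h.lower hf (peel_sound h hf (4 - a) P E subset_rfl (fun t => by
      refine ⟨fun ht => ⟨ht, ?_⟩, fun ht => ht.1⟩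
      obtain ⟨h1, h2, -, -⟩ := h.mem t ht
      exact ⟨h.subS h1.1, h.subS h2.1⟩) hk)
    omega
  · rw [Bool.and_eq_true, anyL_eq_true] at hk
    obtain ⟨ha, q, -, hq⟩ := hk
    rw [Bool.and_eq_true, Bool.and_eq_true] at hq
    obtain ⟨⟨-, hq2⟩, hq3⟩ := hq
    obtain ⟨hr, hc, hdet⟩ := paired_sound h2 h hq3
    have hb := (nondeg_zero f ⊥).block (Q' := Submodule.span F (v '' P)) (s := 3) bot_le
      (fun i => v (![q.r₁, q.r₂, q.r₃] i)) (fun i => v (![q.c₁, q.c₂, q.c₃] i))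
      (fun i => Submodule.subset_span ⟨_, h.subS (hr i).1, rfl⟩)
      (fun i => Submodule.subset_span ⟨_, h.subS (hc i).1, rfl⟩)
      (fun i x hx => by rw [(Submodule.mem_bot F).1 hx, lie_zero, map_zero])
      (isotropic_sound h hq2 (fun i => h.subS (hr i).1) hf) (hdet f hf)
    have := h.lower hf hb
    have := Nat.eq_of_beq_eq_true ha
    omega

theorem removable_sound {D B : List ℕ} (h : removable D B E n comp = true) :
    (∀ t ∈ E, t.k ∉ B ∧ (t.i ∈ D → t.j ∈ B ∧ t.k ∈ mask n) ∧
      (t.j ∈ D → t.i ∈ B ∧ t.k ∈ mask n)) ∧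
    ∀ T ∈ comp, (∀ x ∈ D, x ∉ mask T) ∧ ∀ x ∈ B, x ∉ mask T := by
  rw [removable, Bool.and_eq_true, allL_eq_true, allL_eq_true] at h
  constructor
  · intro t ht
    have := h.1 t ht
    simp only [Bool.and_eq_true, Bool.or_eq_true, Bool.not_eq_true', memb_eq_true,
      memb_eq_false] at this
    simp only [mem_mask]
    tauto
  · intro T hT
    have := h.2 T hT
    simp only [Bool.and_eq_true, allL_eq_true, Bool.not_eq_true'] at this
    simp only [mem_mask, Bool.not_eq_true]
    exact this

/-- The listed forms vanish on `D`, hence fit the smaller state, and by `Reduced.Block.mem_span` an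
element connecting two of them does not involve `B`. For existence, an arbitrary form is first moved
so as to vanish on `D`. -/
theorem Solved.of_remove (hs : Setting v R Ext ups) (h : Reduced F v R P S Z E a) {s : ℕ}
    {D B : Fin s → ℕ} (hb : Reduced.Block F v P S Z E D B)
    (hT : ∀ T ∈ comp, ∀ i, D i ∉ mask T)
    (hsol : Solved v R Ext (P \ Set.range B) (S \ (Set.range B ∪ Set.range D)) Z comp) :
    Solved v R Ext P S Z comp := by
  have hD0 : ∀ f : Dual F L, ∀ T ∈ comp, HasSupport v R f T → ∀ i, f (v (D i)) = 0 :=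
    fun f T hT' hf i => by
      by_contra hc
      exact hT T hT' i ((hf _ (h.subP (h.subS (hb.memD i).1))).1 hc)
  have hfit : ∀ f : Dual F L, Fits v P S Z f → ∀ T ∈ comp, HasSupport v R f T →
      Fits v (P \ Set.range B) (S \ (Set.range B ∪ Set.range D)) Z f := fun f hf T hT' hfT =>
    ⟨fun i hi hiS => by
      by_cases hiS' : i ∈ S
      · have hiD : i ∈ Set.range D := by
          by_contra hc
          exact hiS ⟨hiS', fun h' => h'.elim hi.2 hc⟩
        obtain ⟨k, rfl⟩ := hiD
        exact hD0 f T hT' hfT k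
      · exact hf.1 i hi.1 hiS', hf.2⟩
  refine ⟨fun f f' hf hf' T hT₁ hfT T' hT₂ hfT' x hx hxf => ?_, fun f hf he hr => ?_,
    fun f hf T hT₁ hfT => hsol.sound f (hfit f hf T hT₁ hfT) T hT₁ hfT⟩
  · refine hsol.unique f f' (hfit f hf T hT₁ hfT) (hfit f' hf' T' hT₂ hfT') T hT₁ hfT T' hT₂ hfT' x
      ?_ hxf
    refine Reduced.Block.mem_span hs.group h hb hf hx (hD0 f T hT₁ hfT) fun i => ?_
    have := hD0 f' T' hT₂ hfT' i
    rwa [hxf] at this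
  · obtain ⟨f₁, hf₁, hfit₁⟩ := Reduced.Block.exists_fits hs.group h hb hf
    obtain ⟨f₂, hf₂, T, hT, hfT⟩ := hsol.exist f₁ hfit₁ (hs.ext_orbit f f₁ hf₁ he)
      ((hs.rank f f₁ hf₁).trans hr)
    exact ⟨f₂, orbit_trans hf₁ hf₂, T, hT, hfT⟩

/-- Modulo the ideal `g` commutes with everything in `P`, so connected forms have the same value at
`g` and belong to the same branch. -/
theorem Solved.of_split (hs : Setting v R Ext ups) (h : Reduced F v R P S Z E a) {g : ℕ}
    (hg : g ∈ S) (hgE : ∀ t ∈ E, t.meets g = false)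
    (h0 : Solved v R Ext P (S \ {g}) Z (filterL (fun T => !(bit T g)) comp))
    (h1 : Solved v R Ext P S (insert g Z) (filterL (fun T => bit T g) comp)) :
    Solved v R Ext P S Z comp := by
  have fit0 : ∀ f : Dual F L, Fits v P S Z f → f (v g) = 0 → Fits v P (S \ {g}) Z f :=
    fun f hf hfg => ⟨fun i hi hiS => by
      by_cases e : i = g
      · rw [e, hfg]
      · exact hf.1 i hi fun hc => hiS ⟨hc, e⟩, hf.2⟩
  have fit1 : ∀ f : Dual F L, Fits v P S Z f → f (v g) ≠ 0 → Fits v P S (insert g Z) f :=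
    fun f hf hfg => ⟨hf.1, fun i hi => hi.elim (fun e => e ▸ hfg) (hf.2 i)⟩
  have hgR : g < R := h.subP (h.subS hg)
  have mem0 : ∀ f : Dual F L, ∀ T ∈ comp, HasSupport v R f T → f (v g) = 0 →
      T ∈ filterL (fun T => !(bit T g)) comp := fun f T hT hfT hfg => by
    rw [mem_filterL]
    refine ⟨hT, ?_⟩
    rw [Bool.not_eq_true', Bool.eq_false_iff]
    exact fun hc => ((hfT g hgR).2 hc) hfg
  have mem1 : ∀ f : Dual F L, ∀ T ∈ comp, HasSupport v R f T → f (v g) ≠ 0 →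
      T ∈ filterL (fun T => bit T g) comp := fun f T hT hfT hfg => by
    rw [mem_filterL]
    exact ⟨hT, (hfT g hgR).1 hfg⟩
  refine ⟨fun f f' hf hf' T hT hfT T' hT' hfT' x hx hxf => ?_, fun f hf he hr => ?_,
    fun f hf T hT hfT => ?_⟩
  · have hgg : f' (v g) = f (v g) := by
      rw [hxf]
      refine h.apply_exp' hs.group hf hx ?_
      rw [← lie_skew]
      refine neg_mem (lie_mem_of_span (A := {g}) (fun i hi j hj => ?_)
        (Submodule.subset_span ⟨g, rfl, rfl⟩) hx)
      obtain rfl : i = g := hi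
      exact h.unrel _ (h.subS hg) _ hj fun t ht => Reduced.unjoined (hgE t ht) j
    by_cases hfg : f (v g) = 0
    · have hfg' := hgg.trans hfg
      exact h0.unique f f' (fit0 f hf hfg) (fit0 f' hf' hfg') T (mem0 f T hT hfT hfg) hfT T'
        (mem0 f' T' hT' hfT' hfg') hfT' x hx hxf
    · have hfg' : f' (v g) ≠ 0 := hgg ▸ hfg
      exact h1.unique f f' (fit1 f hf hfg) (fit1 f' hf' hfg') T (mem1 f T hT hfT hfg) hfT T'
        (mem1 f' T' hT' hfT' hfg') hfT' x hx hxf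
  · by_cases hfg : f (v g) = 0
    · obtain ⟨f', hf', T, hT, hfT⟩ := h0.exist f (fit0 f hf hfg) he hr
      exact ⟨f', hf', T, (mem_filterL.1 hT).1, hfT⟩
    · obtain ⟨f', hf', T, hT, hfT⟩ := h1.exist f (fit1 f hf hfg) he hr
      exact ⟨f', hf', T, (mem_filterL.1 hT).1, hfT⟩
  · by_cases hfg : f (v g) = 0
    · exact h0.sound f (fit0 f hf hfg) T (mem0 f T hT hfT hfg) hfT
    · exact h1.sound f (fit1 f hf hfg) T (mem1 f T hT hfT hfg) hfT

/-- The span of `P` is isotropic of codimension at most `a`, which gives the upper bound; the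
removed pairs give the lower one. -/
theorem Reduced.central_rank [FiniteDimensional F L] (h : Reduced F v R P S S E a) {f : Dual F L}
    (hf : Fits v P S S f) : kirillovRank f = 2 * a := by
  refine le_antisymm (kirillovRank_le (W := Submodule.span F (v '' P)) (fun x hx y hy => ?_)
    h.codim) ?_
  · refine hf.apply_eq_zero (lie_mem_of_span (fun i hi j hj => h.unrel i hi j hj fun t ht => ?_)
      hx hy)
    have := (h.mem t ht).1
    exact absurd this.1 this.2
  · have := h.lower hf (nondeg_zero _ _)
    omega

/-- The orbit contains a form with the same values on `P` and zero values outside `P`. Its support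
lies in `S`, and extensiveness forces it to meet every `u`. -/
theorem ext_of_fits (hs : Setting v R Ext ups) (h : Reduced F v R P S Z E a) {f : Dual F L}
    (hf : Fits v P S Z f) (he : Ext f) : ∀ u ∈ ups, ∃ i ∈ mask u, i ∈ S := by
  intro u hu
  obtain ⟨f', hf', h1, h2⟩ := h.lift f hf
  obtain ⟨i, hiR, hiu, hi⟩ := (hs.ext_iff f').1 (hs.ext_orbit f f' hf' he) u hu
  refine ⟨i, hiu, ?_⟩
  by_contra hiS
  by_cases hiP : i ∈ P
  · exact hi ((h1 i hiP).trans (hf.1 i hiP hiS))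
  · exact hi (h2 i hiR hiP)

/-- The quotient is abelian, so exponentials of the span of `P` do not move the values on `P`;
outside `P` the forms with support `mask n` vanish. Hence connected forms of this kind coincide. The
lift gives existence. -/
theorem solved_leaf (hs : Setting v R Ext ups) {n : ℕ} (h : Reduced F v R P (mask n) (mask n) E 3)
    (hu : ∀ u ∈ ups, ∃ i ∈ mask u, i ∈ mask n) :
    Solved v R Ext P (mask n) (mask n) [n] := by
  have := hs.finite
  refine ⟨fun f f' hf hf' T hT hfT T' hT' hfT' x hx hxf => ?_, fun f hf he hr => ?_,
    fun f hf T hT hfT => ⟨h.central_rank hf, (hs.ext_iff f).2 fun u hu' => ?_⟩⟩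
  · obtain rfl : T = n := by simpa using hT
    obtain rfl : T' = T := by simpa using hT'
    have hE : E = [] := List.eq_nil_iff_forall_not_mem.2 fun t ht =>
      absurd (h.mem t ht).1.1 (h.mem t ht).1.2
    have hv : ∀ i < R, f (v i) = f' (v i) := fun i hi => by
      by_cases hiP : i ∈ P
      · rw [hxf]
        refine (h.apply_exp' hs.group hf hx (lie_mem_of_span (fun i hi j hj => h.unrel i hi j hj ?_)
          hx (Submodule.subset_span ⟨i, hiP, rfl⟩))).symm
        simp [hE]
      · have h1 : f (v i) = 0 := by
          by_contra hc
          exact hiP (h.subS ((hfT i hi).1 hc))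
        have h2 : f' (v i) = 0 := by
          by_contra hc
          exact hiP (h.subS ((hfT' i hi).1 hc))
        rw [h1, h2]
    refine LinearMap.ext_on hs.span ?_
    rintro _ ⟨i, hi, rfl⟩
    exact hv i hi
  · obtain ⟨f', hf', h1, h2⟩ := h.lift f hf
    refine ⟨f', hf', n, by simp, fun i hi => ?_⟩
    by_cases hiP : i ∈ P
    · rw [h1 i hiP]
      refine ⟨fun hc => ?_, hf.2 i⟩
      by_contra hiS
      exact hc (hf.1 i hiP hiS)
    · refine ⟨fun hc => absurd (h2 i hi hiP) hc, fun hc => absurd (h.subS hc) hiP⟩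
  · obtain ⟨i, hiu, hi⟩ := hu u hu'
    have hiR : i < R := h.subP (h.subS hi)
    obtain rfl : T = n := by simpa using hT
    exact ⟨i, hiR, hiu, (hfT i hiR).2 hi⟩

theorem mem_avoiding {t : Rel} {l : List ℕ} :
    t ∈ avoiding E l ↔ t ∈ E ∧ t.i ∉ l ∧ t.j ∉ l ∧ t.k ∉ l := by
  rw [avoiding, mem_filterL]
  simp [memb_eq_false, and_assoc]

/-- The common part of the removal of a pair (`s = 1`) and of a hexad (`s = 3`): tests on lists and
masks become the hypotheses of `Reduced.Block`. -/
theorem solved_remove (hs : Setting v R Ext ups) {cores : List Hexad} {fuel : ℕ}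
    (ih : ∀ (S Z : ℕ) (E : List Rel) (a : ℕ) (comp : List ℕ) (P : Set ℕ),
      Reduced F v R P (mask S) (mask Z) E a → classify ups cores fuel S Z E a comp = true →
      Solved v R Ext P (mask S) (mask Z) comp)
    {S Z : ℕ} (h : Reduced F v R P (mask S) (mask Z) E a) {s : ℕ} {D B : Fin s → ℕ}
    {lD lB l : List ℕ} (hD : ∀ x, x ∈ Set.range D ↔ x ∈ lD) (hB : ∀ x, x ∈ Set.range B ↔ x ∈ lB)
    (hl : ∀ x, x ∈ l ↔ x ∈ lB ∨ x ∈ lD) (hnd : l.Nodup) (hdisj : ∀ i j, D i ≠ B j)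
    (hDS : ∀ i, D i ∈ mask S \ mask Z) (hBS : ∀ i, B i ∈ mask S \ mask Z)
    (hdet : ∀ f : Dual F L, Fits v P (mask S) (mask Z) f →
      (Matrix.of fun i j => f ⁅v (D i), v (B j)⁆).det ≠ 0)
    (hr : removable lD lB E Z comp = true)
    (hc : classify ups cores fuel (clear S l) Z (avoiding E l) (a + s) comp = true) :
    Solved v R Ext P (mask S) (mask Z) comp := by
  have := hs.finite
  obtain ⟨hr1, hr2⟩ := removable_sound hr
  have hb : Reduced.Block F v P (mask S) (mask Z) E D B :=
    ⟨hDS, hBS, hdisj, fun t ht => by rw [hB]; exact (hr1 t ht).1,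
      fun t ht => by rw [hB, hD]; exact (hr1 t ht).2.1,
      fun t ht => by rw [hB, hD]; exact (hr1 t ht).2.2, hdet⟩
  have hlset : {x | x ∈ l} = Set.range B ∪ Set.range D := by
    ext x
    rw [Set.mem_ofPred_eq, hl, Set.mem_union, hB, hD]
  have hmask : mask (clear S l) = mask S \ (Set.range B ∪ Set.range D) := by
    rw [mask_clear hnd, hlset]
    intro x hx
    have : x ∈ Set.range B ∪ Set.range D := hlset ▸ hx
    rcases this with ⟨i, rfl⟩ | ⟨i, rfl⟩
    exacts [(hBS i).1, (hDS i).1]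
  refine Solved.of_remove hs h hb (fun T hT i => (hr2 T hT).1 _ ((hD _).1 ⟨i, rfl⟩)) ?_
  rw [← hmask]
  refine ih _ _ _ _ _ _ ?_ hc
  rw [hmask]
  refine h.remove hs.group hb fun t => ?_
  rw [mem_avoiding, ← hlset]
  rfl

/-- Induction on the fuel. The heuristic choices carry no weight: each branch uses only the tests
that it has passed. -/
theorem classify_sound (hs : Setting v R Ext ups) {cores : List Hexad} (fuel : ℕ) :
    ∀ (S Z : ℕ) (E : List Rel) (a : ℕ) (comp : List ℕ) (P : Set ℕ),
      Reduced F v R P (mask S) (mask Z) E a → classify ups cores fuel S Z E a comp = true →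
      Solved v R Ext P (mask S) (mask Z) comp := by
  have := hs.finite
  induction fuel with
  | zero => intro S Z E a comp P _ hc; simp [classify] at hc
  | succ fuel ih =>
    intro S Z E a comp P h hc
    unfold classify at hc
    -- How the position was found is irrelevant; the tests that it passes make it central.
    generalize Nat.log2 (Nat.xor (Nat.lor (Nat.xor S Z) (used E)) (used E)) = g at hc
    simp only [Bool.cond_eq_ite] at hc
    split_ifs at hc with c1 c2 c3 c4 c5
    · obtain rfl := isNil_eq_true.1 hc
      refine solved_nil fun f hf he => ?_
      obtain ⟨u, hu, hus⟩ := anyL_eq_true.1 c1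
      obtain ⟨i, hiu, hi⟩ := ext_of_fits hs h hf he u hu
      exact absurd hi (mask_and_eq_zero hus hiu)
    · rw [Bool.and_eq_true] at c2
      obtain rfl := isNil_eq_true.1 c2.1
      refine solved_nil fun f hf he hr => ?_
      have := killed_sound hs.two h c2.2 hf
      omega
    · simp only [Bool.and_eq_true, Bool.not_eq_true'] at c3 hc
      obtain ⟨⟨hgS, hgZ⟩, hgE⟩ := c3
      have hgE' : ∀ t ∈ E, t.meets g = false := fun t ht => by
        rw [Bool.eq_false_iff]
        intro hc
        rw [Bool.eq_false_iff] at hgE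
        exact hgE (anyL_eq_true.2 ⟨t, ht, hc⟩)
      have hgZ' : g ∉ mask Z := by rw [mem_mask, hgZ]; simp
      refine Solved.of_split hs h hgS hgE' ?_ ?_
      · have := ih _ _ _ _ _ P (by
          rw [mask_xor_pow hgS]
          exact h.vanish hgS hgZ' hgE' fun t => by
            rw [mem_filterL, Bool.not_eq_true', Bool.eq_false_iff, ne_eq, Nat.beq_eq]) hc.1
        rwa [mask_xor_pow hgS] at this
      · have := ih _ _ _ _ _ P (by
          rw [mask_lor_pow]
          exact h.nonvanish hgS hgE') hc.2
        rwa [mask_lor_pow] at this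
    · obtain rfl := Nat.eq_of_beq_eq_true c4
      obtain rfl := Nat.eq_of_beq_eq_true c5
      split at hc
      · rename_i T
        obtain rfl := Nat.eq_of_beq_eq_true hc
        refine solved_leaf hs h fun u hu => exists_mem_mask ?_
        rw [Bool.eq_false_iff]
        exact fun hc => c1 (anyL_eq_true.2 ⟨u, hu, hc⟩)
      · simp at hc
    · obtain rfl := Nat.eq_of_beq_eq_true c4
      obtain rfl := isNil_eq_true.1 hc
      refine solved_nil fun f hf he hr => c5 ?_
      have := h.central_rank hf
      have ha : a = 3 := by omega
      simp [ha]
    · split at hc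
      · rename_i d b _
        simp only [Bool.and_eq_true] at hc
        obtain ⟨⟨hr, hany⟩, hc⟩ := hc
        obtain ⟨t, ht, htj⟩ := anyL_eq_true.1 hany
        rw [Bool.and_eq_true] at htj
        have hm := h.mem_of_joins ⟨t, ht, htj.2⟩
        have hne : d ≠ b := by
          rintro rfl
          have := (h.mem t ht).2.2.2
          rcases Rel.joins_iff.1 htj.2 with ⟨h1, h2⟩ | ⟨h1, h2⟩ <;> exact this (h1.trans h2.symm)
        exact solved_remove hs ih h (s := 1) (D := fun _ => d) (B := fun _ => b) (lD := [d])
          (lB := [b]) (by simp [eq_comm]) (by simp [eq_comm]) (by simp [or_comm]) (by simp [hne])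
          (fun _ _ => hne) (fun _ => hm.1) (fun _ => hm.2)
          (fun f hf => by simpa using h.apply_joined hf ht htj.1 htj.2) hr hc
      · split at hc
        · simp at hc
        · rename_i q _
          simp only [Bool.and_eq_true] at hc
          obtain ⟨⟨⟨hd, hp⟩, hr⟩, hc⟩ := hc
          obtain ⟨hrm, hcm, hdet⟩ := paired_sound hs.two h hp
          have hd' : (q.rows ++ q.cols).Nodup := of_decide_eq_true hd
          have hrows : ∀ x, x ∈ Set.range ![q.r₁, q.r₂, q.r₃] ↔ x ∈ q.rows := fun x => by
            simp [Hexad.rows, Matrix.range_cons]; tauto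
          have hcols : ∀ x, x ∈ Set.range ![q.c₁, q.c₂, q.c₃] ↔ x ∈ q.cols := fun x => by
            simp [Hexad.cols, Matrix.range_cons]; tauto
          refine solved_remove hs ih h (s := 3) (D := ![q.r₁, q.r₂, q.r₃])
            (B := ![q.c₁, q.c₂, q.c₃]) hrows hcols (by simp [or_comm]) hd' (fun i j hij => ?_)
            hrm hcm hdet hr hc
          exact (List.nodup_append.1 hd').2.2 _ ((hrows _).1 ⟨i, rfl⟩) _
            ((hcols _).1 ⟨j, rfl⟩) hij

end Soundness

end ClassicalOrbits

namespace ClassicalOrbits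

open Module Matrix

attribute [local instance] LieRing.ofAssociativeRing

/-! ### Truncated exponentials of commuting operators -/

section TruncatedExponential

variable {F : Type*} [Field F]

/-- The binomial theorem: terms of total degree at least `N` vanish at `y`, so the truncation loses
nothing. -/
theorem sum_exp_add {V : Type*} [AddCommGroup V] [Module F V] {a b : Module.End F V}
    (hab : Commute a b) {y : V} {N : ℕ} (hN : ∀ i j, N ≤ i + j → (a ^ i) ((b ^ j) y) = 0)
    (hfac : ∀ k < N, (Nat.factorial k : F) ≠ 0) :
    ∑ i ∈ Finset.range N, ∑ j ∈ Finset.range N,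
      ((Nat.factorial i : F)⁻¹ * (Nat.factorial j : F)⁻¹) • (a ^ i) ((b ^ j) y) =
    ∑ k ∈ Finset.range N, (Nat.factorial k : F)⁻¹ • ((a + b) ^ k) y := by
  rw [← Finset.sum_product', ← Finset.sum_filter_of_ne (p := fun p : ℕ × ℕ => p.1 + p.2 < N)]
  · rw [← Finset.sum_fiberwise_of_maps_to (t := Finset.range N) (g := fun p : ℕ × ℕ => p.1 + p.2)
      (by simp)]
    refine Finset.sum_congr rfl fun k hk => ?_
    rw [Finset.mem_range] at hk
    have e : ((Finset.range N ×ˢ Finset.range N).filter (fun p : ℕ × ℕ => p.1 + p.2 < N)).filter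
        (fun p => p.1 + p.2 = k) = Finset.HasAntidiagonal.antidiagonal k := by
      ext p
      simp only [Finset.mem_filter, Finset.mem_product, Finset.mem_range,
        Finset.HasAntidiagonal.mem_antidiagonal]
      omega
    rw [e, hab.add_pow', LinearMap.sum_apply, Finset.smul_sum]
    refine Finset.sum_congr rfl fun p hp => ?_
    have hp' : p.1 + p.2 = k := Finset.HasAntidiagonal.mem_antidiagonal.1 hp
    have h1 : ((k.choose p.1 : ℕ) : F) * (Nat.factorial p.1 : F) * (Nat.factorial p.2 : F) =
        (Nat.factorial k : F) := by
      subst hp'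
      rw [← Nat.add_choose_mul_factorial_mul_factorial p.1 p.2, Nat.choose_symm_add]
      push_cast
      rfl
    have hk' := hfac k hk
    have hk1 := hfac p.1 (by omega)
    have hk2 := hfac p.2 (by omega)
    rw [LinearMap.smul_apply, ← Nat.cast_smul_eq_nsmul F, smul_smul, Module.End.mul_apply]
    congr 1
    field_simp
    rw [← h1]
    ring
  · intro p _ hne
    by_contra hc
    exact hne (by rw [hN p.1 p.2 (not_lt.1 hc), smul_zero])

end TruncatedExponential

/-! ### Exponentials of strictly upper-triangular matrices -/

section Band

variable {F : Type*} [Field F] {m : ℕ}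

variable (F m) in
/-- The upper-triangular matrices that vanish below the `k`-th diagonal. -/
def band (k : ℕ) : Submodule F (Matrix (Fin m) (Fin m) F) where
  carrier := {x | ∀ i j, j.val < i.val + k → x i j = 0}
  add_mem' {x y} hx hy i j h := by simp [hx i j h, hy i j h]
  zero_mem' i j _ := rfl
  smul_mem' c x hx i j h := by simp [hx i j h]

theorem band_anti {a b : ℕ} (h : a ≤ b) : band F m b ≤ band F m a := fun _ hx i j hij =>
  hx i j (by omega)

theorem mul_mem_band {a b : ℕ} {x y : Matrix (Fin m) (Fin m) F} (hx : x ∈ band F m a)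
    (hy : y ∈ band F m b) : x * y ∈ band F m (a + b) := fun i j hij => by
  rw [Matrix.mul_apply]
  refine Finset.sum_eq_zero fun k _ => ?_
  by_cases hk : k.val < i.val + a
  · rw [hx i k hk, zero_mul]
  · rw [hy k j (by omega), mul_zero]

theorem one_mem_band : (1 : Matrix (Fin m) (Fin m) F) ∈ band F m 0 := fun i j hij =>
  Matrix.one_apply_ne fun h => by subst h; omega

theorem pow_mem_band {x : Matrix (Fin m) (Fin m) F} (hx : x ∈ band F m 1) (k : ℕ) :
    x ^ k ∈ band F m k := by
  induction k with
  | zero => simpa using one_mem_band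
  | succ k ih => rw [pow_succ]; exact mul_mem_band ih hx

theorem eq_zero_of_mem_band {x : Matrix (Fin m) (Fin m) F} {k : ℕ} (hk : m ≤ k + 1 + 0)
    (hx : x ∈ band F m (k + 1)) : x = 0 := by
  ext i j
  exact hx i j (by omega)

theorem mem_strictUpper_iff {x : Matrix (Fin m) (Fin m) F} :
    x ∈ strictUpper F m ↔ x ∈ band F m 1 :=
  forall₂_congr fun i j => by
    rw [show j ≤ i ↔ j.val < i.val + 1 from Nat.lt_succ_iff.symm]

/-- The exponential of a strictly upper-triangular matrix. -/
noncomputable def truncExp (x : Matrix (Fin m) (Fin m) F) : Matrix (Fin m) (Fin m) F :=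
  ∑ k ∈ Finset.range m, (Nat.factorial k : F)⁻¹ • x ^ k

/-- Left and right multiplications commute, so conjugation by the exponential of `x` is the
exponential of `ad x`. -/
theorem truncExp_mul_mul {x y : Matrix (Fin m) (Fin m) F} (hx : x ∈ band F m 1)
    (hfac : ∀ k < m, (Nat.factorial k : F) ≠ 0) (hy : y ∈ band F m 0) :
    truncExp x * y * truncExp (-x) = ∑ k ∈ Finset.range m, (Nat.factorial k : F)⁻¹ •
      ((LinearMap.mulLeft F x - LinearMap.mulRight F x) ^ k) y := by
  have key := sum_exp_add (a := LinearMap.mulLeft F x) (b := LinearMap.mulRight F (-x)) (y := y)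
    (N := m) (LinearMap.commute_mulLeft_right x (-x)) (fun i j hij => by
      rw [LinearMap.pow_mulLeft, LinearMap.pow_mulRight, LinearMap.mulLeft_apply,
        LinearMap.mulRight_apply]
      have h1 := mul_mem_band (pow_mem_band hx i)
        (mul_mem_band hy (pow_mem_band ((band F m 1).neg_mem hx) j))
      ext p q
      exact h1 p q (by omega)) hfac
  have e : LinearMap.mulLeft F x + LinearMap.mulRight F (-x) =
      LinearMap.mulLeft F x - LinearMap.mulRight F x := by
    ext1 z
    simp [sub_eq_add_neg]
  rw [e] at key
  rw [← key, truncExp, truncExp, Finset.sum_mul, Finset.sum_mul]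
  refine Finset.sum_congr rfl fun i _ => ?_
  rw [Finset.mul_sum]
  refine Finset.sum_congr rfl fun j _ => ?_
  rw [LinearMap.pow_mulLeft, LinearMap.pow_mulRight, LinearMap.mulLeft_apply,
    LinearMap.mulRight_apply, Matrix.smul_mul, Matrix.smul_mul, Matrix.mul_smul, smul_smul,
    Matrix.mul_assoc]

theorem truncExp_mul_neg {x : Matrix (Fin m) (Fin m) F} (hx : x ∈ band F m 1)
    (hfac : ∀ k < m, (Nat.factorial k : F) ≠ 0) : truncExp x * truncExp (-x) = 1 := by
  have := truncExp_mul_mul hx hfac one_mem_band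
  rw [mul_one] at this
  rw [this]
  rcases Nat.eq_zero_or_pos m with rfl | hm
  · ext i
    exact i.elim0
  · rw [Finset.sum_eq_single_of_mem 0 (Finset.mem_range.2 hm)]
    · simp
    · intro k _ hk
      obtain ⟨k, rfl⟩ := Nat.exists_eq_succ_of_ne_zero hk
      rw [Nat.succ_eq_add_one, pow_succ, Module.End.mul_apply]
      simp

theorem truncExp_neg_mul {x : Matrix (Fin m) (Fin m) F} (hx : x ∈ band F m 1)
    (hfac : ∀ k < m, (Nat.factorial k : F) ≠ 0) : truncExp (-x) * truncExp x = 1 := by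
  have := truncExp_mul_neg ((band F m 1).neg_mem hx) hfac
  rwa [neg_neg] at this

theorem truncExp_zero [NeZero m] : truncExp (0 : Matrix (Fin m) (Fin m) F) = 1 := by
  rw [truncExp, Finset.sum_eq_single_of_mem 0 (Finset.mem_range.2 (NeZero.pos m))]
  · simp
  · intro k _ hk
    rw [zero_pow hk, smul_zero]

theorem truncExp_mem_band {x : Matrix (Fin m) (Fin m) F} (hx : x ∈ band F m 1) :
    truncExp x ∈ band F m 0 :=
  Submodule.sum_mem _ fun k _ => Submodule.smul_mem _ _ (band_anti (Nat.zero_le k)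
    (pow_mem_band hx k))

theorem truncExp_eq [hm : NeZero m] (hm2 : 2 ≤ m) (x : Matrix (Fin m) (Fin m) F) :
    truncExp x = 1 + x + ∑ k ∈ Finset.range (m - 2), (Nat.factorial (k + 2) : F)⁻¹ • x ^ (k + 2) := by
  obtain ⟨d, rfl⟩ := Nat.exists_eq_add_of_le' hm2
  rw [truncExp, Finset.sum_range_succ', Finset.sum_range_succ']
  simp
  abel

theorem truncExp_sub_one_mem_band (hm2 : 2 ≤ m) {x : Matrix (Fin m) (Fin m) F}
    (hx : x ∈ band F m 1) : truncExp x - 1 ∈ band F m 1 := by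
  have : NeZero m := ⟨by omega⟩
  rw [truncExp_eq hm2, add_assoc, add_sub_cancel_left]
  exact add_mem hx (Submodule.sum_mem _ fun k _ => Submodule.smul_mem _ _
    (band_anti (by omega) (pow_mem_band hx (k + 2))))

theorem add_pow_sub_pow_mem_band {x y : Matrix (Fin m) (Fin m) F} {k : ℕ} (hk : 1 ≤ k)
    (hx : x ∈ band F m 1) (hy : y ∈ band F m k) (l : ℕ) :
    (x + y) ^ (l + 1) - x ^ (l + 1) ∈ band F m (k + l) := by
  have hxy : x + y ∈ band F m 1 := add_mem hx (band_anti hk hy)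
  induction l with
  | zero => simpa using hy
  | succ l ih =>
    have e : (x + y) ^ (l + 1 + 1) - x ^ (l + 1 + 1) =
        ((x + y) ^ (l + 1) - x ^ (l + 1)) * (x + y) + x ^ (l + 1) * y := by
      rw [pow_succ (x + y) (l + 1), pow_succ x (l + 1)]
      noncomm_ring
    rw [e]
    refine add_mem (mul_mem_band (a := k + l) ih hxy) ?_
    rw [show k + (l + 1) = l + 1 + k by ring]
    exact mul_mem_band (pow_mem_band hx _) hy

/-- In the difference of the powers of order at least two, `y` is accompanied by at least one
further strictly upper-triangular factor. -/
theorem truncExp_add_sub_mem_band (hm2 : 2 ≤ m) {x y : Matrix (Fin m) (Fin m) F} {k : ℕ}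
    (hk : 1 ≤ k) (hx : x ∈ band F m 1) (hy : y ∈ band F m k) :
    truncExp (x + y) - truncExp x - y ∈ band F m (k + 1) := by
  have : NeZero m := ⟨by omega⟩
  have e : truncExp (x + y) - truncExp x - y = ∑ l ∈ Finset.range (m - 2),
      (Nat.factorial (l + 2) : F)⁻¹ • ((x + y) ^ (l + 2) - x ^ (l + 2)) := by
    rw [truncExp_eq hm2, truncExp_eq hm2]
    simp only [smul_sub, Finset.sum_sub_distrib]
    abel
  rw [e]
  exact Submodule.sum_mem _ fun l _ => Submodule.smul_mem _ _ (band_anti (by omega)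
    (add_pow_sub_pow_mem_band hk hx hy (l + 1)))

/-- Every element of a group of unipotent matrices is an exponential, if its leading parts belong
to the Lie algebra. -/
theorem exists_truncExp_eq (hm2 : 2 ≤ m) (hfac : ∀ k < m, (Nat.factorial k : F) ≠ 0)
    (N : Submodule F (Matrix (Fin m) (Fin m) F)) (hN : N ≤ band F m 1)
    (U : Matrix (Fin m) (Fin m) F → Prop) (hU1 : ∀ u, U u → u - 1 ∈ band F m 1)
    (hU2 : ∀ u u', U u → U u' → U (u * u')) (hU3 : ∀ x ∈ N, U (truncExp x))
    (hU4 : ∀ k, 1 ≤ k → ∀ w ∈ band F m k, U (1 + w) → ∃ y ∈ N, y ∈ band F m k ∧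
      w - y ∈ band F m (k + 1)) {u : Matrix (Fin m) (Fin m) F} (hu : U u) :
    ∃ z ∈ N, u = truncExp z := by
  have : NeZero m := ⟨by omega⟩
  have key : ∀ k : ℕ, ∃ z ∈ N, u - truncExp z ∈ band F m (k + 1) := by
    intro k
    induction k with
    | zero => exact ⟨0, zero_mem _, by rw [truncExp_zero]; exact hU1 u hu⟩
    | succ k ih =>
      obtain ⟨z, hz, hzu⟩ := ih
      have hz1 := hN hz
      -- Successive approximation along the diagonals: `1 + w = u * exp (-z)` has the property `U`,
      -- its leading part `y` is in `N`, and `z + y` is correct one diagonal further.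
      let w := (u - truncExp z) * truncExp (-z)
      have hw : w ∈ band F m (k + 1) :=
        mul_mem_band (b := 0) hzu (truncExp_mem_band (Submodule.neg_mem _ hz1))
      have hw1 : 1 + w = u * truncExp (-z) := by
        simp only [w]
        rw [Matrix.sub_mul, truncExp_mul_neg hz1 hfac]
        abel
      obtain ⟨y, hy, hyk, hwy⟩ := hU4 (k + 1) (by omega) w hw
        (hw1 ▸ hU2 _ _ hu (hU3 _ (neg_mem hz)))
      refine ⟨z + y, add_mem hz hy, ?_⟩
      have e : u - truncExp (z + y) = (w - y) + w * (truncExp z - 1) -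
          (truncExp (z + y) - truncExp z - y) := by
        have : w * truncExp z = u - truncExp z := by
          simp only [w]
          rw [Matrix.mul_assoc, truncExp_neg_mul hz1 hfac, Matrix.mul_one]
        rw [Matrix.mul_sub, this, Matrix.mul_one]
        abel
      rw [e]
      exact sub_mem (add_mem hwy (mul_mem_band hw (truncExp_sub_one_mem_band hm2 hz1)))
        (truncExp_add_sub_mem_band hm2 (by omega) hz1 hyk)
  obtain ⟨z, hz, hzu⟩ := key m
  exact ⟨z, hz, sub_eq_zero.1 (eq_zero_of_mem_band (k := m) (by omega) hzu)⟩

end Band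

/-! ### The adjoint group of a Lie algebra of strictly upper-triangular matrices -/

section ExpGroupOfMatrices

variable {F : Type*} [Field F] {m : ℕ} (L : LieSubalgebra F (Matrix (Fin m) (Fin m) F))

theorem coe_ad_pow (x y : L) (k : ℕ) : (((LieAlgebra.ad F L x ^ k) y : L) : Matrix _ _ F) =
    ((LinearMap.mulLeft F x.1 - LinearMap.mulRight F x.1) ^ k) y.1 := by
  induction k with
  | zero => rfl
  | succ k ih =>
    rw [pow_succ', pow_succ', Module.End.mul_apply, Module.End.mul_apply, ← ih]
    rfl

variable {L}

theorem mulLeft_sub_pow_mem_band {x y : Matrix (Fin m) (Fin m) F} (hx : x ∈ band F m 1)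
    (hy : y ∈ band F m 1) (k : ℕ) :
    ((LinearMap.mulLeft F x - LinearMap.mulRight F x) ^ k) y ∈ band F m (k + 1) := by
  induction k with
  | zero => simpa using hy
  | succ k ih =>
    rw [pow_succ', Module.End.mul_apply, LinearMap.sub_apply, LinearMap.mulLeft_apply,
      LinearMap.mulRight_apply]
    refine sub_mem ?_ (mul_mem_band ih hx)
    rw [show k + 1 + 1 = 1 + (k + 1) by ring]
    exact mul_mem_band hx ih

/-- The power `m - 1` of `ad x` kills strictly upper-triangular matrices, and both truncations, at
`m` and at `finrank F L ≥ m - 1`, retain all lower terms. -/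
theorem coe_expAd (hL : ∀ x ∈ L, x ∈ band F m 1) (hdim : m ≤ finrank F L + 1)
    (hfac : ∀ k < m, (Nat.factorial k : F) ≠ 0) (x y : L) :
    ((expAd F x y : L) : Matrix (Fin m) (Fin m) F) = truncExp x.1 * y.1 * truncExp (-x.1) := by
  have hx := hL x.1 x.2
  have hy := hL y.1 y.2
  have hz : ∀ k, m ≤ k + 1 →
      ((LinearMap.mulLeft F x.1 - LinearMap.mulRight F x.1) ^ k) y.1 = 0 := fun k hk =>
    eq_zero_of_mem_band (k := k) hk (mulLeft_sub_pow_mem_band hx hy k)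
  rw [truncExp_mul_mul hx hfac (band_anti zero_le_one hy), expAd_apply,
    ← LieSubalgebra.coe_incl, map_sum]
  simp only [LieSubalgebra.coe_incl, map_smul, coe_ad_pow]
  rw [← Finset.sum_subset (Finset.range_mono (Nat.sub_le m 1)),
    ← Finset.sum_subset (Finset.range_mono (show m - 1 ≤ finrank F L by omega))]
  all_goals
    intro k _ hk
    rw [hz k (by simp at hk; omega), smul_zero]

/-- The exponentials of a Lie algebra of strictly upper-triangular matrices make up the adjoint
group, if the products of the exponentials of matrices are exponentials. -/
theorem expGroup_of_mul (hm2 : 2 ≤ m) (hL : ∀ x ∈ L, x ∈ band F m 1) (hdim : m ≤ finrank F L + 1)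
    (hdim2 : 2 ≤ finrank F L) (hfac : ∀ k < m, (Nat.factorial k : F) ≠ 0)
    (hmul : ∀ x ∈ L, ∀ y ∈ L, ∃ z ∈ L, truncExp x * truncExp y = truncExp z) :
    ExpGroup F L := by
  have : NeZero m := ⟨by omega⟩
  have hcomp : ∀ x y z : L, truncExp x.1 * truncExp y.1 = truncExp z.1 → ∀ w,
      expAd F x (expAd F y w) = expAd F z w := fun x y z h w => by
    refine Subtype.ext ?_
    have h' : truncExp (-y.1) * truncExp (-x.1) = truncExp (-z.1) := by
      rw [← Matrix.mul_one (truncExp (-y.1) * truncExp (-x.1)),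
        ← truncExp_mul_neg (hL z.1 z.2) hfac, ← h, ← Matrix.mul_assoc, ← Matrix.mul_assoc,
        Matrix.mul_assoc (truncExp (-y.1)), truncExp_neg_mul (hL x.1 x.2) hfac, Matrix.mul_one,
        truncExp_neg_mul (hL y.1 y.2) hfac, Matrix.one_mul]
    rw [coe_expAd hL hdim hfac, coe_expAd hL hdim hfac, coe_expAd hL hdim hfac, ← h, ← h']
    simp only [Matrix.mul_assoc]
  have hzero : ∀ w : L, expAd F 0 w = w := fun w => by
    refine Subtype.ext ?_
    rw [coe_expAd hL hdim hfac]
    simp [truncExp_zero]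
  have hinv : ∀ x w : L, expAd F x (expAd F (-x) w) = w := fun x w => by
    rw [hcomp x (-x) 0 ((truncExp_mul_neg (hL x.1 x.2) hfac).trans truncExp_zero.symm), hzero]
  refine ⟨hdim2, fun g hg => ?_, fun x => ?_⟩
  · induction hg using Subgroup.closure_induction with
    | mem g hg => exact hg
    | one => exact ⟨0, by ext w; simp [hzero]⟩
    | mul g h _ _ hg hh =>
      obtain ⟨x, hx⟩ := hg
      obtain ⟨y, hy⟩ := hh
      obtain ⟨z, hz, e⟩ := hmul x.1 x.2 y.1 y.2
      refine ⟨⟨z, hz⟩, LinearMap.ext fun w => ?_⟩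
      rw [← hcomp x y ⟨z, hz⟩ e, ← hx, ← hy]
      rfl
    | inv g _ hg =>
      obtain ⟨x, hx⟩ := hg
      refine ⟨-x, LinearMap.ext fun w => g.injective ?_⟩
      change g (g.symm w) = (g : L →ₗ[F] L) _
      rw [hx, hinv, LinearEquiv.apply_symm_apply]
  · refine ⟨LinearEquiv.ofLinearMap (expAd F x) (expAd F (-x)) (LinearMap.ext fun w => hinv x w)
      (LinearMap.ext fun w => ?_), Subgroup.subset_closure ⟨x, ?_⟩, ?_⟩
    · have := hinv (-x) w
      rwa [neg_neg] at this
    · ext w; rfl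
    · ext w; rfl

end ExpGroupOfMatrices

/-! ### Exponentials in orthogonal and symplectic Lie algebras -/

section Involution

variable {F : Type*} [Field F] {m : ℕ}

/-- The adjoint of a matrix with respect to the form with Gram matrix `c i` at `(i, -i)`. -/
def formAdjoint (c : Fin m → F) (x : Matrix (Fin m) (Fin m) F) : Matrix (Fin m) (Fin m) F :=
  Matrix.of fun i j => c i * c j * x j.rev i.rev

variable {c : Fin m → F}

theorem formAdjoint_add (x y : Matrix (Fin m) (Fin m) F) :
    formAdjoint c (x + y) = formAdjoint c x + formAdjoint c y := by
  ext i j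
  simp [formAdjoint, mul_add]

theorem formAdjoint_smul (a : F) (x : Matrix (Fin m) (Fin m) F) :
    formAdjoint c (a • x) = a • formAdjoint c x := by
  ext i j
  simp [formAdjoint]
  ring

theorem formAdjoint_one (hc : ∀ i, c i * c i = 1) : formAdjoint c (1 : Matrix _ _ F) = 1 := by
  ext i j
  simp only [formAdjoint, Matrix.of_apply, Matrix.one_apply, Fin.rev_inj]
  by_cases h : i = j
  · subst h; simp [hc]
  · simp [h, Ne.symm h]

theorem formAdjoint_mul (hc : ∀ i, c i * c i = 1) (x y : Matrix (Fin m) (Fin m) F) :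
    formAdjoint c (x * y) = formAdjoint c y * formAdjoint c x := by
  ext i j
  simp only [formAdjoint, Matrix.of_apply, Matrix.mul_apply, Finset.mul_sum]
  rw [← Equiv.sum_comp Fin.revPerm]
  refine Finset.sum_congr rfl fun k _ => ?_
  rw [Fin.revPerm_apply]
  linear_combination (-c i * c j * x j.rev k.rev * y k.rev i.rev) * hc k

theorem formAdjoint_formAdjoint {e : F} (he : e * e = 1) (hc : ∀ i, c i * c i = 1)
    (hr : ∀ i, c i.rev = e * c i) (x : Matrix (Fin m) (Fin m) F) :
    formAdjoint c (formAdjoint c x) = x := by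
  ext i j
  simp only [formAdjoint, Matrix.of_apply, Fin.rev_rev, hr]
  linear_combination (c i * c i * c j * c j * x i j) * he + (c j * c j * x i j) * hc i +
    x i j * hc j

theorem formAdjoint_pow (hc : ∀ i, c i * c i = 1) (x : Matrix (Fin m) (Fin m) F) (k : ℕ) :
    formAdjoint c (x ^ k) = formAdjoint c x ^ k := by
  induction k with
  | zero => simpa using formAdjoint_one hc
  | succ k ih => rw [pow_succ, formAdjoint_mul hc, ih, pow_succ']

theorem formAdjoint_truncExp (hc : ∀ i, c i * c i = 1) (x : Matrix (Fin m) (Fin m) F) :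
    formAdjoint c (truncExp x) = truncExp (formAdjoint c x) := by
  have h : ∀ s : Finset ℕ, formAdjoint c (∑ k ∈ s, (Nat.factorial k : F)⁻¹ • x ^ k) =
      ∑ k ∈ s, (Nat.factorial k : F)⁻¹ • formAdjoint c x ^ k := fun s => by
    induction s using Finset.induction_on with
    | empty => ext; simp [formAdjoint]
    | insert k s hk ih =>
      rw [Finset.sum_insert hk, Finset.sum_insert hk, formAdjoint_add, ih, formAdjoint_smul,
        formAdjoint_pow hc]
  exact h _

theorem formAdjoint_mem_band {k : ℕ} {x : Matrix (Fin m) (Fin m) F} (hx : x ∈ band F m k) :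
    formAdjoint c x ∈ band F m k := fun i j hij => by
  have := hx j.rev i.rev (by simp only [Fin.val_rev]; omega)
  simp [formAdjoint, this]

/-- Products of exponentials are exponentials in the Lie algebra of a form. -/
theorem exists_truncExp_mul_of_form (hm2 : 2 ≤ m) (hfac : ∀ k < m, (Nat.factorial k : F) ≠ 0)
    (h2 : (2 : F) ≠ 0) {e : F} (he : e * e = 1) (hc : ∀ i, c i * c i = 1)
    (hr : ∀ i, c i.rev = e * c i) (N : Submodule F (Matrix (Fin m) (Fin m) F))
    (hN : ∀ x, x ∈ N ↔ x ∈ band F m 1 ∧ formAdjoint c x = -x) :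
    ∀ x ∈ N, ∀ y ∈ N, ∃ z ∈ N, truncExp x * truncExp y = truncExp z := by
  have hexp : ∀ x ∈ N, truncExp x - 1 ∈ band F m 1 ∧
      formAdjoint c (truncExp x) * truncExp x = 1 := fun x hx => by
    obtain ⟨h1, h2⟩ := (hN x).1 hx
    exact ⟨truncExp_sub_one_mem_band hm2 h1, by
      rw [formAdjoint_truncExp hc, h2, truncExp_neg_mul h1 hfac]⟩
  have hmul : ∀ u u' : Matrix (Fin m) (Fin m) F,
      (u - 1 ∈ band F m 1 ∧ formAdjoint c u * u = 1) →
      (u' - 1 ∈ band F m 1 ∧ formAdjoint c u' * u' = 1) →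
      (u * u' - 1 ∈ band F m 1 ∧ formAdjoint c (u * u') * (u * u') = 1) := by
    rintro u u' ⟨h1, h2⟩ ⟨h3, h4⟩
    constructor
    · have e : u * u' - 1 = (u - 1) * (u' - 1) + (u - 1) + (u' - 1) := by noncomm_ring
      rw [e]
      exact add_mem (add_mem (band_anti (by omega) (mul_mem_band h1 h3)) h1) h3
    · rw [formAdjoint_mul hc, Matrix.mul_assoc, ← Matrix.mul_assoc _ u u', h2, Matrix.one_mul, h4]
  intro x hx y hy
  refine exists_truncExp_eq hm2 hfac N (fun z hz => ((hN z).1 hz).1)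
    (fun u => u - 1 ∈ band F m 1 ∧ formAdjoint c u * u = 1) (fun _ h => h.1) hmul hexp
    (fun k hk w hw hu => ?_) (hmul _ _ (hexp x hx) (hexp y hy))
  have hw' := formAdjoint_mem_band (c := c) hw
  -- Since `1 + w` preserves the form, `w` is skew up to a product of two matrices of the band `k`.
  -- So the skew part of `w`, obtained by division by `2`, is its leading part.
  have h3 : w + formAdjoint c w = -(formAdjoint c w * w) := by
    have := hu.2
    rw [formAdjoint_add, formAdjoint_one hc] at this
    have e : (1 + formAdjoint c w) * (1 + w) = 1 + (w + formAdjoint c w) + formAdjoint c w * w := by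
      noncomm_ring
    rw [e] at this
    rw [eq_neg_iff_add_eq_zero]
    have h := congrArg (fun z => z - 1) this
    simp only [sub_self] at h
    rw [← h]
    abel
  have h4 : ∀ z : Matrix (Fin m) (Fin m) F, formAdjoint c (-z) = -formAdjoint c z := fun z => by
    simpa using formAdjoint_smul (c := c) (-1) z
  refine ⟨(2 : F)⁻¹ • (w - formAdjoint c w), (hN _).2 ⟨?_, ?_⟩, ?_, ?_⟩
  · exact Submodule.smul_mem _ _ (sub_mem (band_anti hk hw) (band_anti hk hw'))
  · rw [formAdjoint_smul, sub_eq_add_neg, formAdjoint_add, h4,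
      formAdjoint_formAdjoint he hc hr, ← smul_neg]
    congr 1
    abel
  · exact Submodule.smul_mem _ _ (sub_mem hw hw')
  · have e : w - (2 : F)⁻¹ • (w - formAdjoint c w) = (2 : F)⁻¹ • (w + formAdjoint c w) := by
      ext i j
      simp only [Matrix.sub_apply, Matrix.smul_apply, Matrix.add_apply, smul_eq_mul]
      field_simp
      ring
    rw [e, h3]
    exact Submodule.smul_mem _ _ (Submodule.neg_mem _ (band_anti (by omega)
      (mul_mem_band hw' hw)))

/-- Products of exponentials of strictly upper-triangular matrices are exponentials. -/
theorem exists_truncExp_mul (hm2 : 2 ≤ m) (hfac : ∀ k < m, (Nat.factorial k : F) ≠ 0) :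
    ∀ x ∈ band F m 1, ∀ y ∈ band F m 1, ∃ z ∈ band F m 1,
      truncExp x * truncExp y = truncExp z := by
  intro x hx y hy
  have hmul : ∀ u u' : Matrix (Fin m) (Fin m) F, u - 1 ∈ band F m 1 → u' - 1 ∈ band F m 1 →
      u * u' - 1 ∈ band F m 1 := fun u u' h1 h3 => by
    have e : u * u' - 1 = (u - 1) * (u' - 1) + (u - 1) + (u' - 1) := by noncomm_ring
    rw [e]
    exact add_mem (add_mem (band_anti (by omega) (mul_mem_band h1 h3)) h1) h3
  exact exists_truncExp_eq hm2 hfac (band F m 1) le_rfl (fun u => u - 1 ∈ band F m 1)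
    (fun _ h => h) hmul (fun z hz => truncExp_sub_one_mem_band hm2 hz)
    (fun k hk w hw _ => ⟨w, band_anti hk hw, hw, by simp⟩)
    (hmul _ _ (truncExp_sub_one_mem_band hm2 hx) (truncExp_sub_one_mem_band hm2 hy))

end Involution

end ClassicalOrbits

namespace ClassicalOrbits

open Module Matrix

attribute [local instance] LieRing.ofAssociativeRing

/-! ### Root vectors as a basis of the nilradical -/

section Realization

variable {F : Type*} [Field F] {X : ClassicalType} {n : ℕ}

variable (F X n) in
/-- The signs of the invariant form. -/
def formSign (i : Fin (size X n)) : F :=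
  match X, i with
  | .C, i => if i < i.rev then 1 else -1
  | _, _ => 1

theorem formSign_mul_self (i : Fin (size X n)) : formSign F X n i * formSign F X n i = 1 := by
  cases X <;> simp only [formSign]
  · simp
  · simp
  · split_ifs <;> simp
  · simp

theorem exists_formSign_rev : ∃ e : F, e * e = 1 ∧
    ∀ i, formSign F X n i.rev = e * formSign F X n i := by
  cases X with
  | A => exact ⟨1, by simp, fun i => by simp [formSign]⟩
  | B => exact ⟨1, by simp, fun i => by simp [formSign]⟩
  | C =>
    refine ⟨-1, by simp, fun i => ?_⟩
    have hi := i.2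
    have hs : size .C n = 2 * n := rfl
    simp only [formSign, Fin.rev_rev, Fin.lt_def, Fin.val_rev]
    split_ifs <;> first | omega | simp
  | D => exact ⟨1, by simp, fun i => by simp [formSign]⟩

/-- Entrywise, invariance of the form is skewness for the involution `formAdjoint`; the types `B`,
`C`, `D` differ only in the signs. -/
theorem mem_simpleLie_iff (hX : X ≠ .A) {x : Matrix (Fin (size X n)) (Fin (size X n)) F} :
    x ∈ simpleLie F X n ↔ formAdjoint (formSign F X n) x = -x := by
  have symm : ∀ {m : ℕ} {x : Matrix (Fin m) (Fin m) F},
      x ∈ skewAdjointMatricesLieSubalgebra (symmGram F m) ↔ formAdjoint (fun _ => 1) x = -x := by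
    intro m x
    rw [mem_symm_iff, ← Matrix.ext_iff]
    simp only [formAdjoint, Matrix.of_apply, mul_one, one_mul, Matrix.neg_apply]
    constructor
    · intro h i j
      have := h i.rev j
      rwa [Fin.rev_rev] at this
    · intro h i j
      have := h i.rev j
      rwa [Fin.rev_rev] at this
  cases X with
  | A => exact absurd rfl hX
  | B => exact symm
  | C =>
    change x ∈ skewAdjointMatricesLieSubalgebra (skewGram F (size .C n)) ↔ _
    rw [mem_alt_iff, ← Matrix.ext_iff]
    have key : ∀ i j : Fin (size .C n), formAdjoint (formSign F .C n) x i j = (-x) i j ↔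
        x j.rev i.rev * (if j.rev < j then (1 : F) else -1) =
          - ((if i.rev < i then 1 else -1) * x i j) := by
      intro i j
      have hi := i.2
      have hj := j.2
      have hs : size .C n = 2 * n := rfl
      simp only [formAdjoint, formSign, Matrix.of_apply, Matrix.neg_apply, Fin.lt_def, Fin.val_rev]
      split_ifs <;> first | omega | skip
      all_goals
        simp only [mul_one, one_mul, mul_neg, neg_mul, neg_neg]
        try rw [neg_eq_iff_eq_neg]
        try simp only [neg_neg]
    constructor
    · intro h i j
      rw [key]
      have := h i.rev j
      simpa using this
    · intro h i j
      have := (key i.rev j).1 (h i.rev j)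
      simpa using this
  | D => exact symm

theorem mem_nilradical_iff (hX : X ≠ .A) {x : Matrix (Fin (size X n)) (Fin (size X n)) F} :
    x ∈ nilradical F X n ↔ x ∈ band F (size X n) 1 ∧ formAdjoint (formSign F X n) x = -x := by
  rw [← mem_simpleLie_iff hX, ← mem_strictUpper_iff]
  rfl

theorem mem_nilradical_A_iff {x : Matrix (Fin (size .A n)) (Fin (size .A n)) F} :
    x ∈ nilradical F .A n ↔ x ∈ band F (size .A n) 1 := by
  rw [← mem_strictUpper_iff]
  refine ⟨fun h => h.1, fun h => ⟨h, ?_⟩⟩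
  change Matrix.trace x = 0
  exact Finset.sum_eq_zero fun i _ => h i i le_rfl

theorem mem_band_of_mem_nilradical {x : Matrix (Fin (size X n)) (Fin (size X n)) F}
    (hx : x ∈ nilradical F X n) : x ∈ band F (size X n) 1 :=
  mem_strictUpper_iff.1 hx.1

/-- An entry outside the root cells is, up to sign, the entry of the mirrored root cell. On the
antidiagonal in types `B` and `D` skewness says that twice the entry is zero. -/
theorem eq_zero_of_forall_root (h2 : (2 : F) ≠ 0) {x : nilradical F X n}
    (h : ∀ α : PosRoot X n, x.1 α.1.1 α.1.2 = 0) : x = 0 := by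
  refine Subtype.ext (Matrix.ext fun i j => ?_)
  change x.1 i j = 0
  have hb := mem_band_of_mem_nilradical x.2
  by_cases hij : j.val < i.val + 1
  · exact hb i j hij
  · have hlt : i < j := by rw [Fin.lt_def]; omega
    by_cases hX : X = .A
    · subst hX
      exact h ⟨(i, j), hlt⟩
    · have hadj := fun i j => congrFun (congrFun ((mem_nilradical_iff hX).1 x.2).2 i) j
      have key : (∀ α : PosRoot X n, x.1 α.1.1 α.1.2 = 0) → x.1 j.rev i.rev = 0 → x.1 i j = 0 :=
        fun _ h0 => by
          have := hadj i j
          simp only [formAdjoint, Matrix.of_apply, h0, mul_zero, Matrix.neg_apply] at this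
          exact neg_eq_zero.1 this.symm
      rcases lt_trichotomy j i.rev with hj | hj | hj
      · have hroot : IsRootCell X n (i, j) := by
          cases X
          exacts [absurd rfl hX, ⟨hlt, hj⟩, ⟨hlt, hj.le⟩, ⟨hlt, hj⟩]
        exact h ⟨(i, j), hroot⟩
      · by_cases hC : X = .C
        · subst hC
          exact h ⟨(i, j), hlt, hj.le⟩
        · subst hj
          have := hadj i i.rev
          have hs : ∀ k, formSign F X n k = 1 := by
            cases X
            exacts [absurd rfl hX, fun _ => rfl, absurd rfl hC, fun _ => rfl]
          simp only [formAdjoint, Matrix.of_apply, hs, mul_one, one_mul, Fin.rev_rev,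
            Matrix.neg_apply] at this
          have h3 : (2 : F) * x.1 i i.rev = 0 := by linear_combination this
          exact (mul_eq_zero.1 h3).resolve_left h2
      · refine key h ?_
        have h1 : j.rev < i.rev := Fin.rev_lt_rev.2 hlt
        have h2 : i.rev < j.rev.rev := by rwa [Fin.rev_rev]
        have hroot : IsRootCell X n (j.rev, i.rev) := by
          cases X
          exacts [absurd rfl hX, ⟨h1, h2⟩, ⟨h1, h2.le⟩, ⟨h1, h2⟩]
        exact h ⟨(j.rev, i.rev), hroot⟩

/-- The cell of a root, in natural numbers. -/
def PosRoot.cell (α : PosRoot X n) : ℕ × ℕ := (α.1.1.val, α.1.2.val)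

theorem PosRoot.cell_injective : Function.Injective (PosRoot.cell : PosRoot X n → ℕ × ℕ) := by
  rintro ⟨⟨a, b⟩, h⟩ ⟨⟨c, d⟩, h'⟩ e
  simp only [PosRoot.cell, Prod.mk.injEq] at e
  exact Subtype.ext (Prod.ext (Fin.ext e.1) (Fin.ext e.2))

theorem isCell_iff {p q : Fin (size X n)} : isCell X n p q = true ↔ IsRootCell X n (p, q) := by
  have hp := p.2
  have hq := q.2
  have hA : size .A n = n + 1 := rfl
  have hB : size .B n = 2 * n + 1 := rfl
  have hC : size .C n = 2 * n := rfl
  have hD : size .D n = 2 * n := rfl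
  cases X <;> simp only [isCell, IsRootCell, Bool.and_eq_true, Nat.blt_eq, Nat.ble_eq, Fin.lt_def,
    Fin.le_def, Fin.val_rev] <;> omega

theorem lt_of_isCell {p q : ℕ} (h : isCell X n p q = true) : p < size X n ∧ q < size X n := by
  cases X <;> simp only [isCell, Bool.and_eq_true, Nat.blt_eq, Nat.ble_eq, size] at h ⊢ <;> omega

theorem PosRoot.isCell_cell (α : PosRoot X n) : isCell X n α.cell.1 α.cell.2 = true :=
  isCell_iff.2 α.2

theorem exists_cell_eq {x : ℕ × ℕ} (h : isCell X n x.1 x.2 = true) :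
    ∃ α : PosRoot X n, α.cell = x :=
  ⟨⟨(⟨x.1, (lt_of_isCell h).1⟩, ⟨x.2, (lt_of_isCell h).2⟩), isCell_iff.1 h⟩, rfl⟩

theorem rootMatrix_eq (α : PosRoot X n) : rootMatrix F α = single α.1.1 α.1.2 1 +
    ((mirrorSign X n α.1.1 α.1.2 : ℤ) : F) • single α.1.2.rev α.1.1.rev 1 := by
  obtain ⟨⟨p, q⟩, h⟩ := α
  have hp := p.2
  have hq := q.2
  have hs : size .C n = 2 * n := rfl
  cases X with
  | A => simp [rootMatrix, mirrorSign]
  | B => simp [rootMatrix, mirrorSign, sub_eq_add_neg]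
  | C =>
    have e1 : q = p.rev ↔ Nat.beq (p.val + q.val + 1) (2 * n) = true := by
      rw [Fin.ext_iff, Fin.val_rev, Nat.beq_eq]
      omega
    have e2 : q < q.rev ↔ Nat.blt q.val n = true := by
      rw [Fin.lt_def, Fin.val_rev, Nat.blt_eq]
      omega
    simp only [rootMatrix, mirrorSign, e1, e2]
    split_ifs <;> simp [sub_eq_add_neg]
  | D => simp [rootMatrix, mirrorSign, sub_eq_add_neg]

/-- The mirrored cell of a root is no root cell, or its coefficient is zero (in type `A`, and on the
antidiagonal in type `C`). So the entries in the root cells are the coordinates dual to the root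
vectors. -/
theorem rootMatrix_apply (α β : PosRoot X n) :
    rootMatrix F α β.1.1 β.1.2 = if α = β then 1 else 0 := by
  rw [rootMatrix_eq, Matrix.add_apply, Matrix.smul_apply, Matrix.single_apply, Matrix.single_apply]
  have h1 : (α.1.1 = β.1.1 ∧ α.1.2 = β.1.2) ↔ α = β := by
    rw [Subtype.ext_iff, Prod.ext_iff]
  simp only [h1]
  rw [add_eq_left, smul_eq_mul]
  by_cases h : α.1.2.rev = β.1.1 ∧ α.1.1.rev = β.1.2
  · have hs : mirrorSign X n α.1.1 α.1.2 = 0 := by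
      obtain ⟨⟨p, q⟩, hα⟩ := α
      obtain ⟨⟨p', q'⟩, hβ⟩ := β
      simp only at h
      obtain ⟨rfl, rfl⟩ := h
      have hp := p.2
      have hq := q.2
      cases X with
      | A => rfl
      | B =>
        simp only [IsRootCell, Fin.lt_def, Fin.val_rev] at hα hβ
        omega
      | C =>
        simp only [IsRootCell, Fin.lt_def, Fin.le_def, Fin.val_rev] at hα hβ
        have hs : size .C n = 2 * n := rfl
        have : Nat.beq (p.val + q.val + 1) (2 * n) = true := by
          rw [Nat.beq_eq]; omega
        simp [mirrorSign, this]
      | D =>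
        simp only [IsRootCell, Fin.lt_def, Fin.val_rev] at hα hβ
        omega
    simp [hs]
  · rw [if_neg h, mul_zero]

variable (X n) in
/-- The basis of root vectors. -/
noncomputable def rootBasis (h2 : (2 : F) ≠ 0) : Basis (PosRoot X n) F (nilradical F X n) :=
  Basis.ofEquivFun <| LinearEquiv.ofBijective
    ({ toFun := fun x α => x.1 α.1.1 α.1.2
       map_add' := fun _ _ => rfl
       map_smul' := fun _ _ => rfl } : nilradical F X n →ₗ[F] PosRoot X n → F)
    ⟨fun x y hxy => sub_eq_zero.1 (eq_zero_of_forall_root h2 fun α => by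
        have := congrFun hxy α
        change x.1 α.1.1 α.1.2 = y.1 α.1.1 α.1.2 at this
        change x.1 α.1.1 α.1.2 - y.1 α.1.1 α.1.2 = 0
        rw [this, sub_self]),
      fun c => ⟨∑ α, c α • rootVector F α, funext fun β => by
        change (nilradical F X n).subtype (∑ α, c α • rootVector F α) β.1.1 β.1.2 = c β
        rw [map_sum, Matrix.sum_apply]
        have : ∀ α, (nilradical F X n).subtype (c α • rootVector F α) β.1.1 β.1.2 =
            c α * if α = β then 1 else 0 := fun α => by
          rw [← rootMatrix_apply (F := F)]
          rfl
        simp [this]⟩⟩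

theorem rootBasis_repr (h2 : (2 : F) ≠ 0) (x : nilradical F X n) (α : PosRoot X n) :
    (rootBasis X n h2).repr x α = x.1 α.1.1 α.1.2 := by
  rw [← Basis.equivFun_apply, rootBasis, Basis.equivFun_ofEquivFun]
  rfl

theorem rootBasis_apply (h2 : (2 : F) ≠ 0) (α : PosRoot X n) :
    rootBasis X n h2 α = rootVector F α := by
  refine (rootBasis X n h2).repr.injective (Finsupp.ext fun β => ?_)
  rw [Basis.repr_self, rootBasis_repr, Finsupp.single_apply]
  exact (rootMatrix_apply α β).symm

theorem finrank_nilradical (h2 : (2 : F) ≠ 0) :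
    finrank F (nilradical F X n) = Fintype.card (PosRoot X n) :=
  finrank_eq_card_basis (rootBasis X n h2)

theorem expGroup_nilradical (h2 : (2 : F) ≠ 0) (hm : 2 ≤ size X n)
    (hfac : ∀ k < size X n, (Nat.factorial k : F) ≠ 0)
    (hdim : size X n ≤ finrank F (nilradical F X n) + 1)
    (hdim2 : 2 ≤ finrank F (nilradical F X n)) : ExpGroup F (nilradical F X n) := by
  refine expGroup_of_mul hm (fun x => mem_band_of_mem_nilradical) hdim hdim2 hfac ?_
  by_cases hX : X = .A
  · subst hX
    intro x hx y hy
    obtain ⟨z, hz, e⟩ := exists_truncExp_mul hm hfac x (mem_nilradical_A_iff.1 hx) y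
      (mem_nilradical_A_iff.1 hy)
    exact ⟨z, mem_nilradical_A_iff.2 hz, e⟩
  · obtain ⟨e, he, hr⟩ := exists_formSign_rev (F := F) (X := X) (n := n)
    exact exists_truncExp_mul_of_form hm hfac h2 he formSign_mul_self hr
      (nilradical F X n).toSubmodule fun x => mem_nilradical_iff hX

/-! ### Brackets of root vectors -/

variable (F) in
/-- The coefficient of a matrix cell in a list of cells with coefficients. -/
def coefAt (l : List ((ℕ × ℕ) × ℤ)) (z : ℕ × ℕ) : F :=
  (l.map fun w => if w.1 = z then (w.2 : F) else 0).sum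

theorem coefAt_append (l l' : List ((ℕ × ℕ) × ℤ)) (z : ℕ × ℕ) :
    coefAt F (l ++ l') z = coefAt F l z + coefAt F l' z := by
  simp [coefAt]

theorem coefAt_ite {m : ℕ} (a b c d g h : Fin m) (t : ℤ) {b' c' a' d' : ℕ} (hb : b' = b.val)
    (hc : c' = c.val) (ha : a' = a.val) (hd : d' = d.val) :
    coefAt F (if Nat.beq b' c' then [((a', d'), t)] else []) (g.val, h.val) =
      (t : F) * (single a b (1 : F) * single c d 1 : Matrix (Fin m) (Fin m) F) g h := by
  subst hb hc ha hd
  by_cases hbc : b = c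
  · subst hbc
    rw [Matrix.single_mul_single_same, Matrix.single_apply]
    have e : ((a.val, d.val) = (g.val, h.val)) ↔ (a = g ∧ d = h) := by
      rw [Prod.mk.injEq, Fin.ext_iff, Fin.ext_iff]
    have : Nat.beq b.val b.val = true := by simp
    simp only [this, if_true, coefAt, List.map_cons, List.map_nil, List.sum_cons, List.sum_nil, e]
    split_ifs <;> simp
  · rw [Matrix.single_mul_single_of_ne _ _ _ _ hbc]
    have : Nat.beq b.val c.val = false := by
      rw [Bool.eq_false_iff, ne_eq, Nat.beq_eq]
      exact fun hc => hbc (Fin.ext hc)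
    simp [this, coefAt]

/-- A root vector is a combination of two matrix units, so the commutator expands into the eight
products of `bracketCells`. -/
theorem lie_rootMatrix_apply (α β : PosRoot X n) (g h : Fin (size X n)) :
    (⁅rootMatrix F α, rootMatrix F β⁆ : Matrix _ _ F) g h =
      coefAt F (bracketCells X n α.cell β.cell) (g.val, h.val) := by
  have hrev : ∀ p : Fin (size X n), size X n - 1 - p.val = p.rev.val := fun p => by
    rw [Fin.val_rev]
    omega
  have hR := congrArg₂ (· + ·)
    (coefAt_ite (F := F) α.1.1 α.1.2 β.1.1 β.1.2 g h 1 rfl rfl rfl rfl) <| congrArg₂ (· + ·)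
    (coefAt_ite α.1.1 α.1.2 β.1.2.rev β.1.1.rev g h (mirrorSign X n β.1.1 β.1.2) rfl (hrev _) rfl
      (hrev _)) <| congrArg₂ (· + ·)
    (coefAt_ite α.1.2.rev α.1.1.rev β.1.1 β.1.2 g h (mirrorSign X n α.1.1 α.1.2) (hrev _) rfl
      (hrev _) rfl) <| congrArg₂ (· + ·)
    (coefAt_ite α.1.2.rev α.1.1.rev β.1.2.rev β.1.1.rev g h
      (mirrorSign X n α.1.1 α.1.2 * mirrorSign X n β.1.1 β.1.2) (hrev _) (hrev _) (hrev _)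
      (hrev _)) <| congrArg₂ (· + ·)
    (coefAt_ite β.1.1 β.1.2 α.1.1 α.1.2 g h (-1) rfl rfl rfl rfl) <| congrArg₂ (· + ·)
    (coefAt_ite β.1.1 β.1.2 α.1.2.rev α.1.1.rev g h (-mirrorSign X n α.1.1 α.1.2) rfl (hrev _) rfl
      (hrev _)) <| congrArg₂ (· + ·)
    (coefAt_ite β.1.2.rev β.1.1.rev α.1.1 α.1.2 g h (-mirrorSign X n β.1.1 β.1.2) (hrev _) rfl
      (hrev _) rfl)
    (coefAt_ite β.1.2.rev β.1.1.rev α.1.2.rev α.1.1.rev g h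
      (-(mirrorSign X n α.1.1 α.1.2 * mirrorSign X n β.1.1 β.1.2)) (hrev _) (hrev _) (hrev _)
      (hrev _))
  simp only [← coefAt_append] at hR
  refine Eq.trans ?_ hR.symm
  rw [Ring.lie_def, rootMatrix_eq, rootMatrix_eq]
  simp only [add_mul, mul_add, Matrix.sub_apply, Matrix.add_apply, Matrix.smul_mul, Matrix.mul_smul,
    Matrix.smul_apply, smul_eq_mul]
  push_cast
  ring

theorem coefAt_rootTerms (α β γ : PosRoot X n) :
    coefAt F (rootTerms X n α.cell β.cell) γ.cell =
      coefAt F (bracketCells X n α.cell β.cell) γ.cell := by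
  rw [rootTerms]
  generalize bracketCells X n α.cell β.cell = l
  induction l with
  | nil => rfl
  | cons z l ih =>
    have e : ∀ l : List ((ℕ × ℕ) × ℤ), coefAt F (z :: l) γ.cell =
        (if z.1 = γ.cell then (z.2 : F) else 0) + coefAt F l γ.cell := fun l => by simp [coefAt]
    rw [List.filter_cons, e]
    split_ifs with h1 h2 h2
    · rw [e, if_pos h2, ih]
    · rw [e, if_neg h2, ih]
    · have h3 : z.2 = 0 := by
        rw [h2, γ.isCell_cell, Bool.true_and, Bool.not_eq_true, Bool.not_eq_false', Nat.beq_eq]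
          at h1
        exact Int.natAbs_eq_zero.1 h1
      simp [h3, ih]
    · rw [zero_add, ih]

theorem coefAt_of_forall {z : ℕ × ℕ} {l : List ((ℕ × ℕ) × ℤ)} (h : ∀ w ∈ l, w.1 = z) (x : ℕ × ℕ) :
    coefAt F l x = if z = x then (total l : F) else 0 := by
  induction l with
  | nil => simp [coefAt, total]
  | cons w l ih =>
    have e : coefAt F (w :: l) x = (if w.1 = x then (w.2 : F) else 0) + coefAt F l x := by
      simp [coefAt]
    rw [e, ih fun w' hw' => h w' (List.mem_cons_of_mem _ hw'), h w List.mem_cons_self, total]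
    split_ifs <;> simp

theorem lie_rootVector_repr (h2 : (2 : F) ≠ 0) (α β γ : PosRoot X n) :
    (rootBasis X n h2).repr ⁅rootVector F α, rootVector F β⁆ γ =
      coefAt F (rootTerms X n α.cell β.cell) γ.cell := by
  rw [rootBasis_repr, coefAt_rootTerms]
  exact lie_rootMatrix_apply α β γ.1.1 γ.1.2

theorem lie_rootVector_eq_zero (h2 : (2 : F) ≠ 0) {α β : PosRoot X n}
    (h : rootTerms X n α.cell β.cell = []) : ⁅rootVector F α, rootVector F β⁆ = 0 := by
  refine (rootBasis X n h2).repr.injective (Finsupp.ext fun γ => ?_)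
  rw [lie_rootVector_repr, h, map_zero]
  rfl

theorem lie_rootVector_eq (h2 : (2 : F) ≠ 0) {α β γ : PosRoot X n} {l : List ((ℕ × ℕ) × ℤ)}
    (h : rootTerms X n α.cell β.cell = l) (hl : ∀ w ∈ l, w.1 = γ.cell) :
    ⁅rootVector F α, rootVector F β⁆ = ((total l : ℤ) : F) • rootVector F γ := by
  refine (rootBasis X n h2).repr.injective (Finsupp.ext fun δ => ?_)
  rw [lie_rootVector_repr, h, coefAt_of_forall hl, map_smul, ← rootBasis_apply h2, Basis.repr_self,
    Finsupp.smul_apply, Finsupp.single_apply]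
  simp only [PosRoot.cell_injective.eq_iff]
  split_ifs <;> simp

end Realization

end ClassicalOrbits

namespace ClassicalOrbits

open Module Matrix

attribute [local instance] LieRing.ofAssociativeRing

/-! ### Checks of the tables -/

noncomputable def sortedL {α : Type} (p : α → α → Bool) (l : List α) : Bool :=
  List.rec true (fun x l r => cond (allL (p x) l) r false) l

theorem sortedL_eq_true {α : Type} {p : α → α → Bool} {l : List α} :
    sortedL p l = true ↔ l.Pairwise fun x y => p x y = true := by
  induction l with
  | nil => simp [sortedL]
  | cons x l ih =>
    have e : sortedL p (x :: l) = cond (allL (p x) l) (sortedL p l) false := rfl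
    rw [e, List.pairwise_cons, ← ih, ← allL_eq_true]
    cases allL (p x) l <;> simp

def cellPrecedes (X : ClassicalType) (n : ℕ) (x y : ℕ × ℕ) : Bool :=
  Nat.blt (cellHeight X n x.1 x.2) (cellHeight X n y.1 y.2) ||
    (Nat.beq (cellHeight X n x.1 x.2) (cellHeight X n y.1 y.2) &&
      (Nat.blt y.1 x.1 || (Nat.beq y.1 x.1 && Nat.blt y.2 x.2)))

/-- The bracket is a multiple of a later root vector. -/
noncomputable def regularPair (X : ClassicalType) (n : ℕ) (x y : (ℕ × ℕ) × ℕ) : Bool :=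
  match rootTerms X n x.1 y.1 with
  | [] => true
  | z :: l => allL (fun w => cellEq w.1 z.1) (z :: l) && Nat.ble (total (z :: l)).natAbs 2 &&
      Nat.blt y.2 (position z.1 (cells X n))

def weightAt (X : ClassicalType) (n i k : ℕ) : ℤ :=
  match X with
  | .A => if Nat.beq k i then 1 else 0
  | _ => if Nat.beq k i then 1 else if Nat.beq k (size X n - 1 - i) then -1 else 0

def vecAt (X : ClassicalType) (n : ℕ) (x : ℕ × ℕ) (k : ℕ) : ℤ :=
  weightAt X n x.1 k - weightAt X n x.2 k

noncomputable def sumTo (f : ℕ → ℤ) (k : ℕ) : ℤ := Nat.rec 0 (fun k r => r + f k) k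

/-- Twice the sum of the fundamental coweights, up to a factor. -/
def levelCoef (X : ClassicalType) (n k : ℕ) : ℤ :=
  match X with
  | .A => ((2 * (n - k) : ℕ) : ℤ)
  | .B => ((2 * (n - k) : ℕ) : ℤ)
  | .C => ((2 * (n - k) - 1 : ℕ) : ℤ)
  | .D => ((2 * (n - 1 - k) : ℕ) : ℤ)

/-- This is twice the height, a linear function of the root with value `2` at simple roots. -/
noncomputable def level (X : ClassicalType) (n : ℕ) (x : ℕ × ℕ) : ℤ :=
  sumTo (fun k => levelCoef X n k * vecAt X n x k) (numEps X n)

/-- The coordinates of roots lie between `-2` and `2`, so the expansion in base `5` separates the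
roots. `checked` verifies that the codes differ. -/
noncomputable def vecCode (X : ClassicalType) (n : ℕ) (x : ℕ × ℕ) : ℤ :=
  sumTo (fun k => ((Nat.pow 5 k : ℕ) : ℤ) * vecAt X n x k) (numEps X n)

noncomputable def dotAt (X : ClassicalType) (n : ℕ) (x y : ℕ × ℕ) : ℤ :=
  sumTo (fun k => vecAt X n x k * vecAt X n y k) (numEps X n)

def cellAt (X : ClassicalType) (n i : ℕ) : ℕ × ℕ := (cells X n).getD i (0, 0)

def isZero (x : ℤ) : Bool := Nat.beq x.natAbs 0

noncomputable def additive (X : ClassicalType) (n : ℕ) (t : Rel) : Bool :=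
  allL (fun k => isZero (vecAt X n (cellAt X n t.k) k - (vecAt X n (cellAt X n t.i) k +
    vecAt X n (cellAt X n t.j) k))) (List.range (numEps X n))

noncomputable def closedUnder (E : List Rel) (u : ℕ) : Bool :=
  allL (fun t => !(bit u t.i || bit u t.j) || bit u t.k) E

noncomputable def simpleRelation (X : ClassicalType) (n : ℕ) (t : Rel) : Bool :=
  !(Nat.blt t.j n) || (!(isZero (dotAt X n (cellAt X n t.i) (cellAt X n t.j))) &&
    bit (upper (relations X n) t.k) t.k &&
    closedUnder (relations X n) (upper (relations X n) t.k))

/-- The first `n` roots have level `2`, too low for a sum of two positive roots; every other root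
occurs as a bracket. -/
noncomputable def simpleLevel (X : ClassicalType) (n : ℕ) (x : (ℕ × ℕ) × ℕ) : Bool :=
  Nat.ble 2 (level X n x.1).toNat && (!(Nat.blt x.2 n) || Nat.beq (level X n x.1).toNat 2) &&
    (Nat.blt x.2 n || anyL (fun t => Nat.beq t.k x.2) (relations X n))

noncomputable def simpleAdjacent (X : ClassicalType) (n : ℕ) (x y : (ℕ × ℕ) × ℕ) : Bool :=
  !(Nat.blt y.2 n) || isZero (dotAt X n x.1 y.1) ||
    anyL (fun t => Nat.beq t.i x.2 && Nat.beq t.j y.2) (relations X n)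

noncomputable def checked (X : ClassicalType) (n : ℕ) : Bool :=
  Nat.ble (size X n) ((cells X n).length + 1) && Nat.ble 2 (cells X n).length &&
  sortedL (cellPrecedes X n) (cells X n) && sortedL (regularPair X n) (numbered X n) &&
  sortedL (fun x y => !(isZero (vecCode X n x - vecCode X n y))) (cells X n) &&
  allL (additive X n) (relations X n) && allL (simpleRelation X n) (relations X n) &&
  allL (simpleLevel X n) (numbered X n) && sortedL (simpleAdjacent X n) (numbered X n) &&
  allL (fun T => Nat.blt T (Nat.pow 2 (cells X n).length)) (supports X n) &&
  sortedL (fun S T => !(Nat.beq S T)) (supports X n) &&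
  allL (fun s => Nat.blt s (Nat.pow 10 60)) (strings X n)

end ClassicalOrbits

namespace ClassicalOrbits

open Module Matrix

attribute [local instance] LieRing.ofAssociativeRing

/-! ### The enumeration of the roots and the meaning of the checks -/

section Enumeration

variable {X : ClassicalType} {n : ℕ}

theorem cellEq_eq_true {x y : ℕ × ℕ} : cellEq x y = true ↔ x = y := by
  simp [cellEq, Prod.ext_iff]

theorem position_lt {x : ℕ × ℕ} {l : List (ℕ × ℕ)} (h : x ∈ l) :
    ∃ h : position x l < l.length, l[position x l] = x := by
  induction l with
  | nil => simp at h
  | cons y l ih =>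
    by_cases hy : cellEq y x = true
    · simp only [position, hy, if_true]
      exact ⟨by simp, cellEq_eq_true.1 hy⟩
    · have hx : x ∈ l := by
        rcases List.mem_cons.1 h with rfl | h
        · exact absurd (cellEq_eq_true.2 rfl) hy
        · exact h
      obtain ⟨h1, h2⟩ := ih hx
      simp only [position, hy, if_neg, Bool.false_eq_true, not_false_eq_true]
      exact ⟨by simpa using h1, by simpa using h2⟩

theorem mem_cells {x : ℕ × ℕ} : x ∈ cells X n ↔ isCell X n x.1 x.2 = true := by
  obtain ⟨p, q⟩ := x
  simp only [cells, List.mem_flatMap, List.mem_range, List.mem_reverse, List.mem_map,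
    List.mem_filter, List.mem_cons, List.not_mem_nil, or_false, Bool.and_eq_true, Nat.beq_eq,
    Prod.mk.injEq]
  constructor
  · rintro ⟨h, -, p', -, q', ⟨-, h1, -⟩, rfl, rfl⟩
    exact h1
  · intro h
    obtain ⟨hp, hq⟩ := lt_of_isCell h
    have hpq : p < q := by
      cases X <;> simp only [isCell, Bool.and_eq_true, Nat.blt_eq] at h <;> exact h.1
    refine ⟨cellHeight X n p q, ?_, p, hp, q, ⟨?_, h, rfl⟩, rfl, rfl⟩
    · cases X <;> simp only [cellHeight] <;> first | omega | (split_ifs <;> omega)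
    · cases X <;> simp only [cellHeight] <;> first | omega | (split_ifs <;> omega)

theorem PosRoot.cell_mem (α : PosRoot X n) : α.cell ∈ cells X n := mem_cells.2 α.isCell_cell

/-- The position of a root in the list of cells. -/
def PosRoot.number (α : PosRoot X n) : ℕ := position α.cell (cells X n)

theorem PosRoot.number_lt (α : PosRoot X n) : α.number < (cells X n).length :=
  (position_lt α.cell_mem).1

theorem PosRoot.getElem_number (α : PosRoot X n) :
    (cells X n)[α.number]'α.number_lt = α.cell := (position_lt α.cell_mem).2

theorem PosRoot.cellAt_number (α : PosRoot X n) : cellAt X n α.number = α.cell := by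
  rw [cellAt, List.getD_eq_getElem _ _ α.number_lt, α.getElem_number]

theorem PosRoot.number_injective : Function.Injective (PosRoot.number : PosRoot X n → ℕ) :=
  fun α β h => PosRoot.cell_injective (by rw [← α.cellAt_number, ← β.cellAt_number, h])

/-- The consequences of the check of the tables. -/
structure Facts (X : ClassicalType) (n : ℕ) : Prop where
  size_le : size X n ≤ (cells X n).length + 1
  two_le : 2 ≤ (cells X n).length
  sorted : (cells X n).Pairwise fun x y => cellPrecedes X n x y = true
  regular : (numbered X n).Pairwise fun x y => regularPair X n x y = true
  code : (cells X n).Pairwise fun x y => (!(isZero (vecCode X n x - vecCode X n y))) = true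
  add : ∀ t ∈ relations X n, additive X n t = true
  simpleRel : ∀ t ∈ relations X n, simpleRelation X n t = true
  simpleLev : ∀ x ∈ numbered X n, simpleLevel X n x = true
  simpleAdj : (numbered X n).Pairwise fun x y => simpleAdjacent X n x y = true
  bound : ∀ T ∈ supports X n, T < 2 ^ (cells X n).length
  distinct : (supports X n).Pairwise fun S T => (!(Nat.beq S T)) = true
  length : ∀ s ∈ strings X n, s < 10 ^ 60

theorem facts_of_checked (h : checked X n = true) : Facts X n := by
  simp only [checked, Bool.and_eq_true, sortedL_eq_true, allL_eq_true] at h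
  obtain ⟨⟨⟨⟨⟨⟨⟨⟨⟨⟨⟨h1, h2⟩, h3⟩, h4⟩, h5⟩, h6⟩, h7⟩, h8⟩, h9⟩, h10⟩, h11⟩, h12⟩ := h
  exact ⟨Nat.le_of_ble_eq_true h1, Nat.le_of_ble_eq_true h2, h3, h4, h5, h6, h7, h8, h9,
    fun T hT => Nat.le_of_ble_eq_true (h10 T hT), h11,
    fun s hs => Nat.le_of_ble_eq_true (h12 s hs)⟩

/-- The second alternative is excluded once the list of cells is known to have no repetitions. -/
theorem mem_numbered {x : (ℕ × ℕ) × ℕ} :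
    x ∈ numbered X n ↔ ∃ α : PosRoot X n, x = (α.cell, α.number) ∨
      (cells X n)[x.2]? = some x.1 ∧ x.2 ≠ α.number ∧ x.1 = α.cell := by
  rw [numbered, List.mem_zipIdx_iff_getElem?]
  constructor
  · intro h
    have hm : x.1 ∈ cells X n := List.mem_of_getElem? h
    obtain ⟨α, hα⟩ := exists_cell_eq (mem_cells.1 hm)
    by_cases hx : x.2 = α.number
    · exact ⟨α, Or.inl (Prod.ext hα.symm hx)⟩
    · exact ⟨α, Or.inr ⟨h, hx, hα.symm⟩⟩
  · rintro ⟨α, rfl | h⟩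
    · simp only
      rw [List.getElem?_eq_getElem α.number_lt, α.getElem_number]
    · exact h.1

theorem pairwise_numbered {p : (ℕ × ℕ) × ℕ → (ℕ × ℕ) × ℕ → Prop}
    (hp : (numbered X n).Pairwise p) {α β : PosRoot X n} (hαβ : α.number < β.number) :
    p (α.cell, α.number) (β.cell, β.number) := by
  have e : ∀ γ : PosRoot X n, ∃ hγ : γ.number < (numbered X n).length,
      (numbered X n)[γ.number] = (γ.cell, γ.number) := fun γ => by
    have h1 : γ.number < (numbered X n).length := by simpa [numbered] using γ.number_lt
    refine ⟨h1, ?_⟩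
    simp only [numbered, List.getElem_zipIdx, γ.getElem_number, zero_add]
  obtain ⟨h1, e1⟩ := e α
  obtain ⟨h2, e2⟩ := e β
  have := List.pairwise_iff_getElem.1 hp _ _ h1 h2 hαβ
  rwa [e1, e2] at this

theorem pairwise_cells {p : ℕ × ℕ → ℕ × ℕ → Prop}
    (hp : (cells X n).Pairwise p) {α β : PosRoot X n} (hαβ : α.number < β.number) :
    p α.cell β.cell := by
  have := List.pairwise_iff_getElem.1 hp _ _ α.number_lt β.number_lt hαβ
  rwa [α.getElem_number, β.getElem_number] at this

theorem cellPrecedes_irrefl (x : ℕ × ℕ) : cellPrecedes X n x x = false := by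
  rw [Bool.eq_false_iff]
  simp [cellPrecedes, Nat.blt_eq]

theorem cellPrecedes_asymm {x y : ℕ × ℕ} (h : cellPrecedes X n x y = true) :
    cellPrecedes X n y x = false := by
  rw [Bool.eq_false_iff]
  simp only [cellPrecedes, Bool.or_eq_true, Bool.and_eq_true, Nat.blt_eq, Nat.beq_eq, ne_eq] at h ⊢
  omega

namespace Facts

theorem nodup (h : Facts X n) : (cells X n).Nodup := h.sorted.imp fun hxy e => by
  subst e
  rw [cellPrecedes_irrefl] at hxy
  exact absurd hxy (by simp)

theorem exists_number (h : Facts X n) {i : ℕ} (hi : i < (cells X n).length) :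
    ∃ α : PosRoot X n, α.number = i ∧ α.cell = (cells X n)[i] := by
  obtain ⟨α, hα⟩ := exists_cell_eq (mem_cells.1 (List.getElem_mem hi))
  refine ⟨α, ?_, hα⟩
  have := α.getElem_number
  rw [hα] at this
  exact (h.nodup.getElem_inj_iff).1 this

theorem mem_numbered_iff (h : Facts X n) {x : (ℕ × ℕ) × ℕ} :
    x ∈ numbered X n ↔ ∃ α : PosRoot X n, x = (α.cell, α.number) := by
  rw [mem_numbered]
  constructor
  · rintro ⟨α, hα | ⟨h1, h2, h3⟩⟩
    · exact ⟨α, hα⟩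
    · obtain ⟨hi, e⟩ := List.getElem?_eq_some_iff.1 h1
      refine absurd ?_ h2
      have := α.getElem_number
      rw [← h3, ← e] at this
      exact ((h.nodup.getElem_inj_iff).1 this).symm
  · rintro ⟨α, rfl⟩
    exact ⟨α, Or.inl rfl⟩

theorem precedes_iff (h : Facts X n) (β α : PosRoot X n) :
    β.Precedes α ↔ β.number < α.number := by
  have e : β.Precedes α ↔ cellPrecedes X n β.cell α.cell = true := by
    have hh : ∀ γ : PosRoot X n, γ.height = cellHeight X n γ.cell.1 γ.cell.2 := fun γ => by
      cases X with
      | D => simp [PosRoot.height, cellHeight, PosRoot.cell, Nat.ble_eq]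
      | _ => rfl
    simp only [PosRoot.Precedes, hh, cellPrecedes, Bool.or_eq_true, Bool.and_eq_true, Nat.blt_eq,
      Nat.beq_eq, PosRoot.cell, Fin.lt_def, Fin.ext_iff, eq_comm (a := (α.1.1 : ℕ))]
  rw [e]
  refine ⟨fun hp => ?_, fun hlt => pairwise_cells h.sorted hlt⟩
  by_contra hc
  rcases (not_lt.1 hc).lt_or_eq with hlt | heq
  · have := cellPrecedes_asymm (pairwise_cells h.sorted hlt)
    rw [hp] at this
    exact absurd this (by simp)
  · obtain rfl := PosRoot.number_injective heq
    rw [cellPrecedes_irrefl] at hp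
    exact absurd hp (by simp)

/-- The list of cells is sorted by the order of the enumeration, so the predecessors of a root are
the roots with smaller numbers. -/
theorem index_eq (h : Facts X n) (α : PosRoot X n) : α.index = α.number := by
  rw [PosRoot.index, ← Finset.card_range α.number]
  refine Finset.card_bij (fun β _ => β.number) (fun β hβ => ?_) (fun β _ γ _ hβγ =>
    PosRoot.number_injective hβγ) fun i hi => ?_
  · rw [Finset.mem_range, ← h.precedes_iff]
    simpa using hβ
  · rw [Finset.mem_range] at hi
    obtain ⟨β, rfl, -⟩ := h.exists_number (hi.trans α.number_lt)
    exact ⟨β, by simpa [h.precedes_iff] using hi, rfl⟩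

theorem card_posRoot (h : Facts X n) : Fintype.card (PosRoot X n) = (cells X n).length := by
  rw [← Finset.card_univ, ← Finset.card_range (cells X n).length]
  refine Finset.card_bij (fun β _ => β.number) (fun β _ => Finset.mem_range.2 β.number_lt)
    (fun β _ γ _ hβγ => PosRoot.number_injective hβγ) fun i hi => ?_
  obtain ⟨β, rfl, -⟩ := h.exists_number (Finset.mem_range.1 hi)
  exact ⟨β, Finset.mem_univ _, rfl⟩

end Facts

/-! ### Roots as vectors -/

theorem sumTo_eq (f : ℕ → ℤ) (k : ℕ) : sumTo f k = ∑ i : Fin k, f i.val := by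
  rw [Fin.sum_univ_eq_sum_range]
  induction k with
  | zero => rfl
  | succ k ih =>
    rw [Finset.sum_range_succ, ← ih]
    rfl

theorem vec_eq (α : PosRoot X n) (k : Fin (numEps X n)) : α.vec k = vecAt X n α.cell k := by
  have e : ∀ i : Fin (size X n), weight X n i k = weightAt X n i k := fun i => by
    have hi := i.2
    have hrev : size X n - 1 - i.val = i.rev.val := by rw [Fin.val_rev]; omega
    cases X with
    | A => simp [weight, weightAt]
    | B => simp only [weight, weightAt, hrev, Nat.beq_eq]
    | C => simp only [weight, weightAt, hrev, Nat.beq_eq]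
    | D => simp only [weight, weightAt, hrev, Nat.beq_eq]
  simp [PosRoot.vec, vecAt, e, PosRoot.cell]

theorem isZero_eq_true {x : ℤ} : isZero x = true ↔ x = 0 := by
  simp [isZero]

theorem dotAt_eq (α β : PosRoot X n) : dotAt X n α.cell β.cell = α.vec ⬝ᵥ β.vec := by
  rw [dotAt, sumTo_eq]
  exact Finset.sum_congr rfl fun k _ => by rw [vec_eq, vec_eq]

theorem vec_injective (h : Facts X n) {α β : PosRoot X n} (hv : α.vec = β.vec) : α = β := by
  have hc : vecCode X n α.cell = vecCode X n β.cell := by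
    rw [vecCode, vecCode, sumTo_eq, sumTo_eq]
    exact Finset.sum_congr rfl fun k _ => by rw [← vec_eq, ← vec_eq, hv]
  have key : ∀ {α β : PosRoot X n}, vecCode X n α.cell = vecCode X n β.cell →
      ¬ α.number < β.number := fun {α β} hc hlt => by
    have := pairwise_cells h.code hlt
    rw [hc, sub_self] at this
    simp [isZero] at this
  exact PosRoot.number_injective (le_antisymm (not_lt.1 (key hc.symm)) (not_lt.1 (key hc)))

theorem level_eq (α : PosRoot X n) :
    level X n α.cell = ∑ k : Fin (numEps X n), levelCoef X n k * α.vec k := by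
  rw [level, sumTo_eq]
  exact Finset.sum_congr rfl fun k _ => by rw [vec_eq]

theorem level_add {α β γ : PosRoot X n} (h : α.vec = β.vec + γ.vec) :
    level X n α.cell = level X n β.cell + level X n γ.cell := by
  rw [level_eq, level_eq, level_eq, h, ← Finset.sum_add_distrib]
  exact Finset.sum_congr rfl fun k _ => by rw [Pi.add_apply, mul_add]

theorem vec_add_of_additive {t : Rel} {α β γ : PosRoot X n} (hα : α.number = t.i)
    (hβ : β.number = t.j) (hγ : γ.number = t.k) (h : additive X n t = true) :
    γ.vec = α.vec + β.vec := by
  funext k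
  have := allL_eq_true.1 h k.val (List.mem_range.2 k.2)
  rw [isZero_eq_true, ← hα, ← hβ, ← hγ, α.cellAt_number, β.cellAt_number, γ.cellAt_number,
    ← vec_eq, ← vec_eq, ← vec_eq] at this
  rw [Pi.add_apply]
  omega

/-! ### The table of brackets -/

theorem mem_relations (h : Facts X n) {t : Rel} : t ∈ relations X n ↔ ∃ α β : PosRoot X n,
    α.number < β.number ∧ ∃ z l, rootTerms X n α.cell β.cell = z :: l ∧ total (z :: l) ≠ 0 ∧
      t = ⟨α.number, β.number, position z.1 (cells X n), total (z :: l)⟩ := by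
  simp only [relations, List.mem_flatMap, List.mem_reverse, List.mem_filter]
  constructor
  · rintro ⟨y, hy, x, ⟨hx, hxy⟩, ht⟩
    obtain ⟨β, rfl⟩ := h.mem_numbered_iff.1 hy
    obtain ⟨α, rfl⟩ := h.mem_numbered_iff.1 hx
    refine ⟨α, β, by simpa using hxy, ?_⟩
    simp only at ht
    split at ht
    · simp at ht
    · rename_i z l hzl
      split_ifs at ht with h0
      · simp at ht
      · exact ⟨z, l, hzl, h0, by simpa using ht⟩
  · rintro ⟨α, β, hαβ, z, l, hzl, h0, rfl⟩
    refine ⟨_, h.mem_numbered_iff.2 ⟨β, rfl⟩, _, ⟨h.mem_numbered_iff.2 ⟨α, rfl⟩, by simpa using hαβ⟩,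
      ?_⟩
    simp only [hzl, if_neg h0, List.mem_singleton]

variable {F : Type*} [Field F]

/-- `regularPair` has checked that all terms lie in one root cell, after both factors, with total
coefficient at most `2` in absolute value. -/
theorem rootTerms_spec (h : Facts X n) (h2 : (2 : F) ≠ 0) {α β : PosRoot X n}
    (hαβ : α.number < β.number) {z : (ℕ × ℕ) × ℤ} {l : List ((ℕ × ℕ) × ℤ)}
    (hzl : rootTerms X n α.cell β.cell = z :: l) : ∃ γ : PosRoot X n, γ.cell = z.1 ∧
      β.number < γ.number ∧ (total (z :: l)).natAbs ≤ 2 ∧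
      ⁅rootVector F α, rootVector F β⁆ = ((total (z :: l) : ℤ) : F) • rootVector F γ := by
  have hreg := pairwise_numbered h.regular hαβ
  rw [regularPair] at hreg
  simp only [hzl] at hreg
  rw [Bool.and_eq_true, Bool.and_eq_true, allL_eq_true] at hreg
  obtain ⟨⟨h1, h3⟩, h4⟩ := hreg
  have hz : isCell X n z.1.1 z.1.2 = true := by
    have : z ∈ rootTerms X n α.cell β.cell := by rw [hzl]; exact List.mem_cons_self
    rw [rootTerms, List.mem_filter, Bool.and_eq_true] at this
    exact this.2.1
  obtain ⟨γ, hγ⟩ := exists_cell_eq hz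
  refine ⟨γ, hγ, ?_, Nat.le_of_ble_eq_true h3, lie_rootVector_eq h2 hzl fun w hw => ?_⟩
  · have e : γ.number = position z.1 (cells X n) := by rw [PosRoot.number, hγ]
    rw [e]
    exact Nat.le_of_ble_eq_true h4
  · rw [hγ]
    exact cellEq_eq_true.1 (h1 w hw)

theorem intCast_ne_zero (h2 : (2 : F) ≠ 0) {x : ℤ} (h0 : x ≠ 0) (hx : x.natAbs ≤ 2) :
    (x : F) ≠ 0 := by
  have : x = 1 ∨ x = -1 ∨ x = 2 ∨ x = -2 := by omega
  rcases this with rfl | rfl | rfl | rfl <;> simp [h2]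

theorem relation_spec (h : Facts X n) (h2 : (2 : F) ≠ 0) {t : Rel} (ht : t ∈ relations X n) :
    ∃ α β γ : PosRoot X n, α.number = t.i ∧ β.number = t.j ∧ γ.number = t.k ∧ t.i < t.j ∧
      t.j < t.k ∧ (t.c : F) ≠ 0 ∧
      ⁅rootVector F α, rootVector F β⁆ = (t.c : F) • rootVector F γ := by
  obtain ⟨α, β, hαβ, z, l, hzl, h0, rfl⟩ := (mem_relations h).1 ht
  obtain ⟨γ, hγ, h1, h3, h4⟩ := rootTerms_spec h h2 hαβ hzl
  have hγ' : position z.1 (cells X n) = γ.number := by rw [PosRoot.number, hγ]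
  exact ⟨α, β, γ, rfl, rfl, hγ'.symm, hαβ, hγ' ▸ h1, intCast_ne_zero h2 h0 h3, h4⟩

theorem lie_eq_zero_or (h : Facts X n) (h2 : (2 : F) ≠ 0) {α β : PosRoot X n}
    (hαβ : α.number < β.number) : ⁅rootVector F α, rootVector F β⁆ = 0 ∨
      ∃ t ∈ relations X n, t.i = α.number ∧ t.j = β.number := by
  cases hzl : rootTerms X n α.cell β.cell with
  | nil => exact Or.inl (lie_rootVector_eq_zero h2 hzl)
  | cons z l =>
    by_cases h0 : total (z :: l) = 0
    · obtain ⟨γ, -, -, -, h4⟩ := rootTerms_spec (F := F) h h2 hαβ hzl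
      left
      rw [h4, h0, Int.cast_zero, zero_smul]
    · exact Or.inr ⟨_, (mem_relations h).2 ⟨α, β, hαβ, z, l, hzl, h0, rfl⟩, rfl, rfl⟩

theorem isFlag_rootBasis (h : Facts X n) (h2 : (2 : F) ≠ 0) :
    IsFlag (rootBasis X n h2) (PosRoot.number : PosRoot X n → ℕ) := by
  refine ⟨PosRoot.number_injective, fun α β γ hne => ?_⟩
  rw [rootBasis_apply, rootBasis_apply] at hne
  have key : ∀ {α β : PosRoot X n}, α.number < β.number →
      (rootBasis X n h2).repr ⁅rootVector F α, rootVector F β⁆ γ ≠ 0 → β.number < γ.number := by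
    intro α β hαβ hne
    rcases lie_eq_zero_or h h2 hαβ with h0 | ⟨t, ht, hti, htj⟩
    · simp [h0] at hne
    · obtain ⟨α', β', γ', h3, h4, h5, -, h6, -, h7⟩ := relation_spec h h2 ht
      obtain rfl := PosRoot.number_injective (h3.trans hti)
      obtain rfl := PosRoot.number_injective (h4.trans htj)
      rw [h7, map_smul, ← rootBasis_apply h2, Basis.repr_self, Finsupp.smul_apply,
        Finsupp.single_apply] at hne
      have : γ' = γ := by
        by_contra hc
        simp [hc] at hne
      subst this
      omega
  rcases lt_trichotomy α.number β.number with hlt | heq | hlt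
  · exact key hlt hne
  · obtain rfl := PosRoot.number_injective heq
    simp at hne
  · refine hlt.trans (key hlt ?_)
    rw [← lie_skew, map_neg, Finsupp.neg_apply]
    exact neg_ne_zero.2 hne

/-- The `i`-th root vector. -/
noncomputable def vectorAt (F : Type*) [Field F] (X : ClassicalType) (n i : ℕ) :
    nilradical F X n :=
  open Classical in if h : ∃ α : PosRoot X n, α.number = i then rootVector F h.choose else 0

theorem vectorAt_number (α : PosRoot X n) : vectorAt F X n α.number = rootVector F α := by
  have h : ∃ β : PosRoot X n, β.number = α.number := ⟨α, rfl⟩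
  rw [vectorAt, dif_pos h, PosRoot.number_injective h.choose_spec]

theorem span_vectorAt (h2 : (2 : F) ≠ 0) :
    Submodule.span F (vectorAt F X n '' Set.Iio (cells X n).length) = ⊤ := by
  rw [eq_top_iff, ← (rootBasis X n h2).span_eq]
  refine Submodule.span_mono ?_
  rintro _ ⟨α, rfl⟩
  exact ⟨α.number, α.number_lt, by rw [vectorAt_number, rootBasis_apply]⟩

theorem mask_full (R : ℕ) : mask (2 ^ R - 1) = Set.Iio R := by
  ext i
  rw [mem_mask, bit_eq, Nat.testBit_two_pow_sub_one]
  simp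

/-- At the start nothing is decided: the subalgebra is everything, the ideal is zero and no pair has
been removed. -/
theorem reduced_initial (h : Facts X n) (h2 : (2 : F) ≠ 0) :
    Reduced F (vectorAt F X n) (cells X n).length (Set.Iio (cells X n).length)
      (mask (2 ^ (cells X n).length - 1)) (mask 0) (relations X n) 0 := by
  rw [mask_full, mask_zero]
  refine ⟨Set.empty_subset _, subset_rfl, subset_rfl, fun t ht => ?_, fun t ht => ?_,
    fun i hi j hj hij => ?_, fun f _ => ⟨f, orbit_refl f, fun _ _ => rfl,
    fun i hi hi' => absurd hi hi'⟩, fun f _ m hm => ?_, ?_⟩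
  · obtain ⟨α, β, γ, h3, h4, h5, -, -, h6, h7⟩ := relation_spec h h2 ht
    rw [← h3, ← h4, ← h5, vectorAt_number, vectorAt_number, vectorAt_number]
    exact ⟨h7, h6⟩
  · obtain ⟨α, β, γ, h3, h4, h5, h6, -, -, -⟩ := relation_spec h h2 ht
    rw [Set.sdiff_empty]
    exact ⟨h3 ▸ α.number_lt, h4 ▸ β.number_lt, h5 ▸ γ.number_lt, h6.ne⟩
  · obtain ⟨α, rfl, -⟩ := h.exists_number hi
    obtain ⟨β, rfl, -⟩ := h.exists_number hj
    have key : ⁅vectorAt F X n α.number, vectorAt F X n β.number⁆ = 0 := by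
      rw [vectorAt_number, vectorAt_number]
      rcases lt_trichotomy α.number β.number with hlt | heq | hlt
      · refine (lie_eq_zero_or h h2 hlt).resolve_right ?_
        rintro ⟨t, ht, hti, htj⟩
        have := hij t ht
        rw [Bool.eq_false_iff, ne_eq, Rel.joins_iff] at this
        exact this (Or.inl ⟨hti, htj⟩)
      · obtain rfl := PosRoot.number_injective heq
        exact lie_self _
      · rw [← lie_skew, neg_eq_zero]
        refine (lie_eq_zero_or h h2 hlt).resolve_right ?_
        rintro ⟨t, ht, hti, htj⟩
        have := hij t ht
        rw [Bool.eq_false_iff, ne_eq, Rel.joins_iff] at this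
        exact this (Or.inr ⟨hti, htj⟩)
    rw [key]
    exact zero_mem _
  · obtain ⟨W, -, h3, h4⟩ := hm
    exact ⟨W, le_top, h3, h4⟩
  · rw [span_vectorAt h2, finrank_top, add_zero]

end Enumeration

/-! ### Consequences of the assumption on the characteristic -/

section Characteristic

variable {F : Type*} [Field F] {X : ClassicalType} {n : ℕ}

/-- The assumption on the characteristic involves the dimension of `𝔤`; the factorials to be
inverted are bounded by the number of positive roots. -/
theorem card_posRoot_le : Fintype.card (PosRoot X n) ≤ finrank F (simpleLie F X n) := by
  have : LinearIndependent F fun α : PosRoot X n =>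
      (⟨rootMatrix F α, (rootMatrix_mem F α).2⟩ : simpleLie F X n) := by
    rw [Fintype.linearIndependent_iff]
    intro c hc β
    have h1 := congrArg (fun x : simpleLie F X n => x.1 β.1.1 β.1.2) hc
    change (simpleLie F X n).subtype _ β.1.1 β.1.2 = 0 at h1
    rw [map_sum, Matrix.sum_apply] at h1
    have : ∀ α, (simpleLie F X n).subtype (c α •
        (⟨rootMatrix F α, (rootMatrix_mem F α).2⟩ : simpleLie F X n)) β.1.1 β.1.2 =
        c α * if α = β then 1 else 0 := fun α => by
      rw [← rootMatrix_apply (F := F)]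
      rfl
    rw [Finset.sum_congr rfl fun α _ => this α] at h1
    simpa using h1
  exact this.fintype_card_le_finrank

theorem natCast_ne_zero (h : Facts X n)
    (hF : ringChar F = 0 ∨ finrank F (simpleLie F X n) < ringChar F) {k : ℕ} (hk0 : k ≠ 0)
    (hk : k ≤ (cells X n).length) : (k : F) ≠ 0 := by
  rw [ne_eq, ringChar.spec]
  intro hd
  rcases hF with hF | hF
  · rw [hF, zero_dvd_iff] at hd
    exact hk0 hd
  · have h1 := Nat.le_of_dvd (Nat.pos_of_ne_zero hk0) hd
    have h2 := card_posRoot_le (F := F) (X := X) (n := n)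
    rw [h.card_posRoot] at h2
    omega

theorem two_ne_zero' (h : Facts X n)
    (hF : ringChar F = 0 ∨ finrank F (simpleLie F X n) < ringChar F) : (2 : F) ≠ 0 := by
  exact_mod_cast natCast_ne_zero h hF two_ne_zero h.two_le

theorem factorial_ne_zero (h : Facts X n)
    (hF : ringChar F = 0 ∨ finrank F (simpleLie F X n) < ringChar F) {k : ℕ}
    (hk : k ≤ (cells X n).length) : (Nat.factorial k : F) ≠ 0 := by
  induction k with
  | zero => simp
  | succ k ih =>
    rw [Nat.factorial_succ, Nat.cast_mul]
    exact mul_ne_zero (natCast_ne_zero h hF k.succ_ne_zero hk) (ih (by omega))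

theorem expGroup_of_facts (h : Facts X n)
    (hF : ringChar F = 0 ∨ finrank F (simpleLie F X n) < ringChar F) :
    ExpGroup F (nilradical F X n) := by
  have h2 := two_ne_zero' h hF
  have h3 : finrank F (nilradical F X n) = (cells X n).length := by
    rw [finrank_nilradical h2, h.card_posRoot]
  have h4 := h.two_le
  have h5 := h.size_le
  refine expGroup_nilradical h2 ?_ (fun k hk => factorial_ne_zero h hF (by omega)) (by omega)
    (by omega)
  obtain ⟨α, -⟩ := h.exists_number (i := 0) (by omega)
  have h6 := α.1.1.2
  have h7 := α.1.2.2
  have h8 := α.isCell_cell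
  have : α.1.1.val < α.1.2.val := by
    cases X <;> simp only [isCell, PosRoot.cell, Bool.and_eq_true, Nat.blt_eq] at h8 <;> exact h8.1
  omega

theorem orbitDim_eq [IsAlgClosed F] (h : Facts X n)
    (hF : ringChar F = 0 ∨ finrank F (simpleLie F X n) < ringChar F)
    (f : Dual F (nilradical F X n)) : orbitDim f = (kirillovRank f : WithBot ℕ∞) := by
  have h2 := two_ne_zero' h hF
  have : Infinite F := IsAlgClosed.instInfinite
  rw [← zariskiDim_orbit (expGroup_of_facts h hF) (isFlag_rootBasis h h2) f, orbitDim]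
  congr 2
  funext f' α
  rw [rootBasis_apply]
  rfl

end Characteristic

end ClassicalOrbits

namespace ClassicalOrbits

open Module Matrix

attribute [local instance] LieRing.ofAssociativeRing

/-! ### Nonzero values along an orbit -/

section Reach

variable {F : Type*} [Field F] {L : Type*} [LieRing L] [LieAlgebra F L]

/-- The value at `y` along `exp (s • x)` is a polynomial in `s` with linear coefficient `f ⁅x, y⁆`.
It is nonzero, so over an infinite field it has a nonzero value. -/
theorem exists_orbit_ne_zero [Infinite F] (hG : ExpGroup F L) {f : Dual F L} {x y : L}
    (h : f ⁅x, y⁆ ≠ 0) : ∃ f' ∈ coadjointOrbit f, f' y ≠ 0 := by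
  let p : Polynomial F := ∑ k ∈ Finset.range (finrank F L),
    Polynomial.monomial k (((Nat.factorial k : F)⁻¹) * f ((LieAlgebra.ad F L x ^ k) y))
  have hp : p ≠ 0 := fun h0 => by
    have h1 : p.coeff 1 = f ⁅x, y⁆ := by
      simp only [p, Polynomial.finsetSum_coeff, Polynomial.coeff_monomial]
      rw [Finset.sum_ite_eq' (Finset.range _) 1, if_pos (Finset.mem_range.2 hG.two_le)]
      simp
    rw [h0, Polynomial.coeff_zero] at h1
    exact h h1.symm
  obtain ⟨s, hs⟩ : ∃ s, p.eval s ≠ 0 := by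
    by_contra! hc
    exact hp (Polynomial.funext fun s => by rw [hc s, Polynomial.eval_zero])
  refine ⟨f ∘ₗ expAd F (s • x), hG.comp_expAd_mem f _, ?_⟩
  have e : f (expAd F (s • x) y) = p.eval s := by
    rw [expAd_apply, map_sum, Polynomial.eval_finsetSum]
    refine Finset.sum_congr rfl fun k _ => ?_
    rw [map_smul, map_smul, smul_pow, LinearMap.smul_apply, map_smul, Polynomial.eval_monomial,
      smul_eq_mul, smul_eq_mul]
    ring
  rwa [LinearMap.comp_apply, e]

/-- The construction of `upper` is traced back: a nonzero value at a bracket can be moved to the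
factor that was already in the set, and so on down to `k`. -/
theorem exists_orbit_of_upper [Infinite F] (hG : ExpGroup F L) {v : ℕ → L} {E : List Rel}
    (hE : ∀ t ∈ E, (t.c : F) ≠ 0 ∧ ⁅v t.i, v t.j⁆ = (t.c : F) • v t.k) {k : ℕ} :
    ∀ i ∈ mask (upper E k), ∀ f : Dual F L, f (v i) ≠ 0 →
      ∃ f' ∈ coadjointOrbit f, f' (v k) ≠ 0 := by
  induction E with
  | nil =>
    intro i hi f hf
    have : i = k := by
      have e : mask (upper [] k) = mask (Nat.lor 0 (Nat.pow 2 k)) := by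
        congr 1
        exact (Nat.zero_or _).symm
      rw [e, mask_lor_pow, mask_zero] at hi
      simpa using hi
    exact ⟨f, orbit_refl f, this ▸ hf⟩
  | cons t E ih =>
    intro i hi f hf
    have ih' := ih fun t ht => hE t (List.mem_cons_of_mem _ ht)
    have e : upper (t :: E) k = if bit (upper E k) t.i || bit (upper E k) t.j then
      Nat.lor (upper E k) (Nat.pow 2 t.k) else upper E k := rfl
    rw [e] at hi
    split_ifs at hi with hb
    · rw [mask_lor_pow, Set.mem_insert_iff] at hi
      rcases hi with rfl | hi
      · obtain ⟨hc, hl⟩ := hE t List.mem_cons_self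
        have hne : f ⁅v t.i, v t.j⁆ ≠ 0 := by
          rw [hl, map_smul]
          exact smul_ne_zero hc hf
        have step : ∃ j ∈ mask (upper E k), ∃ f' ∈ coadjointOrbit f, f' (v j) ≠ 0 := by
          rcases (Bool.or_eq_true _ _).mp hb with hb | hb
          · refine ⟨t.i, hb, exists_orbit_ne_zero hG (x := v t.j) ?_⟩
            rw [← lie_skew, map_neg]
            exact neg_ne_zero.2 hne
          · exact ⟨t.j, hb, exists_orbit_ne_zero hG hne⟩
        obtain ⟨j, hj, f', hf', hne'⟩ := step
        obtain ⟨f'', hf'', h⟩ := ih' j hj f' hne'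
        exact ⟨f'', orbit_trans hf' hf'', h⟩
      · exact ih' i hi f hf
    · exact ih' i hi f hf

end Reach

/-! ### Extensiveness as a condition on the support -/

section Extensive

variable {F : Type*} [Field F] {X : ClassicalType} {n : ℕ}

theorem vectorAt_eq_zero {i : ℕ} (h : ∀ α : PosRoot X n, α.number ≠ i) : vectorAt F X n i = 0 := by
  rw [vectorAt, dif_neg]
  rintro ⟨α, hα⟩
  exact h α hα

/-- Hence a set of roots closed under the table spans an ideal. -/
theorem lie_mem_of_closed (h : Facts X n) (h2 : (2 : F) ≠ 0) {u : ℕ}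
    (hu : closedUnder (relations X n) u = true) (x : nilradical F X n) {y : nilradical F X n}
    (hy : y ∈ Submodule.span F (vectorAt F X n '' mask u)) :
    ⁅x, y⁆ ∈ Submodule.span F (vectorAt F X n '' mask u) := by
  refine lie_mem_of_span (A := Set.Iio (cells X n).length) (B := mask u) (fun i hi j hj => ?_)
    (by rw [span_vectorAt h2]; trivial) hy
  obtain ⟨α, rfl, -⟩ := h.exists_number hi
  by_cases hβ : ∃ β : PosRoot X n, β.number = j
  · obtain ⟨β, rfl⟩ := hβ
    have key : ∀ {α β : PosRoot X n}, α.number < β.number →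
        (α.number ∈ mask u ∨ β.number ∈ mask u) → ⁅rootVector F α, rootVector F β⁆ ∈
          Submodule.span F (vectorAt F X n '' mask u) := by
      intro α β hαβ hm
      rcases lie_eq_zero_or h h2 hαβ with h0 | ⟨t, ht, hti, htj⟩
      · rw [h0]
        exact zero_mem _
      · obtain ⟨α', β', γ, h3, h4, h5, -, -, -, h7⟩ := relation_spec h h2 ht
        obtain rfl := PosRoot.number_injective (h3.trans hti)
        obtain rfl := PosRoot.number_injective (h4.trans htj)
        rw [h7]
        refine Submodule.smul_mem _ _ (Submodule.subset_span ⟨γ.number, ?_, vectorAt_number γ⟩)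
        have := allL_eq_true.1 hu t ht
        rw [mem_mask, mem_mask, ← hti, ← htj] at hm
        rw [mem_mask, h5]
        rcases hm with hm | hm <;> simpa [hm] using this
    rw [vectorAt_number, vectorAt_number]
    rcases lt_trichotomy α.number β.number with hlt | heq | hlt
    · exact key hlt (Or.inr hj)
    · obtain rfl := PosRoot.number_injective heq
      rw [lie_self]
      exact zero_mem _
    · rw [← lie_skew]
      exact neg_mem (key hlt (Or.inl hj))
  · rw [vectorAt_eq_zero (F := F) (i := j) fun β hβ' => hβ ⟨β, hβ'⟩, lie_zero]
    exact zero_mem _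

theorem mem_nsupp {f : Dual F (nilradical F X n)} {γ : PosRoot X n} :
    γ ∈ nsupp f ↔ ∃ f' ∈ coadjointOrbit f, f' (rootVector F γ) ≠ 0 := by
  simp [nsupp, supp]

/-- The set `upper` spans an ideal that contains `e_γ`; if `f` vanishes on it, then the whole orbit
vanishes at `e_γ`. The converse is `exists_orbit_of_upper`. -/
theorem mem_nsupp_iff [Infinite F] (h : Facts X n) (h2 : (2 : F) ≠ 0)
    (hG : ExpGroup F (nilradical F X n)) {f : Dual F (nilradical F X n)} {γ : PosRoot X n}
    (hγ : bit (upper (relations X n) γ.number) γ.number = true)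
    (hu : closedUnder (relations X n) (upper (relations X n) γ.number) = true) :
    γ ∈ nsupp f ↔ ∃ i < (cells X n).length, i ∈ mask (upper (relations X n) γ.number) ∧
      f (vectorAt F X n i) ≠ 0 := by
  rw [mem_nsupp]
  constructor
  · rintro ⟨f', hf', hne⟩
    by_contra! hc
    obtain ⟨x, rfl⟩ := hG.mem_orbit_iff.1 hf'
    refine hne ?_
    have hm := expAd_mem_of_stable (F := F) (x := x) (fun q => lie_mem_of_closed h h2 hu x)
      (Submodule.subset_span ⟨γ.number, hγ, vectorAt_number γ⟩)
    have hle : Submodule.span F (vectorAt F X n '' mask (upper (relations X n) γ.number)) ≤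
        LinearMap.ker f := by
      rw [Submodule.span_le]
      rintro _ ⟨i, hi, rfl⟩
      by_cases hβ : ∃ β : PosRoot X n, β.number = i
      · obtain ⟨β, rfl⟩ := hβ
        exact hc _ β.number_lt hi
      · rw [vectorAt_eq_zero (F := F) (i := i) fun β hβ' => hβ ⟨β, hβ'⟩]
        exact zero_mem _
    exact hle hm
  · rintro ⟨i, -, hi, hne⟩
    rw [← vectorAt_number (F := F) γ]
    refine exists_orbit_of_upper hG (fun t ht => ?_) i hi f hne
    obtain ⟨α, β, γ, h3, h4, h5, -, -, h6, h7⟩ := relation_spec h h2 ht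
    rw [← h3, ← h4, ← h5, vectorAt_number, vectorAt_number, vectorAt_number]
    exact ⟨h6, h7⟩

/-- Positive roots have level at least `2`, so sums have level at least `4`, while the first `n`
roots have level `2`. The others are brackets, hence sums. -/
theorem isSimpleRoot_iff (h : Facts X n) (h2 : (2 : F) ≠ 0) (α : PosRoot X n) :
    IsSimpleRoot α ↔ α.number < n := by
  have lev : ∀ β : PosRoot X n, simpleLevel X n (β.cell, β.number) = true := fun β =>
    h.simpleLev _ (h.mem_numbered_iff.2 ⟨β, rfl⟩)
  have lev2 : ∀ β : PosRoot X n, 2 ≤ level X n β.cell := fun β => by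
    have := lev β
    simp only [simpleLevel, Bool.and_eq_true] at this
    have := Nat.le_of_ble_eq_true this.1.1
    omega
  have hα := lev α
  simp only [simpleLevel, Bool.and_eq_true, Bool.or_eq_true, Bool.not_eq_true',
    anyL_eq_true, Nat.beq_eq] at hα
  obtain ⟨⟨-, h3⟩, h4⟩ := hα
  constructor
  · intro hs
    by_contra hn
    obtain ⟨t, ht, htk⟩ := h4.resolve_left fun hb => hn (Nat.le_of_ble_eq_true hb)
    obtain ⟨β, γ, δ, h5, h6, h7, -⟩ := relation_spec h h2 ht
    obtain rfl := PosRoot.number_injective (h7.trans htk)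
    exact hs ⟨β, γ, vec_add_of_additive h5 h6 h7 (h.add t ht)⟩
  · rintro hn ⟨β, γ, hv⟩
    have h5 := h3.resolve_left (by
      rw [Bool.not_eq_false]
      exact Nat.ble_eq_true_of_le hn)
    have h6 := level_add hv
    have := lev2 β
    have := lev2 γ
    omega

/-- Adjacent pairs of simple roots correspond to the table entries with `t.j < n`, and
`mem_nsupp_iff` applies to the sum of each pair. -/
theorem isExtensive_iff [Infinite F] (h : Facts X n) (h2 : (2 : F) ≠ 0)
    (hG : ExpGroup F (nilradical F X n)) (f : Dual F (nilradical F X n)) :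
    IsExtensive f ↔ ∀ u ∈ uppers X n, ∃ i < (cells X n).length, i ∈ mask u ∧
      f (vectorAt F X n i) ≠ 0 := by
  have rel : ∀ t ∈ relations X n, t.j < n → ∃ α β γ : PosRoot X n, α.number = t.i ∧
      β.number = t.j ∧ γ.number = t.k ∧ t.i < t.j ∧ γ.vec = α.vec + β.vec ∧
      α.vec ⬝ᵥ β.vec ≠ 0 ∧ (γ ∈ nsupp f ↔ ∃ i < (cells X n).length,
        i ∈ mask (upper (relations X n) t.k) ∧ f (vectorAt F X n i) ≠ 0) := by
    intro t ht htn
    obtain ⟨α, β, γ, h3, h4, h5, h6, -⟩ := relation_spec h h2 ht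
    have hs := h.simpleRel t ht
    have hb : Nat.blt t.j n = true := Nat.ble_eq_true_of_le htn
    rw [simpleRelation, hb, Bool.not_true, Bool.false_or, Bool.and_eq_true, Bool.and_eq_true,
      Bool.not_eq_true', ← Bool.not_eq_true, isZero_eq_true] at hs
    obtain ⟨⟨h7, h8⟩, h9⟩ := hs
    refine ⟨α, β, γ, h3, h4, h5, h6, vec_add_of_additive h3 h4 h5 (h.add t ht), ?_, ?_⟩
    · rwa [← dotAt_eq, ← α.cellAt_number, ← β.cellAt_number, h3, h4]
    · rw [← h5] at h8 h9 ⊢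
      exact mem_nsupp_iff h h2 hG h8 h9
  simp only [uppers, List.mem_map, List.mem_filter]
  constructor
  · rintro hE _ ⟨t, ⟨ht, htn⟩, rfl⟩
    have htn' := Nat.le_of_ble_eq_true htn
    obtain ⟨α, β, γ, h3, h4, h5, h6, h7, h8, h9⟩ := rel t ht htn'
    rw [← h9]
    have hadj : Adjacent α β := ⟨fun e => by rw [← h3, ← h4, e] at h6; exact h6.false, h8⟩
    obtain ⟨-, γ', hγ', hv⟩ := (hE α β ((isSimpleRoot_iff h h2 α).2 (by omega))
      ((isSimpleRoot_iff h h2 β).2 (by omega))).1 hadj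
    rwa [vec_injective h (h7.trans hv.symm)]
  · intro hu α β hα hβ
    refine ⟨fun hadj => ⟨hadj, ?_⟩, fun hadj => hadj.1⟩
    have key : ∀ {α β : PosRoot X n}, β.number < n → α.vec ⬝ᵥ β.vec ≠ 0 →
        α.number < β.number → ∃ γ ∈ nsupp f, γ.vec = α.vec + β.vec := by
      intro α β hβ hdot hαβ
      have hs := pairwise_numbered h.simpleAdj hαβ
      have hb : Nat.blt β.number n = true := Nat.ble_eq_true_of_le hβ
      have hd : isZero (dotAt X n α.cell β.cell) = false := by
        rw [← Bool.not_eq_true, isZero_eq_true, dotAt_eq]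
        exact hdot
      simp only [simpleAdjacent, hb, hd, Bool.not_true, Bool.false_or, anyL_eq_true,
        Bool.and_eq_true, Nat.beq_eq] at hs
      obtain ⟨t, ht, hti, htj⟩ := hs
      obtain ⟨α', β', γ, h3, h4, h5, h6, h7, h8, h9⟩ := rel t ht (by omega)
      obtain rfl := PosRoot.number_injective (h3.trans hti)
      obtain rfl := PosRoot.number_injective (h4.trans htj)
      exact ⟨γ, h9.2 (hu _ ⟨t, ⟨ht, Nat.ble_eq_true_of_le (by omega)⟩, rfl⟩), h7⟩
    rw [isSimpleRoot_iff h h2] at hα hβ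
    rcases lt_trichotomy α.number β.number with hlt | heq | hlt
    · exact key hβ hadj.2 hlt
    · exact absurd (PosRoot.number_injective heq) hadj.1
    · rw [add_comm]
      exact key hα (by rw [dotProduct_comm]; exact hadj.2) hlt

theorem isExtensive_of_mem_orbit {f f' : Dual F (nilradical F X n)} (hf : f' ∈ coadjointOrbit f)
    (hE : IsExtensive f) : IsExtensive f' := by
  have : nsupp f' = nsupp f := by rw [nsupp, nsupp, orbit_eq hf]
  intro α β hα hβ
  rw [FAdjacent, this]
  exact hE α β hα hβ

theorem setting [IsAlgClosed F] (h : Facts X n)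
    (hF : ringChar F = 0 ∨ finrank F (simpleLie F X n) < ringChar F) :
    Setting (F := F) (vectorAt F X n) (cells X n).length IsExtensive (uppers X n) := by
  have : Infinite F := IsAlgClosed.instInfinite
  have h2 := two_ne_zero' h hF
  have hG := expGroup_of_facts h hF
  refine ⟨hG, h2, span_vectorAt h2, fun f f' hf => ?_, fun f f' => isExtensive_of_mem_orbit,
    isExtensive_iff h h2 hG⟩
  -- The rank is constant along the orbit because it is the dimension of the orbit.
  have e : orbitDim f' = orbitDim f := by rw [orbitDim, orbitDim, orbit_eq hf]
  rw [orbitDim_eq h hF, orbitDim_eq h hF] at e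
  exact_mod_cast e

end Extensive

/-! ### Strings -/

section Strings

/-- The digits of `s` fill the low bits from the left, and the accumulator is shifted up by their
number. -/
theorem testBit_digitMask (fuel : ℕ) : ∀ s acc i : ℕ, s < 10 ^ fuel →
    (digitMask fuel s acc).testBit i = if h : i < (Nat.digits 10 s).length then
      decide ((Nat.digits 10 s).reverse[i]'(by simpa using h) = 1)
      else acc.testBit (i - (Nat.digits 10 s).length) := by
  induction fuel with
  | zero =>
    intro s acc i hs
    obtain rfl : s = 0 := by simpa using hs
    simp [digitMask]
  | succ fuel ih =>
    intro s acc i hs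
    rcases Nat.eq_zero_or_pos s with rfl | hpos
    · simp [digitMask]
    · have e : digitMask (fuel + 1) s acc =
          digitMask fuel (s / 10) (2 * acc + if Nat.beq (s % 10) 1 then 1 else 0) := by
        rw [digitMask, if_neg]
        simpa using hpos.ne'
      rw [e, ih _ _ _ (by rw [pow_succ] at hs; omega)]
      have hd : Nat.digits 10 s = s % 10 :: Nat.digits 10 (s / 10) :=
        Nat.digits_def' (by norm_num) hpos
      simp only [hd, List.reverse_cons, List.length_cons]
      rcases lt_trichotomy i (Nat.digits 10 (s / 10)).length with hlt | heq | hlt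
      · rw [dif_pos hlt, dif_pos (by omega), List.getElem_append_left (by simpa using hlt)]
      · subst heq
        rw [dif_neg (lt_irrefl _), dif_pos (by omega), List.getElem_append_right (by simp)]
        simp only [List.length_reverse, Nat.sub_self, List.getElem_cons_zero, Nat.testBit_zero,
          Nat.beq_eq]
        split_ifs with h1 <;> simp [h1]
      · rw [dif_neg (by omega), dif_neg (by omega)]
        obtain ⟨j, rfl⟩ := Nat.exists_eq_add_of_lt hlt
        rw [show (Nat.digits 10 (s / 10)).length + j + 1 - (Nat.digits 10 (s / 10)).length = j + 1
          by omega, show (Nat.digits 10 (s / 10)).length + j + 1 -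
          ((Nat.digits 10 (s / 10)).length + 1) = j by omega, Nat.testBit_succ]
        congr 1
        split_ifs <;> omega

theorem Letter.ofDigit_eq_S {d : ℕ} : Letter.ofDigit d = Letter.S ↔ d = 1 := by
  unfold Letter.ofDigit
  split <;> simp_all

theorem letterAt_eq_S {s : ℕ} (hs : s < 10 ^ 60) (k : ℕ) :
    letterAt s k = Letter.S ↔ k ∈ mask (digitMask 60 s 0) := by
  rw [mem_mask, bit_eq, testBit_digitMask 60 s 0 k hs, letterAt, letters]
  split_ifs with h
  · rw [List.getD_eq_getElem _ _ (by simpa using h), List.getElem_map, Letter.ofDigit_eq_S,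
      decide_eq_true_iff]
  · rw [List.getD_eq_default _ _ (by simpa using h)]
    simp

variable {F : Type*} [Field F] {X : ClassicalType} {n : ℕ}

theorem mem_formsWithSupport_iff (h : Facts X n) {s : ℕ} (hs : s ∈ strings X n)
    (f : Dual F (nilradical F X n)) : f ∈ formsWithSupport F (stringSupport X n s) ↔
      HasSupport (vectorAt F X n) (cells X n).length f (digitMask 60 s 0) := by
  have key : ∀ α : PosRoot X n, α ∈ stringSupport X n s ↔ α.number ∈ mask (digitMask 60 s 0) :=
    fun α => by rw [← letterAt_eq_S (h.length s hs), ← h.index_eq]; rfl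
  constructor
  · intro hf i hi
    obtain ⟨α, rfl, -⟩ := h.exists_number hi
    rw [vectorAt_number, ← key, ← show supp f = stringSupport X n s from hf]
    rfl
  · intro hf
    refine Set.ext fun α => ?_
    rw [key, ← hf _ α.number_lt, vectorAt_number]
    rfl

/-- The form determines the bits at the positions of roots; the check `bound` excludes any others.
-/
theorem eq_of_hasSupport (h : Facts X n) {f : Dual F (nilradical F X n)} {S T : ℕ}
    (hS : S ∈ supports X n) (hT : T ∈ supports X n)
    (hfS : HasSupport (vectorAt F X n) (cells X n).length f S)
    (hfT : HasSupport (vectorAt F X n) (cells X n).length f T) : S = T := by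
  refine Nat.eq_of_testBit_eq fun i => ?_
  by_cases hi : i < (cells X n).length
  · rw [Bool.eq_iff_iff, ← bit_eq, ← bit_eq, ← mem_mask, ← mem_mask, ← hfS i hi, ← hfT i hi]
  · have key : ∀ U ∈ supports X n, U.testBit i = false := fun U hU =>
      Nat.testBit_lt_two_pow ((h.bound U hU).trans_le
        (Nat.pow_le_pow_right two_pos (not_lt.1 hi)))
    rw [key S hS, key T hT]

end Strings

/-! ### The classification, given the two finite checks -/

section Classification

variable {F : Type*} [Field F] [IsAlgClosed F] {X : ClassicalType} {n : ℕ}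

theorem solved_of_classified (h : Facts X n) (hc : classified X n = true)
    (hF : ringChar F = 0 ∨ finrank F (simpleLie F X n) < ringChar F) :
    Solved (F := F) (vectorAt F X n) (cells X n).length IsExtensive
      (Set.Iio (cells X n).length) (Set.Iio (cells X n).length) ∅ (supports X n) := by
  have := classify_sound (setting h hF) 60 _ _ _ _ _ _ (reduced_initial h (two_ne_zero' h hF)) hc
  rwa [mask_full, mask_zero] at this

theorem classification (h : Facts X n) (hc : classified X n = true)
    (hF : ringChar F = 0 ∨ finrank F (simpleLie F X n) < ringChar F) :
    ((strings X n).Pairwise fun s t =>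
      Disjoint (formsWithSupport F (stringSupport X n s))
        (formsWithSupport F (stringSupport X n t))) ∧
    (∀ s ∈ strings X n, ∀ f ∈ formsWithSupport F (stringSupport X n s),
      IsExtensive f ∧ orbitDim f = 6) ∧
    (∀ f : Dual F (nilradical F X n), IsExtensive f → orbitDim f = 6 →
      ∃! f' : Dual F (nilradical F X n), f' ∈ coadjointOrbit f ∧
        ∃ s ∈ strings X n, f' ∈ formsWithSupport F (stringSupport X n s)) := by
  have hs := solved_of_classified h hc hF
  have hfit : ∀ f : Dual F (nilradical F X n), Fits (vectorAt F X n) (Set.Iio (cells X n).length)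
      (Set.Iio (cells X n).length) ∅ f := fun f =>
    ⟨fun i hi hi' => absurd hi hi', fun i hi => absurd hi (Set.notMem_empty i)⟩
  have hmem : ∀ s ∈ strings X n, digitMask 60 s 0 ∈ supports X n := fun s hs =>
    List.mem_map_of_mem hs
  have hdim : ∀ f : Dual F (nilradical F X n), orbitDim f = 6 ↔ kirillovRank f = 6 := fun f => by
    rw [orbitDim_eq h hF]
    norm_cast
  refine ⟨?_, fun s hsm f hf => ?_, fun f hE hd => ?_⟩
  · have hp := h.distinct
    rw [supports, List.pairwise_map] at hp
    refine hp.imp_of_mem fun {s t} hsm htm hne => Set.disjoint_left.2 fun f hfs hft => ?_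
    rw [eq_of_hasSupport h (hmem s hsm) (hmem t htm) ((mem_formsWithSupport_iff h hsm f).1 hfs)
      ((mem_formsWithSupport_iff h htm f).1 hft)] at hne
    simp at hne
  · obtain ⟨h1, h2⟩ := hs.sound f (hfit f) _ (hmem s hsm) ((mem_formsWithSupport_iff h hsm f).1 hf)
    exact ⟨h2, (hdim f).2 h1⟩
  · obtain ⟨f', hf', T, hT, hfT⟩ := hs.exist f (hfit f) hE ((hdim f).1 hd)
    obtain ⟨s, hsm, rfl⟩ := List.mem_map.1 hT
    refine ⟨f', ⟨hf', s, hsm, (mem_formsWithSupport_iff h hsm f').2 hfT⟩, ?_⟩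
    rintro f'' ⟨hf'', t, htm, hft⟩
    -- Two representatives in one orbit are connected by some `exp (ad x)`. In the initial state the
    -- span of `P` is the whole algebra, so `unique` imposes no restriction on `x`.
    obtain ⟨x, hx⟩ := (expGroup_of_facts h hF).mem_orbit_iff.1
      (orbit_trans (orbit_symm hf') hf'')
    refine (hs.unique f' f'' (hfit f') (hfit f'') _ hT hfT _ (hmem t htm)
      ((mem_formsWithSupport_iff h htm f'').1 hft) x ?_ hx).symm
    rw [span_vectorAt (two_ne_zero' h hF)]
    trivial

end Classification

end ClassicalOrbits

/-! ### Evaluation of the finite checks for all types and ranks -/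

namespace ClassicalOrbits

theorem checked_of_admissible {X : ClassicalType} {n : ℕ} (hn : Admissible X n) :
    checked X n = true := by
  cases X <;> obtain ⟨h1, h2⟩ := hn <;> interval_cases n <;> decide +kernel

theorem classified_of_admissible {X : ClassicalType} {n : ℕ} (hn : Admissible X n) :
    classified X n = true := by
  cases X <;> obtain ⟨h1, h2⟩ := hn <;> interval_cases n <;> decide +kernel

end ClassicalOrbits

theorem theorem8p1 {F : Type*} [Field F] [IsAlgClosed F] (X : ClassicalType) (n : ℕ)
    (hn : Admissible X n)
    (hF : ringChar F = 0 ∨ Module.finrank F (simpleLie F X n) < ringChar F) :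
    ((strings X n).Pairwise fun s t =>
      Disjoint (formsWithSupport F (stringSupport X n s))
        (formsWithSupport F (stringSupport X n t))) ∧
    (∀ s ∈ strings X n, ∀ f ∈ formsWithSupport F (stringSupport X n s),
      IsExtensive f ∧ orbitDim f = 6) ∧
    (∀ f : Module.Dual F (nilradical F X n), IsExtensive f → orbitDim f = 6 →
      ∃! f' : Module.Dual F (nilradical F X n), f' ∈ coadjointOrbit f ∧
        ∃ s ∈ strings X n, f' ∈ formsWithSupport F (stringSupport X n s)) :=
  classification (facts_of_checked (checked_of_admissible hn)) (classified_of_admissible hn) hF
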